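/- Let $A,B\in\mathbb R$ satisfy $-1<A<0$, $-1<B<0$, $-2<A+B<-1$, and put $$\zeta_\pm=\frac{B^2-A^2\pm 4i\sqrt{(A+1)(B+1)(-A-B-1)}}{(A+B+2)^2},$$ $$\Gamma=\Big\{z\in\mathbb C:\ \operatorname{Re}\int_{\zeta_-}^z\frac{((t-\zeta_+)(t-\zeta_-))^{1/2}}{t^2-1}\,dt=0\Big\}$$ (the condition does not depend on the path of integration in $\mathbb C\setminus\{\pm1\}$ nor on the branch of the square root continued along it). The set $\Gamma$ is the union of three analytic arcs $\Gamma_L,\Gamma_C,\Gamma_R$ that join $\zeta_+$ and $\zeta_-$, have pairwise only these end points in common, and meet the real line in exactly one point each, lying in $(-\infty,-1)$, $(-1,1)$ and $(1,\infty)$, respectively. Orient $\Gamma_L$ and $\Gamma_C$ from $\zeta_+$ to $\zeta_-$ and $\Gamma_R$ from $\zeta_-$ to $\zeta_+$. Let $R(z)=((z-\zeta_+)(z-\zeta_-))^{1/2}$ be the branch that is analytic in $\mathbb C\setminus\Gamma_C$ with $R(z)\sim z$ as $z\to\infty$, and for $z\in\Gamma\setminus\{\zeta_+,\zeta_-\}$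 let $R_+(z)$ be its non-tangential boundary value from the left side of the oriented arc through $z$. All these objects exist, and for them the complex measure $$d\mu(z)=\frac{A+B+2}{2\pi i}\,\frac{R_+(z)}{z^2-1}\,dz\qquad\text{on }\Gamma$$ (with $dz$ taken according to the orientation) is positive, and $$\mu(\Gamma_L)=1+A>0,\qquad \mu(\Gamma_C)=-1-A-B>0,\qquad \mu(\Gamma_R)=1+B>0.$$ In particular, $\mu$ is a probability measure on $\Gamma$. -/

import Mathlib

open MeasureTheory Filter Topology

noncomputable section

namespace JacobiZeros

/-- The branch point in the upper half plane (for parameters in the admissible range). -/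
def zetaPlus (A B : ℝ) : ℂ :=
  ((B : ℂ) ^ 2 - (A : ℂ) ^ 2
    + 4 * Complex.I * (Real.sqrt ((A + 1) * (B + 1) * (-A - B - 1)) : ℂ))
    / ((A : ℂ) + (B : ℂ) + 2) ^ 2

/-- The branch point in the lower half plane (for parameters in the admissible range). -/
def zetaMinus (A B : ℝ) : ℂ :=
  ((B : ℂ) ^ 2 - (A : ℂ) ^ 2
    - 4 * Complex.I * (Real.sqrt ((A + 1) * (B + 1) * (-A - B - 1)) : ℂ))
    / ((A : ℂ) + (B : ℂ) + 2) ^ 2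

/-- The set `Γ` of all `z` with `Re ∫ ((t - ζ₊)(t - ζ₋))^{1/2} / (t² - 1) dt = 0`, the integral
being taken from `ζ₋` to `z` along a `C¹` path `p` on `[0, 1]` that avoids the poles `±1`
(and whose interior avoids the branch points), with `s` a continuous determination of the square
root along the path.  The vanishing of the real part depends neither on the path nor on the
determination. -/
def Gam (A B : ℝ) : Set ℂ :=
  {z | ∃ p s : ℝ → ℂ,
      ContDiff ℝ 1 p ∧ p 0 = zetaMinus A B ∧ p 1 = z ∧
      (∀ t ∈ Set.Icc (0 : ℝ) 1, p t ≠ 1 ∧ p t ≠ -1) ∧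
      (∀ t ∈ Set.Ioo (0 : ℝ) 1, p t ≠ zetaPlus A B ∧ p t ≠ zetaMinus A B) ∧
      ContinuousOn s (Set.Icc 0 1) ∧
      (∀ t ∈ Set.Icc (0 : ℝ) 1, s t ^ 2 = (p t - zetaPlus A B) * (p t - zetaMinus A B)) ∧
      (∫ t in (0 : ℝ)..1, s t / (p t ^ 2 - 1) * deriv p t).re = 0}

/-- `γ` is an injective path, regular and real-analytic between its end points. -/
structure IsAnalyticArc {a b : ℂ} (γ : Path a b) : Prop where
  injective : Function.Injective γ
  analytic : AnalyticOnNhd ℝ γ.extend (Set.Ioo 0 1)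
  regular : ∀ t ∈ Set.Ioo (0 : ℝ) 1, deriv γ.extend t ≠ 0

/-- `γL`, `γC`, `γR` are oriented parametrizations of the three arcs `Γ_L`, `Γ_C`, `Γ_R`
which make up `Γ`: the left and the central one run from `ζ₊` to `ζ₋`, the right one from `ζ₋`
to `ζ₊`; they meet the real line in one point each, lying in `(-∞, -1)`, `(-1, 1)` and `(1, ∞)`
respectively. -/
structure IsArcDecomposition (A B : ℝ)
    (γL γC : Path (zetaPlus A B) (zetaMinus A B))
    (γR : Path (zetaMinus A B) (zetaPlus A B)) : Prop where
  arcL : IsAnalyticArc γL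
  arcC : IsAnalyticArc γC
  arcR : IsAnalyticArc γR
  union : Set.range γL ∪ Set.range γC ∪ Set.range γR = Gam A B
  interLC : Set.range γL ∩ Set.range γC = {zetaPlus A B, zetaMinus A B}
  interLR : Set.range γL ∩ Set.range γR = {zetaPlus A B, zetaMinus A B}
  interCR : Set.range γC ∩ Set.range γR = {zetaPlus A B, zetaMinus A B}
  realL : ∃ x : ℝ, x < -1 ∧ Set.range γL ∩ {z : ℂ | z.im = 0} = {(x : ℂ)}
  realC : ∃ x : ℝ, -1 < x ∧ x < 1 ∧ Set.range γC ∩ {z : ℂ | z.im = 0} = {(x : ℂ)}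
  realR : ∃ x : ℝ, 1 < x ∧ Set.range γR ∩ {z : ℂ | z.im = 0} = {(x : ℂ)}

/-- `R` is, off the cut `K`, the analytic branch of `((z - ζ₊)(z - ζ₋))^{1/2}` with `R(z) ~ z` at
infinity.  (Its values on `K` are irrelevant.) -/
structure IsRootBranch (A B : ℝ) (K : Set ℂ) (R : ℂ → ℂ) : Prop where
  analytic : AnalyticOnNhd ℂ R Kᶜ
  sq : ∀ z ∈ Kᶜ, R z ^ 2 = (z - zetaPlus A B) * (z - zetaMinus A B)
  atInfinity : Tendsto (fun z => R z / z) (cocompact ℂ) (𝓝 1)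

/-- `f` has the non-tangential limit `c` at `γ t` from the left of the curve `γ`.  The
point `z` lies on the left of the tangent line when `(z - γ t) / γ'(t)` has positive imaginary
part; the parameter `κ` ranges over the apertures of the sectors symmetric about the left
normal (the sector is empty when `1 ≤ κ`). -/
def HasLeftLimit (γ : ℝ → ℂ) (f : ℂ → ℂ) (t : ℝ) (c : ℂ) : Prop :=
  ∀ κ : ℝ, 0 < κ →
    Tendsto f
      (𝓝[{z : ℂ | κ * ‖(z - γ t) / deriv γ t‖ < ((z - γ t) / deriv γ t).im}] (γ t)) (𝓝 c)

/-- `Rp` gives, at each point of the curve `γ` other than its end points, the boundary value of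
`R` from the `+` (left) side. -/
def IsPlusBoundaryValue {a b : ℂ} (γ : Path a b) (R Rp : ℂ → ℂ) : Prop :=
  ∀ t ∈ Set.Ioo (0 : ℝ) 1, HasLeftLimit γ.extend R t (Rp (γ.extend t))

/-- The complex measure `f(z) dz` on the oriented curve `γ`, as a complex measure on `ℂ`: the
image under `γ` of `f(γ(t)) γ'(t) dt` on `[0, 1]`. -/
def lineMeasure {a b : ℂ} (γ : Path a b) (f : ℂ → ℂ) : ComplexMeasure ℂ :=
  ((volume.restrict (Set.Icc (0 : ℝ) 1)).withDensityᵥ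
    (fun t => f (γ.extend t) * deriv γ.extend t)).map γ.extend

/-- The density `(A + B + 2) / (2πi) · R₊(z) / (z² - 1)`. -/
def density (A B : ℝ) (Rp : ℂ → ℂ) (z : ℂ) : ℂ :=
  ((A : ℂ) + (B : ℂ) + 2) / (2 * (Real.pi : ℂ) * Complex.I) * (Rp z / (z ^ 2 - 1))

/-- The complex measure `dμ(z) = (A + B + 2) / (2πi) · R₊(z) / (z² - 1) dz` on
`Γ = Γ_L ∪ Γ_C ∪ Γ_R`. -/
def mu (A B : ℝ) (γL γC : Path (zetaPlus A B) (zetaMinus A B))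
    (γR : Path (zetaMinus A B) (zetaPlus A B)) (Rp : ℂ → ℂ) : ComplexMeasure ℂ :=
  lineMeasure γL (density A B Rp) + lineMeasure γC (density A B Rp)
    + lineMeasure γR (density A B Rp)

end JacobiZeros

end

/-! The numbers c₁ = -A, c₂ = -B, c₃ = A + B + 2 satisfy the strict triangle inequalities because A
> -1, B > -1 and A + B < -1, and ζ₊ is the apex of the similar triangle with base [-1, 1]. The
Möbius map `mob` with ζ₊ ↦ 0, ζ₋ ↦ ∞, ∞ ↦ 1 sends these three marked points 1, -1, ∞ to the squares
nⱼ² of the unit vectors along the sides. On the double cover w² = `mob z` the root is R = w (z -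
ζ₋), and c₃ R dz / (z² - 1) becomes -G(w) dw, where G has simple poles ±nⱼ with residues ∓cⱼ
(`G_eq_of_sq`). So away from the branch points Γ is the zero set of H(w) = ∑ cⱼ log |(w + nⱼ) / (w -
nⱼ)| (`re_integral_eq`, `Gam_eq`).

Write w = exp (x + iθ). For fixed x the potential changes sign under θ ↦ θ + π, and the closing
condition ∑ cⱼ nⱼ = 0 collapses its θ-derivative to the imaginary part of K / (S₀ S₁ S₂). For x ≠ 0
critical angles therefore solve a cubic in exp (2iθ), so fewer than four fit in a window shorter
than π (`Uθ_four_zeros`). At the bisectors of the three directions the closing condition and the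
convexity of artanh determine the sign, and these signs alternate. By Rolle there is room for just
one zero, a simple one, in each of three sectors. On x = 0, where the poles lie, monotonicity
between poles does the same. The implicit function theorem makes the zeros three analytic graphs θ =
`ang k x` over x ∈ ℝ, running from ζ₊ (x = -∞) to ζ₋ (x = ∞) and meeting the real line (x = 0) once.

By connectedness every arc of an arbitrary decomposition reparametrizes one of these curves
(`exists_follows`), and its real crossing tells which one. The branch R is pinned down by its
behaviour at infinity, and its left boundary values are ±(z - ζ₋) w. Along a curve H vanishes, so G
dw is purely imaginary and the density of μ is a real multiple of the derivative of a phase. This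
derivative has no zero, so the phase is monotone, and its total change π ∑ ±cⱼ is read off at w = 0
and w = ∞. The masses come out as half of -c₁ + c₂ + c₃, c₁ + c₂ - c₃ and c₁ - c₂ + c₃: their
positivity is again the triangle inequality, and their sum is half the perimeter, namely 1. -/

noncomputable section

namespace JacobiZeros

/-! ### The triangle and its potential in polar coordinates -/

/-- Side lengths and two angles of a Euclidean triangle: `P` and `Q` are the interior angles at the
end points of the side `c₃`. -/
structure Triangle where
  (c₁ c₂ c₃ P Q : ℝ)
  c₁_pos : 0 < c₁
  c₂_pos : 0 < c₂
  c₃_pos : 0 < c₃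
  P_pos : 0 < P
  Q_pos : 0 < Q
  add_lt_pi : P + Q < Real.pi
  close_re : c₁ * Real.cos P + c₂ * Real.cos Q = c₃
  close_im : c₁ * Real.sin P = c₂ * Real.sin Q

namespace Triangle

variable (T : Triangle)

/-- The side lengths. -/
def c : Fin 3 → ℝ := ![T.c₁, T.c₂, T.c₃]

/-- The directions of the sides, run through cyclically. -/
def α : Fin 3 → ℝ := ![-T.P, T.Q, Real.pi]

/-- The unit vectors along the sides. -/
def n (j : Fin 3) : ℂ := Complex.exp (T.α j * Complex.I)

lemma c_pos (j : Fin 3) : 0 < T.c j := by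
  have h1 := T.c₁_pos
  have h2 := T.c₂_pos
  have h3 := T.c₃_pos
  fin_cases j <;> simpa [c]

lemma sin_P_pos : 0 < Real.sin T.P :=
  Real.sin_pos_of_pos_of_lt_pi T.P_pos (by linarith [T.Q_pos, T.add_lt_pi])

lemma sin_Q_pos : 0 < Real.sin T.Q :=
  Real.sin_pos_of_pos_of_lt_pi T.Q_pos (by linarith [T.P_pos, T.add_lt_pi])

lemma sin_add_pos : 0 < Real.sin (T.P + T.Q) :=
  Real.sin_pos_of_pos_of_lt_pi (by linarith [T.P_pos, T.Q_pos]) T.add_lt_pi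

/-- The sides, run through cyclically, add up to the zero vector; this is the projection of that sum
to the direction θ. -/
lemma sum_c_mul_cos (θ : ℝ) : ∑ j, T.c j * Real.cos (θ - T.α j) = 0 := by
  simp only [Fin.sum_univ_three, c, α, Matrix.cons_val_zero, Matrix.cons_val_one, Matrix.cons_val,
    Real.cos_sub, Real.cos_neg, Real.sin_neg, Real.cos_pi, Real.sin_pi]
  linear_combination (Real.cos θ) * T.close_re - Real.sin θ * T.close_im

/-- The potential `∑ cⱼ artanh (cos (θ - αⱼ) / cosh x)`. -/
def U (x θ : ℝ) : ℝ :=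
  ∑ j, T.c j / 2 * (Real.log (Real.cosh x + Real.cos (θ - T.α j))
    - Real.log (Real.cosh x - Real.cos (θ - T.α j)))

/-- The points at which the potential is finite. -/
def Reg (x θ : ℝ) : Prop := ∀ j, Real.sin (θ - T.α j) ^ 2 + Real.sinh x ^ 2 ≠ 0

variable {T}

lemma reg_of_ne {x : ℝ} (hx : x ≠ 0) (θ : ℝ) : T.Reg x θ := fun j => by
  have := sq_nonneg (Real.sin (θ - T.α j))
  have h2 : 0 < Real.sinh x ^ 2 := by
    have := Real.sinh_ne_zero.mpr hx
    positivity
  linarith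

lemma reg_zero {θ : ℝ} (h : ∀ j, Real.sin (θ - T.α j) ≠ 0) : T.Reg 0 θ := fun j => by
  simpa using h j

lemma Reg.add_pos {x θ : ℝ} (h : T.Reg x θ) (j : Fin 3) :
    0 < Real.cosh x + Real.cos (θ - T.α j) := by
  have h0 := h j
  have h1 := Real.cosh_sq x
  have h2 := Real.sin_sq_add_cos_sq (θ - T.α j)
  have h3 := Real.one_le_cosh x
  have h4 := Real.neg_one_le_cos (θ - T.α j)
  rcases (show 0 ≤ Real.cosh x + Real.cos (θ - T.α j) by linarith).lt_or_eq with h5 | h5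
  · exact h5
  · exfalso; apply h0
    have : Real.cos (θ - T.α j) = - Real.cosh x := by linarith
    rw [this] at h2
    linarith [h1, h2, neg_sq (Real.cosh x)]

lemma Reg.sub_pos {x θ : ℝ} (h : T.Reg x θ) (j : Fin 3) :
    0 < Real.cosh x - Real.cos (θ - T.α j) := by
  have h0 := h j
  have h1 := Real.cosh_sq x
  have h2 := Real.sin_sq_add_cos_sq (θ - T.α j)
  have h3 := Real.one_le_cosh x
  have h4 := Real.cos_le_one (θ - T.α j)
  rcases (show 0 ≤ Real.cosh x - Real.cos (θ - T.α j) by linarith).lt_or_eq with h5 | h5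
  · exact h5
  · exfalso; apply h0
    have : Real.cos (θ - T.α j) = Real.cosh x := by linarith
    rw [this] at h2
    linarith [h1, h2]

lemma Reg.add_pi {x θ : ℝ} (h : T.Reg x θ) : T.Reg x (θ + Real.pi) := fun j => by
  rw [show θ + Real.pi - T.α j = θ - T.α j + Real.pi by ring, Real.sin_add_pi, neg_sq]
  exact h j

variable (T)

/-- A half turn replaces w by -w, that is, exchanges the two square roots. Hence the zero set is
π-periodic in θ and descends to the variable `mob z = w²`. -/
lemma U_add_pi (x θ : ℝ) : T.U x (θ + Real.pi) = - T.U x θ := by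
  simp only [U, ← Finset.sum_neg_distrib]
  refine Finset.sum_congr rfl fun j _ => ?_
  rw [show θ + Real.pi - T.α j = θ - T.α j + Real.pi by ring, Real.cos_add_pi]
  ring_nf

/-- The angular derivative of the potential. -/
def Uθ (x θ : ℝ) : ℝ :=
  - ∑ j, T.c j * (Real.cosh x * Real.sin (θ - T.α j)
    / (Real.sin (θ - T.α j) ^ 2 + Real.sinh x ^ 2))

variable {T}

lemma hasDerivAt_U {x θ : ℝ} (h : T.Reg x θ) : HasDerivAt (T.U x) (T.Uθ x θ) θ := by
  have : ∀ j ∈ Finset.univ, HasDerivAt (fun θ => T.c j / 2 *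
      (Real.log (Real.cosh x + Real.cos (θ - T.α j))
      - Real.log (Real.cosh x - Real.cos (θ - T.α j))))
      (- (T.c j * (Real.cosh x * Real.sin (θ - T.α j)
    / (Real.sin (θ - T.α j) ^ 2 + Real.sinh x ^ 2)))) θ := by
    intro j _
    have h1 := h.add_pos j
    have h2 := h.sub_pos j
    have hc : HasDerivAt (fun θ => Real.cos (θ - T.α j)) (- Real.sin (θ - T.α j)) θ := by
      simpa using ((hasDerivAt_id θ).sub_const (T.α j)).cos
    have := (((hc.const_add (Real.cosh x)).log h1.ne').sub
      ((hc.const_sub (Real.cosh x)).log h2.ne')).const_mul (T.c j / 2)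
    refine this.congr_deriv ?_
    -- With cosh² - sinh² = 1 the common denominator of the two logarithmic derivatives is the
    -- squared modulus of sinh (x + i (θ - αⱼ)).
    have h3 : Real.sin (θ - T.α j) ^ 2 + Real.sinh x ^ 2
        = (Real.cosh x + Real.cos (θ - T.α j)) * (Real.cosh x - Real.cos (θ - T.α j)) := by
      have h1 := Real.cosh_sq x
      have h2 := Real.sin_sq_add_cos_sq (θ - T.α j)
      linear_combination h2 - h1
    rw [h3]
    field_simp
    ring
  have := HasDerivAt.fun_sum this
  rw [Finset.sum_neg_distrib] at this
  exact this

/-! ### The critical points of the potential -/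

lemma n_ne_zero (j : Fin 3) : T.n j ≠ 0 := Complex.exp_ne_zero _

lemma sinh_eq (x τ : ℝ) : Complex.sinh (x + τ * Complex.I)
    = Real.sinh x * Real.cos τ + Real.cosh x * Real.sin τ * Complex.I := by
  rw [Complex.sinh_add, Complex.cosh_mul_I, Complex.sinh_mul_I]
  push_cast; ring

/-- The factors of the denominator of the derivative of the complex potential. -/
def S (T : Triangle) (x θ : ℝ) (j : Fin 3) : ℂ := Complex.sinh (x + (θ - T.α j : ℝ) * Complex.I)

lemma S_re (x θ : ℝ) (j : Fin 3) : (T.S x θ j).re = Real.sinh x * Real.cos (θ - T.α j) := by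
  rw [S, sinh_eq]; 
  simp [-Complex.ofReal_sinh, -Complex.ofReal_cosh, -Complex.ofReal_sin, -Complex.ofReal_cos,
    ← Complex.ofReal_mul]

lemma S_im (x θ : ℝ) (j : Fin 3) : (T.S x θ j).im = Real.cosh x * Real.sin (θ - T.α j) := by
  rw [S, sinh_eq]; 
  simp [-Complex.ofReal_sinh, -Complex.ofReal_cosh, -Complex.ofReal_sin, -Complex.ofReal_cos,
    ← Complex.ofReal_mul]

lemma normSq_S (x θ : ℝ) (j : Fin 3) :
    Complex.normSq (T.S x θ j) = Real.sin (θ - T.α j) ^ 2 + Real.sinh x ^ 2 := by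
  rw [Complex.normSq_apply, S_re, S_im]
  have h1 := Real.cosh_sq x
  have h2 := Real.sin_sq_add_cos_sq (θ - T.α j)
  linear_combination Real.sin (θ - T.α j) ^ 2 * h1 + Real.sinh x ^ 2 * h2

lemma Reg.S_ne_zero {x θ : ℝ} (h : T.Reg x θ) (j : Fin 3) : T.S x θ j ≠ 0 := by
  intro h0
  have := normSq_S (T := T) x θ j
  rw [h0] at this
  exact h j (by simpa using this.symm)

variable (T) in
/-- The constant in the partial fraction decomposition `∑ cⱼ / Sⱼ = K / (S₀ S₁ S₂)`. -/
def K : ℝ := T.c₃ * Real.sin T.P * Real.sin T.Q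

lemma K_pos : 0 < T.K := mul_pos (mul_pos T.c₃_pos T.sin_P_pos) T.sin_Q_pos

/-- With u = x + iθ the left side is a combination of exp (2u), exp (-2u) and a constant. The
coefficient of exp (2u) is a multiple of ∑ cⱼ nⱼ, that of exp (-2u) a multiple of its conjugate, and
both vanish because the triangle closes. Only the constant remains. -/
lemma sum_c_mul_S (x θ : ℝ) :
    T.c 0 * (T.S x θ 1 * T.S x θ 2) + T.c 1 * (T.S x θ 0 * T.S x θ 2)
      + T.c 2 * (T.S x θ 0 * T.S x θ 1) = T.K := by
  have hP := Real.sin_sq_add_cos_sq T.P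
  have hQ := Real.sin_sq_add_cos_sq T.Q
  have hθ := Real.sin_sq_add_cos_sq θ
  have hx := Real.cosh_sq x
  have e1 := T.close_re
  have e2 := T.close_im
  apply Complex.ext
  · simp only [Complex.add_re, Complex.mul_re, S_re, S_im, Complex.ofReal_re, Complex.ofReal_im,
      c, α, K, Matrix.cons_val_zero, Matrix.cons_val_one, Matrix.cons_val,
      Real.sin_sub, Real.cos_sub, Real.cos_neg, Real.sin_neg, Real.cos_pi, Real.sin_pi]
    generalize Real.cos T.P = p at *
    generalize Real.cos T.Q = q at *
    generalize Real.sin T.P = s at *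
    generalize Real.sin T.Q = t at *
    generalize Real.cos θ = C at *
    generalize Real.sin θ = S at *
    generalize Real.cosh x = ch at *
    generalize Real.sinh x = sh at *
    -- `A1` and `A2` are the real and imaginary parts of the closing relation c₁ exp (-iP) + c₂ exp
    -- (iQ) = c₃ after multiplication by exp (i (P - Q)).
    have A1 : T.c₁ * q + T.c₂ * p = T.c₃ * (p * q + s * t) := by
      linear_combination (p * q + s * t) * e1 + (q * s - p * t) * e2 - T.c₁ * q * hP - T.c₂ * p * hQ
    have A2 : - T.c₁ * t + T.c₂ * s = T.c₃ * (s * q - p * t) := by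
      linear_combination (s * q - p * t) * e1 + (- t * s - p * q) * e2 + T.c₁ * t * hP
        - T.c₂ * s * hQ
    linear_combination (ch ^ 2 - 1 / 2) * (-(C ^ 2 - S ^ 2) * A1 + 2 * S * C * A2) + 1 / 2 * A1
      - 1 / 2 * (- T.c₁ * q - T.c₂ * p + T.c₃ * (p * q - s * t)) * hθ
      - (T.c₁ * ((C * q + S * t) * (-C)) + T.c₂ * ((C * p - S * s) * (-C))
        + T.c₃ * ((C * p - S * s) * (C * q + S * t))) * hx
  · simp only [Complex.add_im, Complex.mul_im, Complex.mul_re, S_re, S_im, Complex.ofReal_re,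
      Complex.ofReal_im,
      c, α, Matrix.cons_val_zero, Matrix.cons_val_one, Matrix.cons_val,
      Real.sin_sub, Real.cos_sub, Real.cos_neg, Real.sin_neg, Real.cos_pi, Real.sin_pi]
    generalize Real.cos T.P = p at *
    generalize Real.cos T.Q = q at *
    generalize Real.sin T.P = s at *
    generalize Real.sin T.Q = t at *
    generalize Real.cos θ = C at *
    generalize Real.sin θ = S at *
    generalize Real.cosh x = ch at *
    generalize Real.sinh x = sh at *
    have A1 : T.c₁ * q + T.c₂ * p = T.c₃ * (p * q + s * t) := by
      linear_combination (p * q + s * t) * e1 + (q * s - p * t) * e2 - T.c₁ * q * hP - T.c₂ * p * hQ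
    have A2 : - T.c₁ * t + T.c₂ * s = T.c₃ * (s * q - p * t) := by
      linear_combination (s * q - p * t) * e1 + (- t * s - p * q) * e2 + T.c₁ * t * hP
        - T.c₂ * s * hQ
    linear_combination - (2 * S * C) * sh * ch * A1 - (C ^ 2 - S ^ 2) * sh * ch * A2

/-- The derivative is the imaginary part of ∑ cⱼ / Sⱼ; by `sum_c_mul_S` the numerator over the
common denominator is the constant `K`. -/
lemma Uθ_eq {x θ : ℝ} (h : T.Reg x θ) : T.Uθ x θ
    = - T.K * (T.S x θ 0 * T.S x θ 1 * T.S x θ 2).im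
      / Complex.normSq (T.S x θ 0 * T.S x θ 1 * T.S x θ 2) := by
  have h0 := h.S_ne_zero 0
  have h1 := h.S_ne_zero 1
  have h2 := h.S_ne_zero 2
  have key : ∑ j, T.c j / T.S x θ j = T.K / (T.S x θ 0 * T.S x θ 1 * T.S x θ 2) := by
    rw [← sum_c_mul_S x θ, Fin.sum_univ_three]
    field_simp
    try ring
  have h3 := congrArg Complex.im key
  rw [Complex.im_sum, Complex.div_im] at h3
  simp only [Complex.ofReal_im, zero_mul, zero_div, Complex.ofReal_re, zero_sub] at h3
  rw [neg_mul, neg_div, ← h3, Uθ, ← Finset.sum_neg_distrib]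
  refine Finset.sum_congr rfl fun j _ => ?_
  rw [Complex.div_im, normSq_S, S_re, S_im]
  simp
  ring

lemma two_mul_S (x θ : ℝ) (j : Fin 3) :
    2 * T.S x θ j * (Complex.exp x * Complex.exp (θ * Complex.I) * T.n j)
      = Complex.exp x ^ 2 * Complex.exp (θ * Complex.I) ^ 2 - T.n j ^ 2 := by
  have : T.S x θ j = (Complex.exp x * Complex.exp (θ * Complex.I) * (T.n j)⁻¹
      - (Complex.exp x)⁻¹ * (Complex.exp (θ * Complex.I))⁻¹ * T.n j) / 2 := by
    rw [S, Complex.sinh, n, ← Complex.exp_neg, ← Complex.exp_neg, ← Complex.exp_neg,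
      ← Complex.exp_add, ← Complex.exp_add, ← Complex.exp_add, ← Complex.exp_add]
    push_cast
    ring_nf
  rw [this]
  have := n_ne_zero (T := T) j
  have := Complex.exp_ne_zero (x : ℂ)
  have := Complex.exp_ne_zero (θ * Complex.I)
  field_simp

lemma two_mul_conj_S (x θ : ℝ) (j : Fin 3) :
    2 * (starRingEnd ℂ) (T.S x θ j) * (Complex.exp x * Complex.exp (θ * Complex.I) * T.n j)
      = Complex.exp x ^ 2 * T.n j ^ 2 - Complex.exp (θ * Complex.I) ^ 2 := by
  have : (starRingEnd ℂ) (T.S x θ j) = (Complex.exp x * (Complex.exp (θ * Complex.I))⁻¹ * (T.n j)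
      - (Complex.exp x)⁻¹ * (Complex.exp (θ * Complex.I)) * (T.n j)⁻¹) / 2 := by
    rw [S, ← Complex.sinh_conj, Complex.sinh, n, ← Complex.exp_neg, ← Complex.exp_neg,
      ← Complex.exp_neg,
      ← Complex.exp_add, ← Complex.exp_add, ← Complex.exp_add, ← Complex.exp_add]
    simp only [map_add, map_mul, Complex.conj_ofReal, Complex.conj_I]
    push_cast
    ring_nf
  rw [this]
  have := n_ne_zero (T := T) j
  have := Complex.exp_ne_zero (x : ℂ)
  have := Complex.exp_ne_zero (θ * Complex.I)
  field_simp

/-- At a critical point S₀ S₁ S₂ is real. Equating the product with its conjugate and clearing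
exponentials gives an equation that is cubic in exp (2iθ). -/
lemma cubic_of_Uθ_eq_zero {x θ : ℝ} (h : T.Reg x θ) (h0 : T.Uθ x θ = 0) :
    ∏ j, (Complex.exp x ^ 2 * Complex.exp (θ * Complex.I) ^ 2 - T.n j ^ 2)
      = ∏ j, (Complex.exp x ^ 2 * T.n j ^ 2 - Complex.exp (θ * Complex.I) ^ 2) := by
  rw [Uθ_eq h, div_eq_zero_iff] at h0
  have hne : T.S x θ 0 * T.S x θ 1 * T.S x θ 2 ≠ 0 :=
    mul_ne_zero (mul_ne_zero (h.S_ne_zero 0) (h.S_ne_zero 1)) (h.S_ne_zero 2)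
  have him : (T.S x θ 0 * T.S x θ 1 * T.S x θ 2).im = 0 := by
    rcases h0 with h0 | h0
    · exact (mul_eq_zero.mp h0).resolve_left (neg_ne_zero.mpr K_pos.ne')
    · exact absurd (Complex.normSq_eq_zero.mp h0) hne
  have hc := Complex.conj_eq_iff_im.mpr him
  rw [map_mul, map_mul] at hc
  simp only [← two_mul_S, ← two_mul_conj_S, Fin.prod_univ_three]
  linear_combination (-8 * (Complex.exp x * Complex.exp (θ * Complex.I)) ^ 3
    * (T.n 0 * T.n 1 * T.n 2)) * hc

end Triangle

end JacobiZeros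

end

/-! ### Off the unit circle: one simple zero in each sector -/

noncomputable section

namespace JacobiZeros

/-- `2 artanh (y / r)`. -/
def logRatio (r y : ℝ) : ℝ := Real.log (r + y) - Real.log (r - y)

lemma logRatio_neg (r y : ℝ) : logRatio r (-y) = - logRatio r y := by
  simp [logRatio, sub_eq_add_neg, add_comm]

/-- `logRatio r` is strictly convex on [0, r) and vanishes at 0, so its quotient by the argument is
strictly increasing. -/
lemma logRatio_lt {r t τ : ℝ} (ht : 0 < t) (htτ : t < τ) (hτ : τ < r) :
    τ * logRatio r t < t * logRatio r τ := by
  have hder : ∀ s ∈ Set.Ico 0 r, HasDerivAt (logRatio r) (1 / (r + s) + 1 / (r - s)) s := by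
    intro s hs
    have h1 : r + s ≠ 0 := by linarith [hs.1, hs.2]
    have h2 : r - s ≠ 0 := by linarith [hs.1, hs.2]
    have := (((hasDerivAt_id s).const_add r).log h1).sub (((hasDerivAt_id s).const_sub r).log h2)
    refine this.congr_deriv ?_
    simp only [id]
    ring
  have hconv : StrictConvexOn ℝ (Set.Ico 0 r) (logRatio r) := by
    refine StrictMonoOn.strictConvexOn_of_deriv (convex_Ico _ _)
      (fun s hs => (hder s hs).continuousAt.continuousWithinAt) ?_
    rw [interior_Ico]
    intro s hs s' hs' hss
    rw [(hder s ⟨hs.1.le, hs.2⟩).deriv, (hder s' ⟨hs'.1.le, hs'.2⟩).deriv]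
    obtain ⟨h1, h2⟩ := hs
    obtain ⟨h3, h4⟩ := hs'
    have e1 : 0 < r - s := by linarith
    have e2 : 0 < r - s' := by linarith
    have e3 : 0 < r + s := by linarith
    have e4 : 0 < r + s' := by linarith
    rw [div_add_div _ _ e3.ne' e1.ne', div_add_div _ _ e4.ne' e2.ne',
      div_lt_div_iff₀ (by positivity) (by positivity)]
    have : s ^ 2 < s' ^ 2 := by nlinarith
    nlinarith
  have hτ0 : 0 < τ := ht.trans htτ
  -- The point t is the convex combination of 0 and τ in which τ has weight t / τ.
  have := hconv.2 (Set.left_mem_Ico.mpr (hτ0.trans hτ)) ⟨hτ0.le, hτ⟩ hτ0.ne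
    (show 0 < 1 - t / τ by rw [sub_pos, div_lt_one hτ0]; exact htτ)
    (div_pos ht hτ0) (by ring)
  have h0 : logRatio r 0 = 0 := by simp [logRatio]
  simp only [smul_eq_mul, mul_zero, zero_add, h0, div_mul_cancel₀ _ hτ0.ne'] at this
  have h3 := mul_lt_mul_of_pos_left this hτ0
  rwa [← mul_assoc, mul_div_cancel₀ _ hτ0.ne'] at h3

/-- The sign of the potential on the bisector of two directions. -/
lemma bisector_neg {ci cj ck r t τ : ℝ} (hk : 0 < ck) (ht : 0 < t) (htτ : t < τ)
    (hτ : τ < r) (h : ci * t + cj * t + ck * (-τ) = 0) :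
    ci / 2 * logRatio r t + cj / 2 * logRatio r t + ck / 2 * logRatio r (-τ) < 0 := by
  have h1 := logRatio_lt ht htτ hτ
  rw [logRatio_neg]
  -- On a bisector two of the cosines coincide, and the closing condition balances them against the
  -- third. The third has the larger modulus, so superlinearity of `logRatio` lets it win.
  have h2 : (ci + cj) * t = ck * τ := by linarith
  have h3 : t * ((ci + cj) * logRatio r t) < t * (ck * logRatio r τ) := by
    calc t * ((ci + cj) * logRatio r t) = ck * (τ * logRatio r t) := by
          rw [← mul_assoc, mul_comm t, h2, mul_assoc]
      _ < ck * (t * logRatio r τ) := by gcongr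
      _ = _ := by ring
  have := lt_of_mul_lt_mul_left h3 ht.le
  linarith

/-- An antiperiodic function that changes sign at least three times in a period and has few
critical points has only one zero between consecutive sign changes, and it is simple. -/
lemma false_of_antiperiodic {g g' : ℝ → ℝ} (hg : ∀ θ, HasDerivAt g (g' θ) θ) {π : ℝ}
    (hanti : ∀ θ, g (θ + π) = - g θ)
    (hcrit : ∀ θ₀ θ₁ θ₂ θ₃, θ₀ < θ₁ → θ₁ < θ₂ → θ₂ < θ₃ → θ₃ < θ₀ + π →
      g' θ₀ = 0 → g' θ₁ = 0 → g' θ₂ = 0 → g' θ₃ = 0 → False)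
    {b₀ b₁ b₂ : ℝ} (h₁₂ : b₁ < b₂) (h₂₃ : b₂ < b₀ + π)
    (s₁ : g b₁ * g b₂ < 0) (s₂ : g b₂ * g b₀ > 0) {t t' : ℝ}
    (ht : b₀ < t) (ht' : t' < b₁) (htt : t ≤ t') (h0 : g t = 0) (h0' : g t' = 0)
    (heq : t = t' → g' t = 0) : False := by
  have hcont : Continuous g := continuous_iff_continuousAt.mpr fun θ => (hg θ).continuousAt
  have ivt : ∀ a b, a < b → g a * g b < 0 → ∃ s ∈ Set.Ioo a b, g s = 0 := by
    intro a b hab hs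
    rcases mul_neg_iff.mp hs with ⟨h1, h2⟩ | ⟨h1, h2⟩
    · obtain ⟨s, hs, h⟩ := intermediate_value_Ioo' hab.le hcont.continuousOn ⟨h2, h1⟩
      exact ⟨s, hs, h⟩
    · obtain ⟨s, hs, h⟩ := intermediate_value_Ioo hab.le hcont.continuousOn ⟨h1, h2⟩
      exact ⟨s, hs, h⟩
  have rolle : ∀ a b, a < b → g a = 0 → g b = 0 → ∃ s ∈ Set.Ioo a b, g' s = 0 := by
    intro a b hab ha hb
    exact exists_hasDerivAt_eq_zero hab hcont.continuousOn (ha.trans hb.symm) fun x _ => hg x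
  -- The zeros t ≤ t' < s < u < t + π give three critical points between t' and t + π. A fourth is t
  -- itself if the zero is double, or lies between t and t' if they differ; all four fit in a window
  -- shorter than π.
  obtain ⟨s, hs, hs0⟩ := ivt b₁ b₂ h₁₂ s₁
  obtain ⟨u, hu, hu0⟩ := ivt b₂ (b₀ + π) h₂₃ (by rw [hanti]; linarith)
  have hp0 : g (t + π) = 0 := by rw [hanti, h0, neg_zero]
  obtain ⟨r₁, hr₁, e₁⟩ := rolle t' s (by linarith [hs.1]) h0' hs0
  obtain ⟨r₂, hr₂, e₂⟩ := rolle s u (by linarith [hs.2, hu.1]) hs0 hu0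
  obtain ⟨r₃, hr₃, e₃⟩ := rolle u (t + π) (by linarith [hu.2]) hu0 hp0
  rcases htt.eq_or_lt with h | h
  · exact hcrit t r₁ r₂ r₃ (by linarith [hr₁.1]) (by linarith [hr₁.2, hr₂.1])
      (by linarith [hr₂.2, hr₃.1]) (by linarith [hr₃.2]) (heq h) e₁ e₂ e₃
  · obtain ⟨r₀, hr₀, e₀⟩ := rolle t t' h h0 h0'
    exact hcrit r₀ r₁ r₂ r₃ (by linarith [hr₀.2, hr₁.1]) (by linarith [hr₁.2, hr₂.1])
      (by linarith [hr₂.2, hr₃.1]) (by linarith [hr₃.2, hr₀.1]) e₀ e₁ e₂ e₃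

lemma cubic_four_roots {a b c d : ℂ} (ha : a ≠ 0) {q : Fin 4 → ℂ} (hq : Function.Injective q)
    (h : ∀ i, a * q i ^ 3 + b * q i ^ 2 + c * q i + d = 0) : False := by
  open Polynomial in
  have h0 := eq_zero_of_natDegree_lt_card_of_eval_eq_zero (C a * X ^ 3 + C b * X ^ 2 + C c * X + C d)
    hq (fun i => by simpa using h i)
    (by rw [Fintype.card_fin]; exact lt_of_le_of_lt natDegree_cubic_le (by norm_num))
  have := congrArg (fun p => Polynomial.coeff p 3) h0
  simp at this
  exact ha this

namespace Triangle

variable {T : Triangle}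

/-- Angles in a window shorter than π have distinct values of exp (2iθ), and a cubic has at most
three roots. -/
lemma Uθ_four_zeros {x θ₀ θ₁ θ₂ θ₃ : ℝ} (h₀₁ : θ₀ < θ₁) (h₁₂ : θ₁ < θ₂) (h₂₃ : θ₂ < θ₃)
    (h₃ : θ₃ < θ₀ + Real.pi) (hx : x ≠ 0) (e₀ : T.Uθ x θ₀ = 0) (e₁ : T.Uθ x θ₁ = 0)
    (e₂ : T.Uθ x θ₂ = 0) (e₃ : T.Uθ x θ₃ = 0) : False := by
  set θ : Fin 4 → ℝ := ![θ₀, θ₁, θ₂, θ₃] with hθ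
  have he : ∀ i, T.Uθ x (θ i) = 0 := by intro i; fin_cases i <;> simpa [hθ]
  have hmem : ∀ i, θ₀ ≤ θ i ∧ θ i < θ₀ + Real.pi := by
    intro i; fin_cases i <;> simp [hθ, Real.pi_pos] <;> constructor <;> linarith
  have hmono : Function.Injective θ := by
    have : StrictMono θ := by
      rw [Fin.strictMono_iff_lt_succ]
      intro i; fin_cases i <;> simpa [hθ]
    exact this.injective
  -- This is the leading coefficient of the cubic: exp (2iθ) enters the two products with opposite
  -- signs, so the coefficients E³ and 1 add up instead of cancelling.
  have hE : (Complex.exp x ^ 2) ^ 3 + 1 ≠ 0 := by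
    rw [← Complex.ofReal_exp]
    norm_cast
    positivity
  set E := Complex.exp x ^ 2
  refine cubic_four_roots (b := -(E ^ 2 + E) * (T.n 0 ^ 2 + T.n 1 ^ 2 + T.n 2 ^ 2))
    (c := (E ^ 2 + E) * (T.n 0 ^ 2 * T.n 1 ^ 2 + T.n 1 ^ 2 * T.n 2 ^ 2 + T.n 0 ^ 2 * T.n 2 ^ 2))
    (d := -(E ^ 3 + 1) * (T.n 0 ^ 2 * T.n 1 ^ 2 * T.n 2 ^ 2)) hE
    (q := fun i => Complex.exp (θ i * Complex.I) ^ 2) ?_ ?_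
  · intro i j hij
    simp only [← Complex.exp_nat_mul] at hij
    rw [Complex.exp_eq_exp_iff_exists_int] at hij
    obtain ⟨k, hk⟩ := hij
    have hk' := congrArg Complex.im hk
    simp at hk'
    have h1 : θ i = θ j + k * Real.pi := by linarith
    have h2 := hmem i
    have h3 := hmem j
    have hk0 : k = 0 := by
      have hpi := Real.pi_pos
      have a1 : (k : ℝ) < 1 := by
        by_contra hc; push Not at hc
        nlinarith
      have a2 : (-1 : ℝ) < k := by
        by_contra hc; push Not at hc
        nlinarith
      have a1' : k < 1 := by exact_mod_cast a1
      have a2' : -1 < k := by exact_mod_cast a2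
      omega
    exact hmono (by simpa [hk0] using h1)
  · intro i
    have := cubic_of_Uθ_eq_zero (reg_of_ne hx _) (he i)
    simp only [Fin.prod_univ_three] at this
    linear_combination this

variable (T)

/-- Between consecutive values of these angles lies, for every `x`, one zero of the potential. -/
def b : Fin 4 → ℝ := ![(T.Q - T.P) / 2 - Real.pi, -(Real.pi + T.P) / 2, (T.Q - Real.pi) / 2,
  (T.Q - T.P) / 2]

variable {T}

lemma U_eq (x θ : ℝ) : T.U x θ = T.c₁ / 2 * logRatio (Real.cosh x) (Real.cos (θ + T.P))
    + T.c₂ / 2 * logRatio (Real.cosh x) (Real.cos (θ - T.Q))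
    + T.c₃ / 2 * logRatio (Real.cosh x) (Real.cos (θ - Real.pi)) := by
  simp [U, Fin.sum_univ_three, c, α, logRatio]

lemma sum_c_mul_cos' (θ : ℝ) : T.c₁ * Real.cos (θ + T.P) + T.c₂ * Real.cos (θ - T.Q)
    + T.c₃ * Real.cos (θ - Real.pi) = 0 := by
  have := T.sum_c_mul_cos θ
  rw [Fin.sum_univ_three] at this
  simpa [c, α] using this

/-- The angle `b 3` bisects the directions -P and Q. Both make the angle (P + Q) / 2 with it, and
the third direction has negative cosine of larger modulus. -/
lemma U_b3_neg {x : ℝ} (h : T.Reg x (T.b 3)) : T.U x (T.b 3) < 0 := by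
  have hP := T.P_pos
  have hQ := T.Q_pos
  have hPQ := T.add_lt_pi
  have hs := sum_c_mul_cos' (T := T) (T.b 3)
  have hr := h.add_pos 2
  rw [U_eq]
  simp only [b, α, Matrix.cons_val] at hs hr ⊢
  rw [show (T.Q - T.P) / 2 + T.P = (T.P + T.Q) / 2 by ring,
    show (T.Q - T.P) / 2 - T.Q = -((T.P + T.Q) / 2) by ring, Real.cos_neg, Real.cos_sub_pi] at *
  refine bisector_neg T.c₃_pos (Real.cos_pos_of_mem_Ioo ⟨by linarith, by linarith⟩) ?_
    (by linarith) hs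
  rw [← Real.cos_abs ((T.Q - T.P) / 2)]
  refine Real.cos_lt_cos_of_nonneg_of_le_pi (abs_nonneg _) (by linarith) ?_
  rw [abs_lt]; constructor <;> linarith

lemma U_b0_pos {x : ℝ} (h : T.Reg x (T.b 0)) : 0 < T.U x (T.b 0) := by
  have e : T.b 0 + Real.pi = T.b 3 := by simp [b]
  have h1 := U_b3_neg (e ▸ h.add_pi)
  rw [← e, U_add_pi] at h1
  linarith

/-- The angle `b 1` bisects -P and -π, the latter being the direction π modulo a full turn; Q plays
the part of the opposite direction. -/
lemma U_b1_neg {x : ℝ} (h : T.Reg x (T.b 1)) : T.U x (T.b 1) < 0 := by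
  have hP := T.P_pos
  have hQ := T.Q_pos
  have hPQ := T.add_lt_pi
  have hs := sum_c_mul_cos' (T := T) (T.b 1)
  have hr := h.add_pos 1
  rw [U_eq]
  simp only [b, α, Matrix.cons_val_one, Matrix.cons_val_zero] at hs hr ⊢
  rw [show -(Real.pi + T.P) / 2 + T.P = T.P / 2 - Real.pi / 2 by ring,
    show -(Real.pi + T.P) / 2 - T.Q = -(T.P / 2 + T.Q + Real.pi / 2) by ring,
    show -(Real.pi + T.P) / 2 - Real.pi = -((T.P / 2 + Real.pi / 2) + Real.pi) by ring,
    Real.cos_neg, Real.cos_neg, Real.cos_add_pi,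
    Real.cos_add_pi_div_two, Real.cos_add_pi_div_two, Real.cos_sub_pi_div_two, neg_neg] at *
  have := bisector_neg (ci := T.c₁) (cj := T.c₃) (t := Real.sin (T.P / 2))
    (τ := Real.sin (T.P / 2 + T.Q)) (r := Real.cosh x) T.c₂_pos
    (Real.sin_pos_of_pos_of_lt_pi (by linarith) (by linarith)) ?_ (by linarith) (by linarith)
  · linarith
  · rw [← Real.cos_sub_pi_div_two, ← Real.cos_sub_pi_div_two, ← Real.cos_abs (_ - _),
      ← Real.cos_abs (T.P / 2 + T.Q - _)]
    refine Real.cos_lt_cos_of_nonneg_of_le_pi (abs_nonneg _) ?_ ?_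
    · rw [abs_le]; constructor <;> linarith
    · rw [abs_of_neg (a := T.P / 2 - Real.pi / 2) (by linarith), abs_lt]; constructor <;> linarith

/-- Here the angle is antipodal to the bisector of Q and π, so all cosines change sign and the
potential is positive. -/
lemma U_b2_pos {x : ℝ} (h : T.Reg x (T.b 2)) : 0 < T.U x (T.b 2) := by
  have hP := T.P_pos
  have hQ := T.Q_pos
  have hPQ := T.add_lt_pi
  have hs := sum_c_mul_cos' (T := T) (T.b 2)
  have hr := h.sub_pos 0
  rw [U_eq]
  simp only [b, α, Matrix.cons_val, Matrix.cons_val_zero] at hs hr ⊢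
  rw [sub_neg_eq_add] at hr
  rw [show (T.Q - Real.pi) / 2 + T.P = (T.P + T.Q / 2) - Real.pi / 2 by ring,
    show (T.Q - Real.pi) / 2 - T.Q = -(T.Q / 2 + Real.pi / 2) by ring,
    show (T.Q - Real.pi) / 2 - Real.pi = (T.Q / 2 - Real.pi / 2) - Real.pi by ring,
    Real.cos_neg, Real.cos_sub_pi,
    Real.cos_add_pi_div_two, Real.cos_sub_pi_div_two, Real.cos_sub_pi_div_two] at *
  have := bisector_neg (ci := T.c₂) (cj := T.c₃) (t := Real.sin (T.Q / 2))
    (τ := Real.sin (T.P + T.Q / 2)) (r := Real.cosh x) T.c₁_pos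
    (Real.sin_pos_of_pos_of_lt_pi (by linarith) (by linarith)) ?_ (by linarith) (by linarith)
  · simp only [logRatio_neg] at *
    linarith
  · rw [← Real.cos_sub_pi_div_two, ← Real.cos_sub_pi_div_two, ← Real.cos_abs (_ - _),
      ← Real.cos_abs (T.P + T.Q / 2 - _)]
    refine Real.cos_lt_cos_of_nonneg_of_le_pi (abs_nonneg _) ?_ ?_
    · rw [abs_le]; constructor <;> linarith
    · rw [abs_of_neg (a := T.Q / 2 - Real.pi / 2) (by linarith), abs_lt]; constructor <;> linarith

lemma b_lt (k : Fin 3) : T.b k.castSucc < T.b k.succ := by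
  have hP := T.P_pos
  have hQ := T.Q_pos
  have hPQ := T.add_lt_pi
  fin_cases k <;> simp [b] <;> linarith

lemma U_b_mul_neg {x : ℝ} (hx : x ≠ 0) (k : Fin 3) :
    T.U x (T.b k.castSucc) * T.U x (T.b k.succ) < 0 := by
  have h0 := U_b0_pos (reg_of_ne hx (T.b 0))
  have h1 := U_b1_neg (reg_of_ne hx (T.b 1))
  have h2 := U_b2_pos (reg_of_ne hx (T.b 2))
  have h3 := U_b3_neg (reg_of_ne hx (T.b 3))
  fin_cases k
  · exact mul_neg_of_pos_of_neg h0 h1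
  · exact mul_neg_of_neg_of_pos h1 h2
  · exact mul_neg_of_pos_of_neg h2 h3

/-- Covers two facts at once: t < t' is excluded (uniqueness), and so is t = t' with vanishing
derivative (simplicity). -/
lemma zero_unique_aux {x : ℝ} (hx : x ≠ 0) (k : Fin 3) {t t' : ℝ} (ht : T.b k.castSucc < t)
    (ht' : t' < T.b k.succ) (htt : t ≤ t') (h0 : T.U x t = 0) (h0' : T.U x t' = 0)
    (heq : t = t' → T.Uθ x t = 0) : False := by
  have hd : ∀ θ, HasDerivAt (T.U x) (T.Uθ x θ) θ := fun θ => hasDerivAt_U (reg_of_ne hx θ)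
  have h0 := U_b0_pos (reg_of_ne hx (T.b 0))
  have h1 := U_b1_neg (reg_of_ne hx (T.b 1))
  have h2 := U_b2_pos (reg_of_ne hx (T.b 2))
  have h3 := U_b3_neg (reg_of_ne hx (T.b 3))
  have e : T.b 0 + Real.pi = T.b 3 := by simp [b]
  have l0 := b_lt (T := T) 0
  have l1 := b_lt (T := T) 1
  have l2 := b_lt (T := T) 2
  simp only [Fin.castSucc_zero, Fin.succ_zero_eq_one] at l0
  change T.b 1 < T.b 2 at l1
  change T.b 2 < T.b 3 at l2
  have hcr := fun θ₀ θ₁ θ₂ θ₃ a b c d e f g h =>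
    Uθ_four_zeros (T := T) (x := x) (θ₀ := θ₀) (θ₁ := θ₁) (θ₂ := θ₂) (θ₃ := θ₃) a b c d hx e f g h
  have p1 : T.U x (T.b 1 + Real.pi) > 0 := by rw [U_add_pi]; linarith
  fin_cases k
  · refine false_of_antiperiodic hd (T.U_add_pi x) hcr (b₀ := T.b 0) (b₁ := T.b 1) (b₂ := T.b 2)
      l1 (by linarith) (mul_neg_of_neg_of_pos h1 h2) (mul_pos h2 h0) ht ht' htt ?_ h0' heq
    assumption
  · refine false_of_antiperiodic hd (T.U_add_pi x) hcr (b₀ := T.b 1) (b₁ := T.b 2) (b₂ := T.b 3)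
      l2 (by linarith) (mul_neg_of_pos_of_neg h2 h3) (mul_pos_of_neg_of_neg h3 h1) ht ht' htt ?_
      h0' heq
    assumption
  -- For the last sector the third sample point lies beyond `b 3`; it is `b 1` moved by π, where
  -- antiperiodicity makes the potential positive.
  · refine false_of_antiperiodic hd (T.U_add_pi x) hcr (b₀ := T.b 2) (b₁ := T.b 3)
      (b₂ := T.b 1 + Real.pi)
      (by linarith) (by linarith) (mul_neg_of_neg_of_pos h3 p1) (mul_pos p1 h2) ht ht' htt ?_
      h0' heq
    assumption

lemma zero_unique {x : ℝ} (hx : x ≠ 0) (k : Fin 3) {t t' : ℝ}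
    (ht : t ∈ Set.Ioo (T.b k.castSucc) (T.b k.succ))
    (ht' : t' ∈ Set.Ioo (T.b k.castSucc) (T.b k.succ))
    (h0 : T.U x t = 0) (h0' : T.U x t' = 0) : t = t' := by
  rcases lt_trichotomy t t' with h | h | h
  · exact (zero_unique_aux hx k ht.1 ht'.2 h.le h0 h0' fun e => absurd e h.ne).elim
  · exact h
  · exact (zero_unique_aux hx k ht'.1 ht.2 h.le h0' h0 fun e => absurd e h.ne).elim

lemma Uθ_ne_zero_of_ne {x : ℝ} (hx : x ≠ 0) (k : Fin 3) {t : ℝ}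
    (ht : t ∈ Set.Ioo (T.b k.castSucc) (T.b k.succ)) (h0 : T.U x t = 0) : T.Uθ x t ≠ 0 := fun h =>
  zero_unique_aux hx k ht.1 ht.2 le_rfl h0 h0 fun _ => h

lemma continuous_U {x : ℝ} (hx : x ≠ 0) : Continuous (T.U x) :=
  continuous_iff_continuousAt.mpr fun θ => (hasDerivAt_U (reg_of_ne hx θ)).continuousAt

lemma exists_zero_of_ne {x : ℝ} (hx : x ≠ 0) (k : Fin 3) :
    ∃ t ∈ Set.Ioo (T.b k.castSucc) (T.b k.succ), T.U x t = 0 := by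
  have hs := U_b_mul_neg (T := T) hx k
  have hc := (continuous_U (T := T) hx).continuousOn (s := Set.Icc (T.b k.castSucc) (T.b k.succ))
  rcases mul_neg_iff.mp hs with ⟨h1, h2⟩ | ⟨h1, h2⟩
  · obtain ⟨s, hs, h⟩ := intermediate_value_Ioo' (b_lt k).le hc ⟨h2, h1⟩
    exact ⟨s, hs, h⟩
  · obtain ⟨s, hs, h⟩ := intermediate_value_Ioo (b_lt k).le hc ⟨h1, h2⟩
    exact ⟨s, hs, h⟩

end Triangle

end JacobiZeros

end

/-! ### Zeros on the unit circle, and the three analytic zero curves -/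

noncomputable section

namespace JacobiZeros

namespace Triangle

variable {T : Triangle}

/-! ### The zeros of the potential on the circle `x = 0` -/

variable (T) in
/-- The singular angles in `[-π, 0]` on the circle `x = 0`. -/
def J : Fin 4 → ℝ := ![-Real.pi, T.Q - Real.pi, -T.P, 0]

/-- The signs of `sin (θ - αⱼ)` for `θ` in the `k`-th interval between singular angles. -/
def sg : Fin 3 → Fin 3 → ℝ := ![![-1, 1, 1], ![-1, -1, 1], ![1, -1, 1]]

lemma sg_mul_sin_pos {k : Fin 3} {θ : ℝ} (h : θ ∈ Set.Ioo (T.J k.castSucc) (T.J k.succ))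
    (j : Fin 3) : 0 < sg k j * Real.sin (θ - T.α j) := by
  have hP := T.P_pos
  have hQ := T.Q_pos
  have hPQ := T.add_lt_pi
  have pos : ∀ y, 0 < y → y < Real.pi → 0 < Real.sin y := fun y => Real.sin_pos_of_pos_of_lt_pi
  have neg : ∀ y, -Real.pi < y → y < 0 → Real.sin y < 0 := fun y h1 h2 =>
    Real.sin_neg_of_neg_of_neg_pi_lt h2 h1
  have pos' : ∀ y, -(2 * Real.pi) < y → y < - Real.pi → 0 < Real.sin y := fun y h1 h2 => by
    rw [← Real.sin_add_two_pi]; exact pos _ (by linarith) (by linarith)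
  obtain ⟨h1, h2⟩ := h
  fin_cases k <;> fin_cases j <;> simp [J, sg, α] at h1 h2 ⊢
  · exact neg _ (by linarith) (by linarith)
  · exact pos' _ (by linarith) (by linarith)
  · exact neg _ (by linarith) (by linarith)
  · exact neg _ (by linarith) (by linarith)
  · exact neg _ (by linarith) (by linarith)
  · exact neg _ (by linarith) (by linarith)
  · exact pos _ (by linarith) (by linarith)
  · exact neg _ (by linarith) (by linarith)
  · exact neg _ (by linarith) (by linarith)

lemma reg_of_mem_J {k : Fin 3} {θ : ℝ} (h : θ ∈ Set.Ioo (T.J k.castSucc) (T.J k.succ)) :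
    T.Reg 0 θ := reg_zero fun j h0 => by
  have := sg_mul_sin_pos h j
  rw [h0, mul_zero] at this
  exact this.false

/-- The sign of the angular derivative in the `k`-th interval between singular angles. -/
def sgProd (k : Fin 3) : ℝ := sg k 0 * sg k 1 * sg k 2

/-- For x = 0 every Sⱼ is the purely imaginary number i sin (θ - αⱼ). The derivative therefore has
the sign of a product of sines and cannot vanish between poles. -/
lemma Uθ_zero {θ : ℝ} (h : T.Reg 0 θ) : T.Uθ 0 θ
    = T.K * (Real.sin (θ - T.α 0) * Real.sin (θ - T.α 1) * Real.sin (θ - T.α 2))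
      / Complex.normSq (T.S 0 θ 0 * T.S 0 θ 1 * T.S 0 θ 2) := by
  rw [Uθ_eq h]
  congr 1
  simp only [Complex.mul_im, Complex.mul_re, S_re, S_im, Real.sinh_zero, Real.cosh_zero]
  ring

lemma normSq_pos {x θ : ℝ} (h : T.Reg x θ) :
    0 < Complex.normSq (T.S x θ 0 * T.S x θ 1 * T.S x θ 2) :=
  Complex.normSq_pos.mpr (mul_ne_zero (mul_ne_zero (h.S_ne_zero 0) (h.S_ne_zero 1))
    (h.S_ne_zero 2))

lemma sgProd_mul_Uθ_pos {k : Fin 3} {θ : ℝ} (h : θ ∈ Set.Ioo (T.J k.castSucc) (T.J k.succ)) :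
    0 < sgProd k * T.Uθ 0 θ := by
  have hr := reg_of_mem_J h
  rw [Uθ_zero hr, ← mul_div_assoc]
  refine div_pos ?_ (normSq_pos hr)
  have h0 := sg_mul_sin_pos h 0
  have h1 := sg_mul_sin_pos h 1
  have h2 := sg_mul_sin_pos h 2
  have := mul_pos (K_pos (T := T)) (mul_pos (mul_pos h0 h1) h2)
  rw [sgProd]
  linarith

lemma strictMonoOn_U_zero (k : Fin 3) :
    StrictMonoOn (fun θ => sgProd k * T.U 0 θ) (Set.Ioo (T.J k.castSucc) (T.J k.succ)) := by
  have hd : ∀ θ ∈ Set.Ioo (T.J k.castSucc) (T.J k.succ),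
      HasDerivAt (fun θ => sgProd k * T.U 0 θ) (sgProd k * T.Uθ 0 θ) θ :=
    fun θ h => (hasDerivAt_U (reg_of_mem_J h)).const_mul _
  refine strictMonoOn_of_deriv_pos (convex_Ioo _ _)
    (fun θ h => (hd θ h).continuousAt.continuousWithinAt) fun θ h => ?_
  rw [interior_Ioo] at h
  rw [(hd θ h).deriv]
  exact sgProd_mul_Uθ_pos h

variable (T) in
/-- A function on the circle with the sign of the potential that is also continuous at the
singular angles. -/
def W (θ : ℝ) : ℝ := ∏ j, (1 + Real.cos (θ - T.α j)) ^ T.c j - ∏ j, (1 - Real.cos (θ - T.α j)) ^ T.c j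

lemma continuous_W : Continuous T.W := by
  unfold W
  refine Continuous.sub ?_ ?_ <;> refine continuous_finsetProd _ fun j _ => ?_ <;>
  exact Continuous.rpow_const (by fun_prop) fun θ => Or.inr (T.c_pos j).le

/-- Away from the poles the two products in `W` are positive, and half the difference of their
logarithms is the potential. -/
lemma U_zero_eq_zero {θ : ℝ} (h : T.Reg 0 θ) (hW : T.W θ = 0) : T.U 0 θ = 0 := by
  have ha := fun j => h.add_pos j
  have hb := fun j => h.sub_pos j
  simp only [Real.cosh_zero] at ha hb
  have := congrArg Real.log (sub_eq_zero.mp hW)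
  rw [Real.log_prod fun j _ => (Real.rpow_pos_of_pos (ha j) _).ne',
    Real.log_prod fun j _ => (Real.rpow_pos_of_pos (hb j) _).ne'] at this
  simp only [Real.log_rpow (ha _), Real.log_rpow (hb _)] at this
  simp only [U, Real.cosh_zero, mul_sub, Finset.sum_sub_distrib, div_mul_eq_mul_div,
    ← Finset.sum_div]
  rw [this, sub_self]

lemma W_pos_of {θ : ℝ} (j : Fin 3) (h : Real.cos (θ - T.α j) = 1)
    (h' : ∀ i, i ≠ j → Real.sin (θ - T.α i) ≠ 0) : 0 < T.W θ := by
  have h1 : ∏ j, (1 - Real.cos (θ - T.α j)) ^ T.c j = 0 :=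
    Finset.prod_eq_zero (Finset.mem_univ j)
      (by rw [h, sub_self, Real.zero_rpow (T.c_pos j).ne'])
  rw [W, h1, sub_zero]
  refine Finset.prod_pos fun i _ => Real.rpow_pos_of_pos ?_ _
  by_cases hi : i = j
  · rw [hi, h]; norm_num
  · have h2 := h' i hi
    have h3 := Real.sin_sq_add_cos_sq (θ - T.α i)
    rcases (show 0 ≤ 1 + Real.cos (θ - T.α i) by
      linarith [Real.neg_one_le_cos (θ - T.α i)]).lt_or_eq with h4 | h4
    · exact h4
    · exfalso; apply h2
      have : Real.cos (θ - T.α i) = -1 := by linarith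
      rw [this] at h3
      have : Real.sin (θ - T.α i) ^ 2 = 0 := by linarith
      exact pow_eq_zero_iff two_ne_zero |>.mp this

lemma W_add_pi (θ : ℝ) : T.W (θ + Real.pi) = - T.W θ := by
  have : ∀ j, Real.cos (θ + Real.pi - T.α j) = - Real.cos (θ - T.α j) := fun j => by
    rw [show θ + Real.pi - T.α j = θ - T.α j + Real.pi by ring, Real.cos_add_pi]
  simp only [W, this, sub_neg_eq_add, ← sub_eq_add_neg]
  ring

lemma W_α_pos (j : Fin 3) : 0 < T.W (T.α j) := by
  refine W_pos_of j (by simp) fun i hi => ?_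
  have hP := T.sin_P_pos.ne'
  have hQ := T.sin_Q_pos.ne'
  have hPQ := T.sin_add_pos.ne'
  have e1 : Real.sin (-T.P - T.Q) ≠ 0 := by
    rw [show -T.P - T.Q = -(T.P + T.Q) by ring, Real.sin_neg]; exact neg_ne_zero.mpr hPQ
  have e2 : Real.sin (T.Q + T.P) ≠ 0 := by rwa [add_comm]
  have e3 : Real.sin (-T.P - Real.pi) ≠ 0 := by rw [Real.sin_sub_pi, Real.sin_neg]; simpa
  have e4 : Real.sin (T.Q - Real.pi) ≠ 0 := by rw [Real.sin_sub_pi]; simpa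
  have e5 : Real.sin (Real.pi + T.P) ≠ 0 := by rw [add_comm, Real.sin_add_pi]; simpa
  have e6 : Real.sin (Real.pi - T.Q) ≠ 0 := by rw [Real.sin_pi_sub]; simpa
  fin_cases i <;> fin_cases j <;> simp [α] at hi ⊢ <;> assumption

/-- `W` is positive at each αⱼ and negative at its antipode. The entries -π, Q - π, -P, 0 of `J` are
alternately of the first and of the second kind, so `W` changes sign on each interval. -/
lemma exists_zero_J (k : Fin 3) :
    ∃ t ∈ Set.Ioo (T.J k.castSucc) (T.J k.succ), T.U 0 t = 0 := by
  have hP := T.P_pos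
  have hQ := T.Q_pos
  have hPQ := T.add_lt_pi
  have w0 := W_α_pos (T := T) 0
  have w1 := W_add_pi (T := T) (T.Q - Real.pi)
  have w1' := W_α_pos (T := T) 1
  have w2 := W_α_pos (T := T) 2
  have w3 := W_add_pi (T := T) 0
  have w4 := W_add_pi (T := T) (-Real.pi)
  simp [α] at w0 w1 w1' w2 w3 w4
  have hc := continuous_W (T := T)
  have key : ∃ t ∈ Set.Ioo (T.J k.castSucc) (T.J k.succ), T.W t = 0 := by
    fin_cases k
    · obtain ⟨t, ht, h⟩ := intermediate_value_Ioo' (a := -Real.pi) (b := T.Q - Real.pi) (by linarith)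
        hc.continuousOn (show (0 : ℝ) ∈ _ from ⟨by linarith, by linarith⟩)
      exact ⟨t, ht, h⟩
    · obtain ⟨t, ht, h⟩ := intermediate_value_Ioo (a := T.Q - Real.pi) (b := - T.P) (by linarith)
        hc.continuousOn (show (0 : ℝ) ∈ _ from ⟨by linarith, by linarith⟩)
      exact ⟨t, ht, h⟩
    · obtain ⟨t, ht, h⟩ := intermediate_value_Ioo' (a := - T.P) (b := 0) (by linarith)
        hc.continuousOn (show (0 : ℝ) ∈ _ from ⟨by linarith, by linarith⟩)
      exact ⟨t, ht, h⟩
  obtain ⟨t, ht, h⟩ := key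
  exact ⟨t, ht, U_zero_eq_zero (reg_of_mem_J ht) h⟩

lemma zero_unique_J (k : Fin 3) {t t' : ℝ} (ht : t ∈ Set.Ioo (T.J k.castSucc) (T.J k.succ))
    (ht' : t' ∈ Set.Ioo (T.J k.castSucc) (T.J k.succ)) (h : T.U 0 t = 0) (h' : T.U 0 t' = 0) :
    t = t' :=
  (strictMonoOn_U_zero k).injOn ht ht' (by simp [h, h'])

/-- Makes the labelling by intervals between poles agree with the labelling by sectors between
bisectors, so that the zero curves can be continued through x = 0. A bisector inside the interval
carries a known sign, and monotonicity then places the zero on the correct side of it. -/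
lemma mem_b_of_zero_J (k : Fin 3) {t : ℝ} (ht : t ∈ Set.Ioo (T.J k.castSucc) (T.J k.succ))
    (h : T.U 0 t = 0) : t ∈ Set.Ioo (T.b k.castSucc) (T.b k.succ) := by
  have hP := T.P_pos
  have hQ := T.Q_pos
  have hPQ := T.add_lt_pi
  have mono := (strictMonoOn_U_zero (T := T) k).monotoneOn
  have lo : T.b k.castSucc < T.J k.succ := by fin_cases k <;> simp [b, J] <;> linarith
  have hi : T.J k.castSucc < T.b k.succ := by fin_cases k <;> simp [b, J] <;> linarith
  have lo' : T.J k.castSucc < T.b k.castSucc → 0 < - (sgProd k * T.U 0 (T.b k.castSucc)) := by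
    intro h1
    have hr := reg_of_mem_J ⟨h1, lo⟩
    fin_cases k
    · have := U_b0_pos hr
      simpa [sgProd, sg]
    · have := U_b1_neg hr
      simpa [sgProd, sg]
    · have := U_b2_pos hr
      simpa [sgProd, sg]
  have hi' : T.b k.succ < T.J k.succ → 0 < sgProd k * T.U 0 (T.b k.succ) := by
    intro h1
    have hr := reg_of_mem_J ⟨hi, h1⟩
    fin_cases k
    · have := U_b1_neg hr
      simpa [sgProd, sg]
    · have := U_b2_pos hr
      simpa [sgProd, sg]
    · have := U_b3_neg hr
      simpa [sgProd, sg]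
  constructor
  · by_contra hc
    push Not at hc
    have h1 := mono ht ⟨ht.1.trans_le hc, lo⟩ hc
    have h2 := lo' (ht.1.trans_le hc)
    simp only [h, mul_zero] at h1
    linarith
  · by_contra hc
    push Not at hc
    have h1 := mono ⟨hi, hc.trans_lt ht.2⟩ ht hc
    have h2 := hi' (hc.trans_lt ht.2)
    simp only [h, mul_zero] at h1
    linarith

/-! ### The zero curves -/

variable (T) in
open Classical in
/-- The angle at which the `k`-th zero curve meets the circle with parameter `x`. -/
def ang (k : Fin 3) (x : ℝ) : ℝ :=
  -- On the unit circle the potential has logarithmic poles, so the zero is chosen there between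
  -- neighbouring poles and not just between bisectors.
  if hx : x = 0 then (exists_zero_J (T := T) k).choose else (exists_zero_of_ne (T := T) hx k).choose

lemma ang_zero_mem (k : Fin 3) : T.ang k 0 ∈ Set.Ioo (T.J k.castSucc) (T.J k.succ) := by
  rw [ang, dif_pos rfl]
  exact (exists_zero_J (T := T) k).choose_spec.1

lemma U_ang (k : Fin 3) (x : ℝ) : T.U x (T.ang k x) = 0 := by
  by_cases hx : x = 0
  · rw [ang, dif_pos hx, hx]
    exact (exists_zero_J (T := T) k).choose_spec.2
  · rw [ang, dif_neg hx]
    exact (exists_zero_of_ne hx k).choose_spec.2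

lemma ang_mem (k : Fin 3) (x : ℝ) : T.ang k x ∈ Set.Ioo (T.b k.castSucc) (T.b k.succ) := by
  by_cases hx : x = 0
  · rw [hx]
    exact mem_b_of_zero_J k (ang_zero_mem k) (U_ang k 0)
  · rw [ang, dif_neg hx]
    exact (exists_zero_of_ne hx k).choose_spec.1

lemma reg_ang (k : Fin 3) (x : ℝ) : T.Reg x (T.ang k x) := by
  by_cases hx : x = 0
  · rw [hx]
    exact reg_of_mem_J (ang_zero_mem k)
  · exact reg_of_ne hx _

lemma Uθ_ang_ne_zero (k : Fin 3) (x : ℝ) : T.Uθ x (T.ang k x) ≠ 0 := by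
  by_cases hx : x = 0
  · rw [hx]
    exact (right_ne_zero_of_mul (sgProd_mul_Uθ_pos (ang_zero_mem k)).ne')
  · exact Uθ_ne_zero_of_ne hx k (ang_mem k x) (U_ang k x)

lemma eq_ang_of_ne {k : Fin 3} {x t : ℝ} (hx : x ≠ 0)
    (ht : t ∈ Set.Ioo (T.b k.castSucc) (T.b k.succ)) (h : T.U x t = 0) : t = T.ang k x :=
  zero_unique hx k ht (ang_mem k x) h (U_ang k x)

lemma eq_ang_of_mem_J {k : Fin 3} {t : ℝ} (ht : t ∈ Set.Ioo (T.J k.castSucc) (T.J k.succ))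
    (h : T.U 0 t = 0) : t = T.ang k 0 :=
  zero_unique_J k ht (ang_zero_mem k) h (U_ang k 0)

open scoped ContDiff in
lemma contDiffAt_U {x θ : ℝ} (h : T.Reg x θ) :
    ContDiffAt ℝ ω (fun p : ℝ × ℝ => T.U p.1 p.2) (x, θ) := by
  unfold U
  refine ContDiffAt.sum fun j _ => contDiffAt_const.mul (ContDiffAt.sub ?_ ?_)
  · refine ContDiffAt.log ?_ (h.add_pos j).ne'
    exact ((Real.contDiff_cosh.comp contDiff_fst).add
      (Real.contDiff_cos.comp (contDiff_snd.sub contDiff_const))).contDiffAt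
  · refine ContDiffAt.log ?_ (h.sub_pos j).ne'
    exact ((Real.contDiff_cosh.comp contDiff_fst).sub
      (Real.contDiff_cos.comp (contDiff_snd.sub contDiff_const))).contDiffAt

-- The zero is simple, so the implicit function theorem provides an analytic local solution. By
-- continuity it stays in the sector, where uniqueness of the zero identifies it with `ang k`.
open scoped ContDiff in
lemma analyticAt_ang (k : Fin 3) (x₀ : ℝ) : AnalyticAt ℝ (T.ang k) x₀ := by
  set u : ℝ × ℝ := (x₀, T.ang k x₀) with hu
  have cdf : ContDiffAt ℝ ω (fun p : ℝ × ℝ => T.U p.1 p.2) u := contDiffAt_U (reg_ang k x₀)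
  have pn : (ω : WithTop ℕ∞) ≠ 0 := by simp
  have hd := hasDerivAt_U (reg_ang (T := T) k x₀)
  have if₂ : (fderiv ℝ (fun p : ℝ × ℝ => T.U p.1 p.2) u ∘L .inr ℝ ℝ ℝ).IsInvertible := by
    refine ⟨ContinuousLinearEquiv.unitsEquivAut ℝ (Units.mk0 _ (Uθ_ang_ne_zero (T := T) k x₀)), ?_⟩
    ext
    have h1 : HasDerivAt (fun θ : ℝ => (x₀, θ)) ((0 : ℝ), (1 : ℝ)) (T.ang k x₀) :=
      (hasDerivAt_const _ _).prodMk (hasDerivAt_id _)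
    have h2 := (cdf.differentiableAt pn).hasFDerivAt.comp_hasDerivAt (T.ang k x₀) h1
    have h3 := hd.unique h2
    simpa using h3
  set ψ := cdf.implicitFunction pn if₂ with hψ
  have h0 : ψ x₀ = T.ang k x₀ := cdf.implicitFunction_apply_self pn if₂
  have han : ContDiffAt ℝ ω ψ x₀ := cdf.contDiffAt_implicitFunction pn if₂
  have hev : ∀ᶠ x in 𝓝 x₀, T.U x (ψ x) = 0 := by
    filter_upwards [cdf.eventually_apply_implicitFunction pn if₂] with x hx
    exact hx.trans (U_ang k x₀)
  have hmem : ∀ᶠ x in 𝓝 x₀, ψ x ∈ Set.Ioo (T.b k.castSucc) (T.b k.succ) := by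
    refine han.continuousAt.eventually_mem (Ioo_mem_nhds ?_ ?_) <;> rw [h0]
    exacts [(ang_mem k x₀).1, (ang_mem k x₀).2]
  have heq : ψ =ᶠ[𝓝 x₀] T.ang k := by
    -- Uniqueness in the whole sector is available only for x ≠ 0. Near x₀ = 0 the single
    -- exceptional parameter is x₀ itself, where the two functions agree by construction.
    by_cases hx₀ : x₀ = 0
    · filter_upwards [hev, hmem] with x h1 h2
      by_cases hx : x = 0
      · rw [hx, ← hx₀, h0]
      · exact eq_ang_of_ne hx h2 h1
    · filter_upwards [hev, hmem, isOpen_ne.mem_nhds hx₀] with x h1 h2 hx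
      exact eq_ang_of_ne hx h2 h1
  exact han.analyticAt.congr heq

lemma continuous_ang (k : Fin 3) : Continuous (T.ang k) :=
  continuous_iff_continuousAt.mpr fun x => (analyticAt_ang k x).continuousAt

/-- Every zero of the potential lies on one of the three curves. -/
lemma exists_eq_ang {x θ : ℝ} (hr : T.Reg x θ) (h : T.U x θ = 0) :
    ∃ (k : Fin 3) (m : ℤ), θ = T.ang k x + m * Real.pi := by
  have hU : ∀ m : ℤ, T.U x (θ - m * Real.pi) = 0 := by
    intro m
    have h1 : Function.Antiperiodic (T.U x) Real.pi := T.U_add_pi x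
    rcases m.even_or_odd with hm | hm
    · obtain ⟨l, rfl⟩ := hm
      have := h1.periodic.sub_int_mul_eq (x := θ) l
      rw [← h, ← this]
      congr 1
      push_cast; ring
    · obtain ⟨l, rfl⟩ := hm
      have := h1.periodic.sub_int_mul_eq (x := θ - Real.pi) l
      rw [h1.sub_eq, h, neg_zero] at this
      rw [← this]
      congr 1
      push_cast; ring
  have hs : ∀ (m : ℤ) j, Real.sin (θ - T.α j) = 0 ↔ Real.sin (θ - m * Real.pi - T.α j) = 0 := by
    intro m j
    rw [show θ - m * Real.pi - T.α j = (θ - T.α j) - m * Real.pi by ring, Real.sin_sub_int_mul_pi]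
    simp [zpow_ne_zero]
  have hpi := Real.pi_pos
  -- The angle is reduced modulo π into a window cut at a pole for x = 0 and at a bisector
  -- otherwise; neither cut point can be a regular zero.
  by_cases hx : x = 0
  · subst hx
    obtain ⟨m, hm⟩ : ∃ m : ℤ, θ - m * Real.pi ∈ Set.Ico (-Real.pi) (-Real.pi + Real.pi) := by
      obtain ⟨m, hm, -⟩ := existsUnique_sub_zsmul_mem_Ico hpi θ (-Real.pi)
      exact ⟨m, by simpa using hm⟩
    have hsn : ∀ j, Real.sin (θ - m * Real.pi - T.α j) ≠ 0 := fun j => by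
      rw [Ne, ← hs m j]
      simpa using hr j
    set t := θ - m * Real.pi with ht
    have n0 : t ≠ -Real.pi := fun e => hsn 2 (by
      rw [e]; simp [α, show -Real.pi - Real.pi = -(2 * Real.pi) by ring])
    have n1 : t ≠ T.Q - Real.pi := fun e => hsn 1 (by rw [e]; simp [α])
    have n2 : t ≠ -T.P := fun e => hsn 0 (by rw [e]; simp [α])
    have hk : ∃ k : Fin 3, t ∈ Set.Ioo (T.J k.castSucc) (T.J k.succ) := by
      have h0 : -Real.pi < t := lt_of_le_of_ne hm.1 n0.symm
      have h3 : t < 0 := by simpa using hm.2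
      rcases lt_or_gt_of_ne n1 with h1 | h1
      · exact ⟨0, h0, h1⟩
      · rcases lt_or_gt_of_ne n2 with h2 | h2
        · exact ⟨1, h1, h2⟩
        · exact ⟨2, h2, h3⟩
    obtain ⟨k, hk⟩ := hk
    exact ⟨k, m, by rw [← eq_ang_of_mem_J hk (hU m), ht]; ring⟩
  · obtain ⟨m, hm⟩ : ∃ m : ℤ, θ - m * Real.pi ∈ Set.Ico (T.b 0) (T.b 0 + Real.pi) := by
      obtain ⟨m, hm, -⟩ := existsUnique_sub_zsmul_mem_Ico hpi θ (T.b 0)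
      exact ⟨m, by simpa using hm⟩
    have h0 := U_b0_pos (reg_of_ne hx (T.b 0))
    have h1 := U_b1_neg (reg_of_ne hx (T.b 1))
    have h2 := U_b2_pos (reg_of_ne hx (T.b 2))
    have ht0 := hU m
    set t := θ - m * Real.pi with ht
    have e : T.b 0 + Real.pi = T.b 3 := by simp [b]
    have n0 : t ≠ T.b 0 := fun e => by rw [e] at ht0; linarith
    have n1 : t ≠ T.b 1 := fun e => by rw [e] at ht0; linarith
    have n2 : t ≠ T.b 2 := fun e => by rw [e] at ht0; linarith
    have hk : ∃ k : Fin 3, t ∈ Set.Ioo (T.b k.castSucc) (T.b k.succ) := by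
      have h0 : T.b 0 < t := lt_of_le_of_ne hm.1 n0.symm
      have h3 : t < T.b 3 := e ▸ hm.2
      rcases lt_or_gt_of_ne n1 with h1 | h1
      · exact ⟨0, h0, h1⟩
      · rcases lt_or_gt_of_ne n2 with h2 | h2
        · exact ⟨1, h1, h2⟩
        · exact ⟨2, h2, h3⟩
    obtain ⟨k, hk⟩ := hk
    exact ⟨k, m, by rw [← eq_ang_of_ne hx hk ht0, ht]; ring⟩

lemma ang_lt {k l : Fin 3} (h : k < l) (x : ℝ) : T.ang k x < T.ang l x := by
  have h0 := ang_mem (T := T) 0 x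
  have h1 := ang_mem (T := T) 1 x
  have h2 := ang_mem (T := T) 2 x
  have e0 : T.ang 0 x < T.b 1 := h0.2
  have e1 : T.b 1 < T.ang 1 x := h1.1
  have e2 : T.ang 1 x < T.b 2 := h1.2
  have e3 : T.b 2 < T.ang 2 x := h2.1
  fin_cases k <;> fin_cases l <;> simp at h ⊢ <;> linarith

lemma ang_two_lt (x : ℝ) : T.ang 2 x < T.ang 0 x + Real.pi := by
  have h0 : T.b 0 < T.ang 0 x := (ang_mem (T := T) 0 x).1
  have h2 : T.ang 2 x < T.b 3 := (ang_mem (T := T) 2 x).2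
  have e : T.b 0 + Real.pi = T.b 3 := by simp [b]
  linarith

/-- The three curves are disjoint, even modulo `π`. -/
lemma ang_eq_add_int {k l : Fin 3} {x : ℝ} {m : ℤ} (h : T.ang k x = T.ang l x + m * Real.pi) :
    k = l ∧ m = 0 := by
  have hpi := Real.pi_pos
  have h01 := ang_lt (T := T) (k := 0) (l := 1) (by decide) x
  have h12 := ang_lt (T := T) (k := 1) (l := 2) (by decide) x
  have h20 := ang_two_lt (T := T) x
  have hb : ∀ k l : Fin 3, T.ang k x < T.ang l x + Real.pi := by
    intro k l
    fin_cases k <;> fin_cases l <;> simp <;> linarith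
  have hm : m = 0 := by
    have h1 := hb k l
    have h2 := hb l k
    have a1 : (m : ℝ) < 1 := by
      by_contra hc; push Not at hc
      nlinarith
    have a2 : (-1 : ℝ) < m := by
      by_contra hc; push Not at hc
      nlinarith
    have a1' : m < 1 := by exact_mod_cast a1
    have a2' : -1 < m := by exact_mod_cast a2
    omega
  refine ⟨?_, hm⟩
  simp only [hm, Int.cast_zero, zero_mul, add_zero] at h
  rcases lt_trichotomy k l with h1 | h1 | h1
  · exact absurd h (ang_lt h1 x).ne
  · exact h1
  · exact absurd h (ang_lt h1 x).ne'

end Triangle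

end JacobiZeros

end

/-! ### The Möbius coordinate and the differential -/

noncomputable section

namespace JacobiZeros

/-- A continuous square root of a differentiable function is differentiable where it does not
vanish. -/
lemma hasDerivAt_of_sq_eq {𝕜 : Type*} [NontriviallyNormedField 𝕜] [NormedAlgebra 𝕜 ℂ]
    {s q : 𝕜 → ℂ} {t : 𝕜} {q' : ℂ} (hs : ContinuousAt s t)
    (hq : HasDerivAt q q' t) (h : ∀ᶠ u in 𝓝 t, s u ^ 2 = q u) (h0 : s t ≠ 0) :
    HasDerivAt s (q' / (2 * s t)) t := by
  have hne : ∀ᶠ u in 𝓝 t, s u + s t ≠ 0 := by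
    have : ContinuousAt (fun u => s u + s t) t := hs.add continuousAt_const
    refine this.eventually_ne ?_
    rw [← two_mul]; exact mul_ne_zero two_ne_zero h0
  rw [hasDerivAt_iff_tendsto_slope] at hq ⊢
  have h1 : Tendsto (fun u => slope q t u / (s u + s t)) (𝓝[≠] t) (𝓝 (q' / (2 * s t))) := by
    refine hq.div ?_ (mul_ne_zero two_ne_zero h0)
    rw [two_mul]
    exact (hs.tendsto.mono_left nhdsWithin_le_nhds).add tendsto_const_nhds
  refine h1.congr' ?_
  filter_upwards [nhdsWithin_le_nhds h, nhdsWithin_le_nhds hne] with u hu hu0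
  rw [slope_def_module, slope_def_module, ← hu, ← h.self_of_nhds, sq_sub_sq, div_eq_iff hu0,
    smul_mul_assoc]
  ring_nf

lemma hasDerivAt_log_norm {u : ℝ → ℂ} {u' : ℂ} {t : ℝ} (hu : HasDerivAt u u' t) (h0 : u t ≠ 0) :
    HasDerivAt (fun t => Real.log ‖u t‖) (u' / u t).re t := by
  have hre : HasDerivAt (fun t => (u t).re) u'.re t :=
    Complex.reCLM.hasFDerivAt.comp_hasDerivAt t hu
  have him : HasDerivAt (fun t => (u t).im) u'.im t :=
    Complex.imCLM.hasFDerivAt.comp_hasDerivAt t hu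
  have hn : HasDerivAt (fun t => Complex.normSq (u t))
      (u'.re * (u t).re + (u t).re * u'.re + (u'.im * (u t).im + (u t).im * u'.im)) t := by
    simp only [Complex.normSq_apply]
    exact (hre.mul hre).add (him.mul him)
  have hpos : Complex.normSq (u t) ≠ 0 := by simpa using h0
  have := (hn.log hpos).const_mul (1 / 2)
  have e : (fun t => Real.log ‖u t‖) = fun t => 1 / 2 * Real.log (Complex.normSq (u t)) := by
    funext t
    rw [Complex.normSq_eq_norm_sq, Real.log_pow]
    push_cast; ring
  rw [e]
  refine this.congr_deriv ?_
  rw [Complex.div_re]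
  field_simp
  ring

namespace Triangle

variable (T : Triangle)

/-- The apex of the triangle with base `[-1, 1]`. -/
def ζ : ℂ := 1 - (2 * T.c₁ / T.c₃ : ℝ) * T.n 0

/-- The reflected apex. -/
def ζ' : ℂ := (starRingEnd ℂ) T.ζ

lemma conj_n (j : Fin 3) : (starRingEnd ℂ) (T.n j) = (T.n j)⁻¹ := by
  rw [n, ← Complex.exp_conj, ← Complex.exp_neg]
  simp

lemma norm_n (j : Fin 3) : ‖T.n j‖ = 1 := Complex.norm_exp_ofReal_mul_I _

lemma n_two : T.n 2 = -1 := by simp [n, α]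

lemma sum_c_mul_n : T.c₁ * T.n 0 + T.c₂ * T.n 1 = T.c₃ := by
  have h1 := T.close_re
  have h2 := T.close_im
  apply Complex.ext <;> simp [n, α, Complex.exp_re, Complex.exp_im] <;> linarith

lemma one_sub_ζ : 1 - T.ζ = 2 * T.c₁ / T.c₃ * T.n 0 := by simp [ζ]

lemma c₃_ne : (T.c₃ : ℂ) ≠ 0 := by exact_mod_cast T.c₃_pos.ne'

lemma one_add_ζ : 1 + T.ζ = 2 * T.c₂ / T.c₃ * T.n 1 := by
  have := T.c₃_ne
  have h := T.sum_c_mul_n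
  simp only [ζ]
  push_cast
  field_simp
  linear_combination -2 * h

lemma one_sub_ζ' : 1 - T.ζ' = 2 * T.c₁ / T.c₃ * (T.n 0)⁻¹ := by
  have := congrArg (starRingEnd ℂ) T.one_sub_ζ
  simpa [conj_n, ζ', Complex.conj_ofNat] using this

lemma one_add_ζ' : 1 + T.ζ' = 2 * T.c₂ / T.c₃ * (T.n 1)⁻¹ := by
  have := congrArg (starRingEnd ℂ) T.one_add_ζ
  simpa [conj_n, ζ', Complex.conj_ofNat] using this

lemma ζ_im_pos : 0 < T.ζ.im := by
  have := mul_pos (mul_pos two_pos T.c₁_pos) T.sin_P_pos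
  have h3 := T.c₃_pos
  have h : T.ζ.im = 2 * T.c₁ / T.c₃ * Real.sin T.P := by
    simp only [ζ, n, α, Complex.sub_im, Complex.im_ofReal_mul, Complex.exp_ofReal_mul_I_im]
    simp
  rw [h]
  have := T.sin_P_pos
  have := T.c₁_pos
  positivity

lemma ζ'_im : T.ζ'.im = - T.ζ.im := by simp [ζ']

lemma ζ_sub_ζ' : T.ζ - T.ζ' = 2 * T.ζ.im * Complex.I := by
  simp [ζ', Complex.sub_conj]

lemma ζ_sub_ζ'_ne : T.ζ - T.ζ' ≠ 0 := by
  rw [ζ_sub_ζ']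
  have : (T.ζ.im : ℂ) ≠ 0 := by exact_mod_cast T.ζ_im_pos.ne'
  simp [this]

lemma ζ_ne_ζ' : T.ζ ≠ T.ζ' := sub_ne_zero.mp T.ζ_sub_ζ'_ne

lemma ne_of_im_eq_zero {z : ℂ} (h : z.im = 0) : z ≠ T.ζ ∧ z ≠ T.ζ' := by
  have := T.ζ_im_pos
  constructor <;> rintro rfl
  · linarith
  · rw [ζ'_im] at h; linarith

/-- The Möbius map that takes `ζ`, `ζ'`, `∞` to `0`, `∞`, `1`. -/
def mob (z : ℂ) : ℂ := (z - T.ζ) / (z - T.ζ')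

/-- The inverse of `mob`. -/
def mobInv (v : ℂ) : ℂ := (T.ζ - v * T.ζ') / (1 - v)

variable {T}

lemma mobInv_sub_ζ {v : ℂ} (hv : v ≠ 1) : T.mobInv v - T.ζ = v * (T.ζ - T.ζ') / (1 - v) := by
  have : 1 - v ≠ 0 := sub_ne_zero.mpr hv.symm
  rw [mobInv]; field_simp; ring

lemma mobInv_sub_ζ' {v : ℂ} (hv : v ≠ 1) : T.mobInv v - T.ζ' = (T.ζ - T.ζ') / (1 - v) := by
  have : 1 - v ≠ 0 := sub_ne_zero.mpr hv.symm
  rw [mobInv]; field_simp; ring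

lemma mobInv_ne_ζ' {v : ℂ} (hv : v ≠ 1) : T.mobInv v ≠ T.ζ' := by
  rw [← sub_ne_zero, mobInv_sub_ζ' hv]
  exact div_ne_zero T.ζ_sub_ζ'_ne (sub_ne_zero.mpr hv.symm)

lemma mobInv_ne_ζ {v : ℂ} (hv : v ≠ 1) (h0 : v ≠ 0) : T.mobInv v ≠ T.ζ := by
  rw [← sub_ne_zero, mobInv_sub_ζ hv]
  exact div_ne_zero (mul_ne_zero h0 T.ζ_sub_ζ'_ne) (sub_ne_zero.mpr hv.symm)

lemma mob_mobInv {v : ℂ} (hv : v ≠ 1) : T.mob (T.mobInv v) = v := by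
  have : 1 - v ≠ 0 := sub_ne_zero.mpr hv.symm
  have := T.ζ_sub_ζ'_ne
  rw [mob, mobInv_sub_ζ hv, mobInv_sub_ζ' hv]; field_simp

lemma one_sub_mob {z : ℂ} (hz : z ≠ T.ζ') : 1 - T.mob z = (T.ζ - T.ζ') / (z - T.ζ') := by
  have : z - T.ζ' ≠ 0 := sub_ne_zero.mpr hz
  rw [mob]; field_simp; ring

lemma mob_ne_one {z : ℂ} (hz : z ≠ T.ζ') : T.mob z ≠ 1 := by
  rw [ne_comm, ← sub_ne_zero, one_sub_mob hz]
  exact div_ne_zero T.ζ_sub_ζ'_ne (sub_ne_zero.mpr hz)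

lemma mob_ne_zero {z : ℂ} (hz : z ≠ T.ζ') (hz' : z ≠ T.ζ) : T.mob z ≠ 0 :=
  div_ne_zero (sub_ne_zero.mpr hz') (sub_ne_zero.mpr hz)

lemma mobInv_mob {z : ℂ} (hz : z ≠ T.ζ') : T.mobInv (T.mob z) = z := by
  have h1 : z - T.ζ' ≠ 0 := sub_ne_zero.mpr hz
  have h2 := T.ζ_sub_ζ'_ne
  rw [mobInv, one_sub_mob hz, mob]
  field_simp; ring

lemma mob_injOn {z z' : ℂ} (hz : z ≠ T.ζ') (hz' : z' ≠ T.ζ') (h : T.mob z = T.mob z') :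
    z = z' := by
  rw [← mobInv_mob hz, h, mobInv_mob hz']

lemma one_ne_ζ' : (1 : ℂ) ≠ T.ζ' := (T.ne_of_im_eq_zero (by simp)).2

lemma neg_one_ne_ζ' : (-1 : ℂ) ≠ T.ζ' := (T.ne_of_im_eq_zero (by simp)).2

/-- At a real point `mob` is the quotient of a number by its conjugate, so only twice the argument
of 1 - ζ survives. -/
lemma mob_one : T.mob 1 = T.n 0 ^ 2 := by
  rw [mob, one_sub_ζ, one_sub_ζ']
  have := T.c₃_ne
  have : (T.c₁ : ℂ) ≠ 0 := by exact_mod_cast T.c₁_pos.ne'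
  have := n_ne_zero (T := T) 0
  field_simp

lemma mob_neg_one : T.mob (-1) = T.n 1 ^ 2 := by
  rw [mob, show -1 - T.ζ = - (1 + T.ζ) by ring, show -1 - T.ζ' = -(1 + T.ζ') by ring, neg_div_neg_eq,
    one_add_ζ, one_add_ζ']
  have := T.c₃_ne
  have : (T.c₂ : ℂ) ≠ 0 := by exact_mod_cast T.c₂_pos.ne'
  have := n_ne_zero (T := T) 1
  field_simp

/-- The squares `nⱼ²` correspond to the points `1`, `-1`, `∞`. -/
lemma mob_ne_n_sq {z : ℂ} (hz : z ≠ T.ζ') (h1 : z ≠ 1) (h2 : z ≠ -1) (j : Fin 3) :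
    T.mob z ≠ T.n j ^ 2 := by
  fin_cases j
  · intro h; exact h1 (mob_injOn hz one_ne_ζ' (h.trans mob_one.symm))
  · intro h; exact h2 (mob_injOn hz neg_one_ne_ζ' (h.trans mob_neg_one.symm))
  · simpa [n_two] using mob_ne_one hz

lemma ne_of_mob_ne {z : ℂ} (h : ∀ j, T.mob z ≠ T.n j ^ 2) : z ≠ 1 ∧ z ≠ -1 := by
  constructor <;> rintro rfl
  · exact h 0 mob_one
  · exact h 1 mob_neg_one

variable (T) in
/-- The potential in the coordinate `w` with `w² = mob z`. -/
def H (w : ℂ) : ℝ := ∑ j, T.c j * (Real.log ‖w + T.n j‖ - Real.log ‖w - T.n j‖)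

variable (T) in
/-- The derivative of the complex potential in the coordinate `w`. -/
def G (w : ℂ) : ℂ := ∑ j, T.c j * (1 / (w + T.n j) - 1 / (w - T.n j))

lemma hasDerivAt_H {w : ℝ → ℂ} {w' : ℂ} {t : ℝ} (hw : HasDerivAt w w' t)
    (h : ∀ j, w t ^ 2 ≠ T.n j ^ 2) :
    HasDerivAt (fun t => T.H (w t)) (T.G (w t) * w').re t := by
  have hne : ∀ j, w t + T.n j ≠ 0 ∧ w t - T.n j ≠ 0 := fun j => by
    have := sub_ne_zero.mpr (h j)
    rw [sq_sub_sq] at this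
    exact ⟨left_ne_zero_of_mul this, right_ne_zero_of_mul this⟩
  unfold H
  have : ∀ j ∈ Finset.univ, HasDerivAt
      (fun t => T.c j * (Real.log ‖w t + T.n j‖ - Real.log ‖w t - T.n j‖))
      (T.c j * ((w' / (w t + T.n j)).re - (w' / (w t - T.n j)).re)) t := fun j _ =>
    ((hasDerivAt_log_norm (hw.add_const _) (hne j).1).sub
      (hasDerivAt_log_norm (hw.sub_const _) (hne j).2)).const_mul _
  refine (HasDerivAt.fun_sum this).congr_deriv ?_
  rw [G, Finset.sum_mul, Complex.re_sum]
  refine Finset.sum_congr rfl fun j _ => ?_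
  rw [mul_assoc, Complex.re_ofReal_mul, sub_mul, Complex.sub_re, one_div_mul_eq_div,
    one_div_mul_eq_div]

lemma continuousAt_H {w : ℂ} (h : ∀ j, w ^ 2 ≠ T.n j ^ 2) : ContinuousAt T.H w := by
  have hne : ∀ j, w + T.n j ≠ 0 ∧ w - T.n j ≠ 0 := fun j => by
    have := sub_ne_zero.mpr (h j)
    rw [sq_sub_sq] at this
    exact ⟨left_ne_zero_of_mul this, right_ne_zero_of_mul this⟩
  unfold H
  refine tendsto_finsetSum _ fun j _ => Tendsto.const_mul _ (Tendsto.sub ?_ ?_)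
  · exact ContinuousAt.log (by fun_prop) (norm_ne_zero_iff.mpr (hne j).1)
  · exact ContinuousAt.log (by fun_prop) (norm_ne_zero_iff.mpr (hne j).2)

lemma H_zero : T.H 0 = 0 := by simp [H]

/-- The potential is antisymmetric under inversion in the unit circle, up to the reflection of
the directions; at infinity it tends to `0`. -/
lemma tendsto_H_of_inv {ι : Type*} {l : Filter ι} {w : ι → ℂ} (h0 : ∀ᶠ i in l, w i ≠ 0)
    (h : Tendsto (fun i => (w i)⁻¹) l (𝓝 0)) : Tendsto (fun i => T.H (w i)) l (𝓝 0) := by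
  have h1 : Tendsto (fun u : ℂ => ∑ j, T.c j * (Real.log ‖1 + T.n j * u‖
      - Real.log ‖1 - T.n j * u‖)) (𝓝 0) (𝓝 0) := by
    have : ContinuousAt (fun u : ℂ => ∑ j, T.c j * (Real.log ‖1 + T.n j * u‖
      - Real.log ‖1 - T.n j * u‖)) 0 := by
      refine tendsto_finsetSum _ fun j _ => Tendsto.const_mul _ (Tendsto.sub ?_ ?_)
      · exact ContinuousAt.log (by fun_prop) (by simp)
      · exact ContinuousAt.log (by fun_prop) (by simp)
    simpa [ContinuousAt] using this
  have hne : ∀ j, ∀ᶠ i in l, 1 + T.n j * (w i)⁻¹ ≠ 0 ∧ 1 - T.n j * (w i)⁻¹ ≠ 0 := fun j => by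
    have a1 : Tendsto (fun i => 1 + T.n j * (w i)⁻¹) l (𝓝 (1 + T.n j * 0)) :=
      (h.const_mul _).const_add _
    have a2 : Tendsto (fun i => 1 - T.n j * (w i)⁻¹) l (𝓝 (1 - T.n j * 0)) :=
      (h.const_mul _).const_sub _
    exact (a1.eventually_ne (by simp)).and (a2.eventually_ne (by simp))
  refine (h1.comp h).congr' ?_
  filter_upwards [h0, eventually_all.mpr hne] with i hi hne
  refine Finset.sum_congr rfl fun j _ => ?_
  have e1 : w i + T.n j = w i * (1 + T.n j * (w i)⁻¹) := by field_simp
  have e2 : w i - T.n j = w i * (1 - T.n j * (w i)⁻¹) := by field_simp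
  rw [e1, e2, norm_mul, norm_mul, Real.log_mul (norm_ne_zero_iff.mpr hi)
    (norm_ne_zero_iff.mpr (hne j).1), Real.log_mul (norm_ne_zero_iff.mpr hi)
    (norm_ne_zero_iff.mpr (hne j).2)]
  ring

lemma G_eq {w : ℂ} (h : ∀ j, w ^ 2 ≠ T.n j ^ 2) :
    T.G w = - ∑ j, 2 * (T.c j * T.n j) / (w ^ 2 - T.n j ^ 2) := by
  rw [G, ← Finset.sum_neg_distrib]
  refine Finset.sum_congr rfl fun j _ => ?_
  have h1 := sub_ne_zero.mpr (h j)
  have h2 := h1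
  rw [sq_sub_sq] at h2
  have h3 := left_ne_zero_of_mul h2
  have h4 := right_ne_zero_of_mul h2
  field_simp
  ring

/-- The differential `c₃ R dz / (z² - 1)` is, in the coordinate `w`, the differential of the complex
potential. -/
lemma G_eq_of_sq {z w : ℂ} (hz : z ≠ T.ζ') (h1 : z ≠ 1) (h2 : z ≠ -1) (hw : w ^ 2 = T.mob z) :
    T.c₃ * (w * (z - T.ζ') / (z ^ 2 - 1)) * (2 * w * (z - T.ζ') ^ 2 / (T.ζ - T.ζ')) = - T.G w := by
  have hn := mob_ne_n_sq hz h1 h2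
  rw [← hw] at hn
  rw [G_eq hn, neg_neg, Fin.sum_univ_three]
  have z1 := sub_ne_zero.mpr hz
  have z2 := sub_ne_zero.mpr h1
  have z3 : z + 1 ≠ 0 := fun h => h2 (eq_neg_of_add_eq_zero_left h)
  have z4 : z ^ 2 - 1 = (z - 1) * (z + 1) := by ring
  have d := T.ζ_sub_ζ'_ne
  have c3 := T.c₃_ne
  have d1 : 1 - T.ζ' ≠ 0 := sub_ne_zero.mpr one_ne_ζ'
  have d2 : 1 + T.ζ' ≠ 0 := fun h => neg_one_ne_ζ' (T := T) (by linear_combination -h)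
  -- All six quantities in the partial fractions are expressed through ζ, ζ' and z: `a0`, `a1`, `a2`
  -- give the numerators, `b0`, `b1`, `b2` the denominators.
  have a0 : (T.c 0 * T.n 0 : ℂ) = T.c₃ / 2 * (1 - T.ζ) := by
    rw [one_sub_ζ]; field_simp; simp [c, mul_comm]
  have a1 : (T.c 1 * T.n 1 : ℂ) = T.c₃ / 2 * (1 + T.ζ) := by
    rw [one_add_ζ]; field_simp; simp [c, mul_comm]
  have a2 : (T.c 2 * T.n 2 : ℂ) = - T.c₃ := by simp [n_two, c]
  have b0 : w ^ 2 - T.n 0 ^ 2 = (z - 1) * (T.ζ - T.ζ') / ((z - T.ζ') * (1 - T.ζ')) := by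
    rw [hw, ← mob_one, mob, mob]; field_simp; ring
  have b1 : w ^ 2 - T.n 1 ^ 2 = - (z + 1) * (T.ζ - T.ζ') / ((z - T.ζ') * (1 + T.ζ')) := by
    rw [hw, ← mob_neg_one, mob, mob, show -1 - T.ζ = - (1 + T.ζ) by ring,
      show -1 - T.ζ' = -(1 + T.ζ') by ring, neg_div_neg_eq]; field_simp; ring
  have b2 : w ^ 2 - T.n 2 ^ 2 = - (T.ζ - T.ζ') / (z - T.ζ') := by
    rw [hw, n_two, mob]; field_simp; ring
  rw [a0, a1, a2, b0, b1, b2]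
  have e : T.c₃ * (w * (z - T.ζ') / (z ^ 2 - 1)) * (2 * w * (z - T.ζ') ^ 2 / (T.ζ - T.ζ'))
      = T.c₃ * (2 * (z - T.ζ) * (z - T.ζ') ^ 2) / ((z ^ 2 - 1) * (T.ζ - T.ζ')) := by
    have : w ^ 2 * (z - T.ζ') = z - T.ζ := by rw [hw, mob]; field_simp
    rw [← this]
    field_simp
  rw [e, z4]
  field_simp
  ring

lemma hasDerivAt_mob {z : ℂ} (hz : z ≠ T.ζ') :
    HasDerivAt T.mob ((T.ζ - T.ζ') / (z - T.ζ') ^ 2) z := by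
  have h := sub_ne_zero.mpr hz
  have := ((hasDerivAt_id z).sub_const T.ζ).div ((hasDerivAt_id z).sub_const T.ζ') h
  refine this.congr_deriv ?_
  simp only [id]
  congr 1
  ring

/-- The differential `c₃ R dz / (z² - 1)` along a curve with lift `w`. -/
lemma integrand_eq {p w : ℝ → ℂ} {p' : ℂ} {t : ℝ} (hp : HasDerivAt p p' t)
    (hw : ContinuousAt w t)
    (hsq : ∀ᶠ u in 𝓝 t, w u ^ 2 = T.mob (p u)) (h0 : p t ≠ T.ζ) (h0' : p t ≠ T.ζ')
    (h1 : p t ≠ 1) (h2 : p t ≠ -1) :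
    ∃ w', HasDerivAt w w' t ∧
      T.c₃ * (w t * (p t - T.ζ') / (p t ^ 2 - 1) * p') = - (T.G (w t) * w') := by
  have hwt : w t ^ 2 = T.mob (p t) := hsq.self_of_nhds
  have hw0 : w t ≠ 0 := fun h => mob_ne_zero h0' h0 (by rw [← hwt, h]; ring)
  have hm := (hasDerivAt_mob h0').comp t hp
  refine ⟨_, hasDerivAt_of_sq_eq hw hm hsq hw0, ?_⟩
  rw [← neg_mul, ← G_eq_of_sq h0' h1 h2 hwt]
  have := sub_ne_zero.mpr h0'
  have := T.ζ_sub_ζ'_ne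
  field_simp

/-- The integral that defines `Γ` in terms of the potential. -/
lemma re_integral_eq {p s : ℝ → ℂ} (hp : ContDiff ℝ 1 p) (hp0 : p 0 = T.ζ')
    (hp1 : p 1 ≠ T.ζ') (h1 : ∀ t ∈ Set.Icc (0 : ℝ) 1, p t ≠ 1 ∧ p t ≠ -1)
    (h2 : ∀ t ∈ Set.Ioo (0 : ℝ) 1, p t ≠ T.ζ ∧ p t ≠ T.ζ')
    (hs : ContinuousOn s (Set.Icc 0 1))
    (hsq : ∀ t ∈ Set.Icc (0 : ℝ) 1, s t ^ 2 = (p t - T.ζ) * (p t - T.ζ')) :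
    T.c₃ * (∫ t in (0 : ℝ)..1, s t / (p t ^ 2 - 1) * deriv p t).re
      = - T.H (s 1 / (p 1 - T.ζ')) := by
  have hpc : Continuous p := hp.continuous
  set w : ℝ → ℂ := fun t => s t / (p t - T.ζ') with hw
  have hwsq : ∀ t ∈ Set.Icc (0 : ℝ) 1, p t ≠ T.ζ' → w t ^ 2 = T.mob (p t) := by
    intro t ht hne
    have := sub_ne_zero.mpr hne
    simp only [hw]
    rw [div_pow, hsq t ht, mob]
    field_simp
  have hF : ContinuousOn (fun t => s t / (p t ^ 2 - 1) * deriv p t) (Set.uIcc 0 1) := by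
    rw [Set.uIcc_of_le zero_le_one]
    refine (hs.div (by fun_prop) fun t ht h => ?_).mul (hp.continuous_deriv le_rfl).continuousOn
    have : (p t - 1) * (p t + 1) = 0 := by linear_combination h
    rcases mul_eq_zero.mp this with h | h
    · exact (h1 t ht).1 (sub_eq_zero.mp h)
    · exact (h1 t ht).2 (eq_neg_of_add_eq_zero_left h)
  have hint := hF.intervalIntegrable (μ := volume)
  have hre : (∫ t in (0 : ℝ)..1, s t / (p t ^ 2 - 1) * deriv p t).re
      = ∫ t in (0 : ℝ)..1, (s t / (p t ^ 2 - 1) * deriv p t).re :=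
    (Complex.reCLM.intervalIntegral_comp_comm hint).symm
  have hderiv : ∀ t ∈ Set.Ioo (0 : ℝ) 1, HasDerivAt (fun t => - T.H (w t))
      (T.c₃ * (s t / (p t ^ 2 - 1) * deriv p t).re) t := by
    intro t ht
    have hIcc : Set.Icc (0 : ℝ) 1 ∈ 𝓝 t := Icc_mem_nhds ht.1 ht.2
    have hne := (h2 t ht).2
    have hsc : ContinuousAt s t := hs.continuousAt hIcc
    have hwc : ContinuousAt w t := hsc.div (by fun_prop) (sub_ne_zero.mpr hne)
    have hev : ∀ᶠ u in 𝓝 t, w u ^ 2 = T.mob (p u) := by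
      filter_upwards [hIcc, hpc.continuousAt.eventually_ne hne] with u hu hu'
      exact hwsq u hu hu'
    have ht' := Set.Ioo_subset_Icc_self ht
    obtain ⟨w', hw', he⟩ := integrand_eq (hp.differentiable one_ne_zero t).hasDerivAt hwc hev
      (h2 t ht).1 hne (h1 t ht').1 (h1 t ht').2
    have hn := mob_ne_n_sq hne (h1 t ht').1 (h1 t ht').2
    rw [← hev.self_of_nhds] at hn
    refine (hasDerivAt_H hw' hn).neg.congr_deriv ?_
    rw [← Complex.neg_re, ← he, Complex.re_ofReal_mul]
    congr 3
    simp only [hw]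
    rw [div_mul_cancel₀ _ (sub_ne_zero.mpr hne)]
  -- The path starts at ζ', where w is infinite and the formula for w is 0 / 0. The boundary term at
  -- 0 is therefore a limit: w⁻¹ tends to 0, since |w⁻¹|² = |(p - ζ') / (p - ζ)|, and the potential
  -- vanishes at infinity.
  have h0lim : Tendsto (fun t => - T.H (w t)) (𝓝[>] 0) (𝓝 0) := by
    have hev : ∀ᶠ t in 𝓝[>] (0 : ℝ), t ∈ Set.Ioo (0 : ℝ) 1 := Ioo_mem_nhdsGT zero_lt_one
    have hev' : ∀ᶠ t in 𝓝[>] (0 : ℝ), w t ≠ 0 ∧ ‖(w t)⁻¹‖ ^ 2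
        = ‖(p t - T.ζ') / (p t - T.ζ)‖ := by
      filter_upwards [hev] with t ht
      have hh := hwsq t (Set.Ioo_subset_Icc_self ht) (h2 t ht).2
      refine ⟨fun h => mob_ne_zero (h2 t ht).2 (h2 t ht).1 (by rw [← hh, h]; ring), ?_⟩
      rw [← norm_pow, inv_pow, hh, mob, inv_div]
    suffices h : Tendsto (fun t => T.H (w t)) (𝓝[>] 0) (𝓝 0) by simpa using h.neg
    refine tendsto_H_of_inv (hev'.mono fun t h => h.1) ?_
    rw [tendsto_zero_iff_norm_tendsto_zero]
    have hlim : Tendsto (fun t => ‖(p t - T.ζ') / (p t - T.ζ)‖) (𝓝[>] (0 : ℝ)) (𝓝 0) := by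
      have hne : p 0 - T.ζ ≠ 0 := by rw [hp0]; exact sub_ne_zero.mpr T.ζ_ne_ζ'.symm
      have : ContinuousAt (fun t => ‖(p t - T.ζ') / (p t - T.ζ)‖) 0 := by
        refine ContinuousAt.norm (ContinuousAt.div ?_ ?_ hne) <;> fun_prop
      have := this.tendsto.mono_left (nhdsWithin_le_nhds (s := Set.Ioi 0))
      simpa [hp0] using this
    have hsqrt := (Real.continuous_sqrt.tendsto 0).comp hlim
    rw [Real.sqrt_zero] at hsqrt
    refine hsqrt.congr' ?_
    filter_upwards [hev'] with t ht
    simp only [Function.comp]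
    rw [← ht.2, Real.sqrt_sq (norm_nonneg _)]
  have h1lim : Tendsto (fun t => - T.H (w t)) (𝓝[<] 1) (𝓝 (- T.H (w 1))) := by
    have hone := Set.right_mem_Icc.mpr (zero_le_one (α := ℝ))
    have hn := mob_ne_n_sq hp1 (h1 1 hone).1 (h1 1 hone).2
    rw [← hwsq 1 hone hp1] at hn
    have hwc : ContinuousWithinAt w (Set.Icc 0 1) 1 :=
      (hs 1 hone).div (by fun_prop) (sub_ne_zero.mpr hp1)
    have hwc' : Tendsto w (𝓝[<] 1) (𝓝 (w 1)) := by
      refine hwc.tendsto.mono_left ?_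
      exact nhdsWithin_le_iff.mpr (mem_of_superset (Ioo_mem_nhdsLT zero_lt_one)
        Set.Ioo_subset_Icc_self)
    exact ((continuousAt_H hn).tendsto.comp hwc').neg
  have hreint : IntervalIntegrable (fun t => T.c₃ * (s t / (p t ^ 2 - 1) * deriv p t).re)
      volume 0 1 := by
    refine ContinuousOn.intervalIntegrable ?_
    exact continuousOn_const.mul (Complex.continuous_re.comp_continuousOn hF)
  have := intervalIntegral.integral_eq_sub_of_hasDerivAt_of_tendsto zero_lt_one hderiv hreint
    h0lim h1lim
  rw [hre, ← intervalIntegral.integral_const_mul, this, sub_zero]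

end Triangle

end JacobiZeros

end

/-! ### Identification of `Gam` with the zero curves -/

noncomputable section

namespace JacobiZeros

namespace Triangle

variable {T : Triangle}

/-! ### Polar coordinates -/

lemma exp_polar (x θ : ℝ) : Complex.exp (x + θ * Complex.I)
    = Complex.exp x * Complex.exp (θ * Complex.I) := Complex.exp_add _ _

lemma norm_exp_polar (x θ : ℝ) : ‖Complex.exp (x + θ * Complex.I)‖ = Real.exp x := by
  rw [Complex.norm_exp]; simp

lemma exp_polar_sq_eq_iff {x y θ φ : ℝ} : Complex.exp (x + θ * Complex.I) ^ 2
    = Complex.exp (y + φ * Complex.I) ^ 2 ↔ x = y ∧ ∃ m : ℤ, θ = φ + m * Real.pi := by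
  rw [← Complex.exp_nat_mul, ← Complex.exp_nat_mul, Complex.exp_eq_exp_iff_exists_int]
  constructor
  · rintro ⟨m, hm⟩
    have h1 := congrArg Complex.re hm
    have h2 := congrArg Complex.im hm
    simp at h1 h2
    exact ⟨h1, m, by linarith⟩
  · rintro ⟨rfl, m, rfl⟩
    refine ⟨m, ?_⟩
    push_cast
    ring

lemma reg_iff {x θ : ℝ} : T.Reg x θ ↔ ∀ j, Complex.exp (x + θ * Complex.I) ^ 2 ≠ T.n j ^ 2 := by
  refine forall_congr' fun j => not_congr ?_
  rw [← normSq_S, Complex.normSq_eq_zero, ← sub_eq_zero (b := T.n j ^ 2), exp_polar, mul_pow,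
    ← two_mul_S]
  simp [n_ne_zero]

lemma H_exp {x θ : ℝ} (h : T.Reg x θ) : T.H (Complex.exp (x + θ * Complex.I)) = T.U x θ := by
  have key : ∀ (ε : ℝ) (j : Fin 3), ε ^ 2 = 1 → 0 < Real.cosh x + ε * Real.cos (θ - T.α j) →
      Real.log ‖Complex.exp (x + θ * Complex.I) + ε * T.n j‖ = 1 / 2 * (Real.log 2 + x +
        Real.log (Real.cosh x + ε * Real.cos (θ - T.α j))) := by
    intro ε j hε hpos
    -- The identity |w ± nⱼ|² = 2 exp x (cosh x ± cos (θ - αⱼ)); the prefactor cancels in the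
    -- difference of logarithms.
    have h1 : Complex.normSq (Complex.exp (x + θ * Complex.I) + ε * T.n j)
        = 2 * Real.exp x * (Real.cosh x + ε * Real.cos (θ - T.α j)) := by
      rw [exp_polar, ← Complex.ofReal_exp, n, Complex.normSq_apply]
      simp only [Complex.add_re, Complex.add_im, Complex.re_ofReal_mul, Complex.im_ofReal_mul,
        Complex.exp_ofReal_mul_I_re, Complex.exp_ofReal_mul_I_im, Real.cos_sub]
      have e1 := Real.sin_sq_add_cos_sq θ
      have e2 := Real.sin_sq_add_cos_sq (T.α j)
      have e3 : 2 * Real.exp x * Real.cosh x = Real.exp x ^ 2 + 1 := by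
        rw [Real.cosh_eq, Real.exp_neg]
        field_simp
      linear_combination Real.exp x ^ 2 * e1 + ε ^ 2 * e2 + hε - e3
    have h2 := Complex.normSq_eq_norm_sq (Complex.exp (x + θ * Complex.I) + ε * T.n j)
    have h3 : Real.log (‖Complex.exp (x + θ * Complex.I) + ε * T.n j‖ ^ 2)
        = Real.log 2 + x + Real.log (Real.cosh x + ε * Real.cos (θ - T.α j)) := by
      rw [← h2, h1, Real.log_mul (by positivity) hpos.ne', Real.log_mul two_ne_zero
        (Real.exp_pos x).ne', Real.log_exp]
    rw [Real.log_pow] at h3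
    push_cast at h3
    linarith
  rw [H, U]
  refine Finset.sum_congr rfl fun j _ => ?_
  have h1 := key 1 j (by norm_num) (by simpa using h.add_pos j)
  have h2 := key (-1) j (by norm_num) (by simpa [sub_eq_add_neg] using h.sub_pos j)
  simp only [Complex.ofReal_one, one_mul, Complex.ofReal_neg, neg_mul, ← sub_eq_add_neg] at h1 h2
  rw [h1, h2]
  ring

variable (T) in
/-- The lift of the `k`-th zero curve to the coordinate `w`. -/
def lift (k : Fin 3) (x : ℝ) : ℂ := Complex.exp (x + T.ang k x * Complex.I)

variable (T) in
/-- The `k`-th zero curve. -/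
def pt (k : Fin 3) (x : ℝ) : ℂ := T.mobInv (T.lift k x ^ 2)

lemma lift_sq_ne (k : Fin 3) (x : ℝ) (j : Fin 3) : T.lift k x ^ 2 ≠ T.n j ^ 2 :=
  reg_iff.mp (reg_ang k x) j

lemma lift_sq_ne_one (k : Fin 3) (x : ℝ) : T.lift k x ^ 2 ≠ 1 := by
  simpa [n_two] using lift_sq_ne k x 2

lemma lift_ne_zero (k : Fin 3) (x : ℝ) : T.lift k x ≠ 0 := Complex.exp_ne_zero _

lemma norm_lift (k : Fin 3) (x : ℝ) : ‖T.lift k x‖ = Real.exp x := norm_exp_polar _ _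

lemma H_lift (k : Fin 3) (x : ℝ) : T.H (T.lift k x) = 0 := by
  rw [lift, H_exp (reg_ang k x), U_ang]

lemma mob_pt (k : Fin 3) (x : ℝ) : T.mob (T.pt k x) = T.lift k x ^ 2 :=
  mob_mobInv (lift_sq_ne_one k x)

lemma pt_ne_ζ (k : Fin 3) (x : ℝ) : T.pt k x ≠ T.ζ :=
  mobInv_ne_ζ (lift_sq_ne_one k x) (pow_ne_zero 2 (lift_ne_zero k x))

lemma pt_ne_ζ' (k : Fin 3) (x : ℝ) : T.pt k x ≠ T.ζ' := mobInv_ne_ζ' (lift_sq_ne_one k x)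

lemma pt_ne (k : Fin 3) (x : ℝ) : T.pt k x ≠ 1 ∧ T.pt k x ≠ -1 :=
  ne_of_mob_ne fun j => by rw [mob_pt]; exact lift_sq_ne k x j

lemma pt_inj {k l : Fin 3} {x y : ℝ} (h : T.pt k x = T.pt l y) : k = l ∧ x = y := by
  have h1 := congrArg T.mob h
  rw [mob_pt, mob_pt, lift, lift, exp_polar_sq_eq_iff] at h1
  obtain ⟨rfl, m, hm⟩ := h1
  exact ⟨(ang_eq_add_int hm).1, rfl⟩

lemma exists_eq_pt {z w : ℂ} (h0 : z ≠ T.ζ) (h0' : z ≠ T.ζ') (h1 : z ≠ 1) (h2 : z ≠ -1)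
    (hw : w ^ 2 = T.mob z) (hH : T.H w = 0) : ∃ k x, z = T.pt k x := by
  have hw0 : w ≠ 0 := fun h => mob_ne_zero h0' h0 (by rw [← hw, h]; ring)
  obtain ⟨x, θ, rfl⟩ : ∃ x θ : ℝ, w = Complex.exp (x + θ * Complex.I) :=
    ⟨(Complex.log w).re, (Complex.log w).im, by rw [Complex.re_add_im, Complex.exp_log hw0]⟩
  have hr : T.Reg x θ := reg_iff.mpr fun j => by rw [hw]; exact mob_ne_n_sq h0' h1 h2 j
  rw [H_exp hr] at hH
  obtain ⟨k, m, hkm⟩ := exists_eq_ang hr hH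
  refine ⟨k, x, mob_injOn h0' (pt_ne_ζ' k x) ?_⟩
  rw [mob_pt, lift, ← hw, exp_polar_sq_eq_iff]
  exact ⟨rfl, m, hkm⟩

/-! ### The set `Γ` in polar coordinates -/

variable (T) in
/-- The point with `mob z = t / (1 - t) * exp (2 i θ)`. -/
def polar (t θ : ℝ) : ℂ :=
  (T.ζ * (1 - t) - t * Complex.exp (θ * Complex.I) ^ 2 * T.ζ')
    / ((1 - t) - t * Complex.exp (θ * Complex.I) ^ 2)

/-- The moduli of 1 - t and t agree only for t = 1/2, which is the real line; there the denominator
vanishes exactly at the point that represents ∞. -/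
lemma polar_den_ne {t θ : ℝ} (h : t = 1 / 2 → Complex.exp (θ * Complex.I) ^ 2 ≠ 1) :
    (1 - t : ℂ) - t * Complex.exp (θ * Complex.I) ^ 2 ≠ 0 := by
  intro h0
  have h1 := congrArg norm (sub_eq_zero.mp h0)
  rw [norm_mul, norm_pow, Complex.norm_exp_ofReal_mul_I, one_pow, mul_one] at h1
  rw [show (1 - t : ℂ) = ((1 - t : ℝ) : ℂ) by push_cast; ring, Complex.norm_real,
    Complex.norm_real, Real.norm_eq_abs, Real.norm_eq_abs, abs_eq_abs] at h1
  have ht : t = 1 / 2 := by rcases h1 with h1 | h1 <;> linarith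
  refine h ht ?_
  rw [ht] at h0
  push_cast at h0
  linear_combination -2 * h0

lemma polar_sub_ζ {t θ : ℝ} (h : t = 1 / 2 → Complex.exp (θ * Complex.I) ^ 2 ≠ 1) :
    T.polar t θ - T.ζ = t * Complex.exp (θ * Complex.I) ^ 2 * (T.ζ - T.ζ')
      / ((1 - t) - t * Complex.exp (θ * Complex.I) ^ 2) := by
  have := polar_den_ne h
  rw [polar]; field_simp; ring

lemma polar_sub_ζ' {t θ : ℝ} (h : t = 1 / 2 → Complex.exp (θ * Complex.I) ^ 2 ≠ 1) :
    T.polar t θ - T.ζ' = (1 - t) * (T.ζ - T.ζ')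
      / ((1 - t) - t * Complex.exp (θ * Complex.I) ^ 2) := by
  have := polar_den_ne h
  rw [polar]; field_simp; ring

lemma mob_polar {t θ : ℝ} (h : t = 1 / 2 → Complex.exp (θ * Complex.I) ^ 2 ≠ 1) (ht : t ≠ 1) :
    T.mob (T.polar t θ) = (t / (1 - t) : ℝ) * Complex.exp (θ * Complex.I) ^ 2 := by
  have h1 := polar_den_ne h
  have h2 := T.ζ_sub_ζ'_ne
  have h3 : (1 - t : ℂ) ≠ 0 := by exact_mod_cast sub_ne_zero.mpr ht.symm
  rw [mob, polar_sub_ζ h, polar_sub_ζ' h]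
  push_cast
  field_simp

lemma polar_ne_ζ {t θ : ℝ} (h : t = 1 / 2 → Complex.exp (θ * Complex.I) ^ 2 ≠ 1) (ht : t ≠ 0) :
    T.polar t θ ≠ T.ζ := by
  have ht' : (t : ℂ) ≠ 0 := by exact_mod_cast ht
  rw [← sub_ne_zero, polar_sub_ζ h]
  exact div_ne_zero (mul_ne_zero (mul_ne_zero ht' (pow_ne_zero 2 (Complex.exp_ne_zero _)))
    T.ζ_sub_ζ'_ne) (polar_den_ne h)

lemma polar_ne_ζ' {t θ : ℝ} (h : t = 1 / 2 → Complex.exp (θ * Complex.I) ^ 2 ≠ 1) (ht : t ≠ 1) :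
    T.polar t θ ≠ T.ζ' := by
  have ht' : (1 - t : ℂ) ≠ 0 := by exact_mod_cast sub_ne_zero.mpr ht.symm
  rw [← sub_ne_zero, polar_sub_ζ' h]
  exact div_ne_zero (mul_ne_zero ht' T.ζ_sub_ζ'_ne) (polar_den_ne h)

lemma polar_zero (θ : ℝ) : T.polar 0 θ = T.ζ := by simp [polar]

lemma polar_one (θ : ℝ) : T.polar 1 θ = T.ζ' := by
  simp [polar]

/-- The radial coordinate on `(0, 1)`. -/
def logit (t : ℝ) : ℝ := Real.log (t / (1 - t)) / 2

lemma exp_logit {t : ℝ} (ht : t ∈ Set.Ioo (0 : ℝ) 1) (θ : ℝ) :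
    Complex.exp (logit t + θ * Complex.I) ^ 2
      = (t / (1 - t) : ℝ) * Complex.exp (θ * Complex.I) ^ 2 := by
  have : 0 < t / (1 - t) := div_pos ht.1 (sub_pos.mpr ht.2)
  rw [exp_polar, mul_pow, ← Complex.exp_nat_mul, logit]
  congr 1
  rw [show ((2 : ℕ) : ℂ) * ((Real.log (t / (1 - t)) / 2 : ℝ) : ℂ)
    = (Real.log (t / (1 - t)) : ℝ) by push_cast; ring, ← Complex.ofReal_exp, Real.exp_log this]

lemma polar_eq_pt {t : ℝ} (ht : t ∈ Set.Ioo (0 : ℝ) 1) (k : Fin 3) :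
    T.polar t (T.ang k (logit t)) = T.pt k (logit t) := by
  have h : t = 1 / 2 → Complex.exp (T.ang k (logit t) * Complex.I) ^ 2 ≠ 1 := by
    rintro rfl
    have := lift_sq_ne_one (T := T) k (logit (1 / 2))
    rw [lift, exp_logit ht] at this
    norm_num at this
    norm_num
    exact this
  refine mob_injOn (polar_ne_ζ' h ht.2.ne) (pt_ne_ζ' _ _) ?_
  rw [mob_polar h ht.2.ne, mob_pt, lift, exp_logit ht]

lemma exists_logit_eq (x : ℝ) : ∃ t ∈ Set.Ioo (0 : ℝ) 1, logit t = x := by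
  have h := Real.exp_pos (2 * x)
  refine ⟨Real.exp (2 * x) / (1 + Real.exp (2 * x)), ⟨by positivity, ?_⟩, ?_⟩
  · rw [div_lt_one (by positivity)]; linarith
  · have : Real.exp (2 * x) / (1 + Real.exp (2 * x)) / (1 - Real.exp (2 * x) / (1 + Real.exp (2 * x)))
        = Real.exp (2 * x) := by field_simp; ring
    rw [logit, this, Real.log_exp]
    ring

section Gam

variable {A B : ℝ} (hp : zetaPlus A B = T.ζ) (hm : zetaMinus A B = T.ζ')
include hp hm

/-- A point that is reached from `ζ'` along a spiral which crosses the real line away from the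
singular points lies on `Γ` if the potential vanishes there. -/
lemma polar_mem_Gam {τ₀ : ℝ} (hτ₀ : τ₀ ∈ Set.Ico (0 : ℝ) 1) (φ l : ℝ)
    (hreg : T.Reg 0 (φ + l * (1 / 2 - τ₀)))
    (hH : T.H (Real.sqrt (τ₀ * (1 - τ₀)) * Complex.exp (φ * Complex.I) / (1 - τ₀)) = 0) :
    T.polar τ₀ φ ∈ Gam A B := by
  -- The path runs from τ = 1 (the point ζ') down to τ₀ while its angle changes linearly. It can
  -- meet ±1 or ∞ only at τ = 1/2, and the slope l steers it through a regular angle there.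
  set θ : ℝ → ℝ := fun τ => φ + l * (τ - τ₀) with hθ
  set r : ℝ → ℝ := fun t => 1 - t * (1 - τ₀) with hr
  have hτ : 0 < 1 - τ₀ := sub_pos.mpr hτ₀.2
  rw [reg_iff] at hreg
  have hreg' : ∀ τ j, τ = 1 / 2 → Complex.exp (θ τ * Complex.I) ^ 2 ≠ T.n j ^ 2 := by
    rintro τ j rfl
    simpa [hθ] using hreg j
  have hne : ∀ τ, τ = 1 / 2 → Complex.exp (θ τ * Complex.I) ^ 2 ≠ 1 := fun τ h => by
    simpa [n_two] using hreg' τ 2 h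
  have hden := fun τ => polar_den_ne (hne τ)
  have hr0 : ∀ t ∈ Set.Icc (0 : ℝ) 1, r t ∈ Set.Icc 0 1 := fun t ht =>
    ⟨by simp only [hr]; nlinarith [ht.1, ht.2, hτ₀.1], by simp only [hr]; nlinarith [ht.1, ht.2]⟩
  have hr1 : ∀ t ∈ Set.Ioo (0 : ℝ) 1, r t ∈ Set.Ioo 0 1 := fun t ht =>
    ⟨by simp only [hr]; nlinarith [ht.1, ht.2, hτ₀.1], by simp only [hr]; nlinarith [ht.1, ht.2]⟩
  have hrone : r 1 = τ₀ := by simp [hr]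
  have hθone : θ (r 1) = φ := by rw [hrone]; simp [hθ]
  have hden1 : (1 - τ₀ : ℂ) - τ₀ * Complex.exp (φ * Complex.I) ^ 2 ≠ 0 := by
    have := hden (r 1)
    rwa [hθone, hrone] at this
  have hrC : ContDiff ℝ 1 r := contDiff_const.sub (contDiff_id.mul contDiff_const)
  have hθC : ContDiff ℝ 1 fun t => θ (r t) :=
    contDiff_const.add (contDiff_const.mul (hrC.sub contDiff_const))
  have hrC' : ContDiff ℝ 1 fun t => (r t : ℂ) := Complex.ofRealCLM.contDiff.comp hrC
  have hθC' : ContDiff ℝ 1 fun t => (θ (r t) : ℂ) := Complex.ofRealCLM.contDiff.comp hθC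
  set p : ℝ → ℂ := fun t => T.polar (r t) (θ (r t)) with hpdef
  set s : ℝ → ℂ := fun t => (T.ζ - T.ζ') * Real.sqrt (r t * (1 - r t))
    * Complex.exp (θ (r t) * Complex.I) / ((1 - r t) - r t * Complex.exp (θ (r t) * Complex.I) ^ 2)
    with hsdef
  have hp1 : p 1 = T.polar τ₀ φ := by
    simp only [hpdef]
    rw [hθone, hrone]
  have hp0 : p 0 = T.ζ' := by simp [hpdef, hr, polar_one]
  have hne1 : τ₀ = 1 / 2 → Complex.exp (φ * Complex.I) ^ 2 ≠ 1 := by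
    have := hne (r 1)
    rwa [hθone, hrone] at this
  have hpC : ContDiff ℝ 1 p := by
    have : ContDiff ℝ 1 (fun t => Complex.exp (θ (r t) * Complex.I) ^ 2) :=
      ((hθC'.mul contDiff_const).cexp).pow 2
    simp only [hpdef, polar, div_eq_mul_inv]
    exact ((contDiff_const.mul (contDiff_const.sub hrC')).sub ((hrC'.mul this).mul
      contDiff_const)).mul (((contDiff_const.sub hrC').sub (hrC'.mul this)).inv fun t => hden (r t))
  have hpne : ∀ t ∈ Set.Icc (0 : ℝ) 1, p t ≠ 1 ∧ p t ≠ -1 := by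
    intro t ht
    by_cases hrt : r t = 1
    · simp only [hpdef, hrt, polar_one]
      exact ⟨one_ne_ζ'.symm, neg_one_ne_ζ'.symm⟩
    · refine ne_of_mob_ne (T := T) fun j h => ?_
      simp only [hpdef] at h
      rw [mob_polar (hne _) hrt] at h
      have h1 := congrArg norm h
      rw [norm_mul, norm_pow, norm_pow, norm_n, Complex.norm_exp_ofReal_mul_I, Complex.norm_real,
        one_pow, mul_one, Real.norm_eq_abs, abs_of_nonneg
        (div_nonneg (hr0 t ht).1 (sub_nonneg.mpr (hr0 t ht).2)),
        div_eq_one_iff_eq (sub_ne_zero.mpr (Ne.symm hrt))] at h1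
      have h2 : r t = 1 / 2 := by linarith
      refine hreg' (r t) j h2 ?_
      rw [← h, h2]
      norm_num
  have hpne' : ∀ t ∈ Set.Ioo (0 : ℝ) 1, p t ≠ T.ζ ∧ p t ≠ T.ζ' := fun t ht =>
    ⟨polar_ne_ζ (hne _) (hr1 t ht).1.ne', polar_ne_ζ' (hne _) (hr1 t ht).2.ne⟩
  have hsc : Continuous s := by
    have h1 := hrC.continuous
    have h2 := hθC'.continuous
    have h3 := hrC'.continuous
    exact Continuous.div (by fun_prop) (by fun_prop) fun t => hden (r t)
  have hsq : ∀ t ∈ Set.Icc (0 : ℝ) 1, s t ^ 2 = (p t - T.ζ) * (p t - T.ζ') := by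
    intro t ht
    simp only [hsdef, hpdef]
    rw [polar_sub_ζ (hne _), polar_sub_ζ' (hne _)]
    have := hden (r t)
    have h1 : ((Real.sqrt (r t * (1 - r t)) : ℝ) : ℂ) ^ 2 = r t * (1 - r t) := by
      rw [← Complex.ofReal_pow, Real.sq_sqrt (mul_nonneg (hr0 t ht).1 (sub_nonneg.mpr (hr0 t ht).2))]
      push_cast; ring
    field_simp
    rw [h1]
    ring
  have hre := re_integral_eq hpC hp0 (by rw [hp1]; exact polar_ne_ζ' hne1 hτ₀.2.ne) hpne hpne'
    hsc.continuousOn hsq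
  have hw : s 1 / (p 1 - T.ζ')
      = Real.sqrt (τ₀ * (1 - τ₀)) * Complex.exp (φ * Complex.I) / (1 - τ₀) := by
    have h1 := T.ζ_sub_ζ'_ne
    have h2 : (1 - τ₀ : ℂ) ≠ 0 := by exact_mod_cast hτ.ne'
    rw [hp1, polar_sub_ζ' hne1]
    simp only [hsdef]
    rw [hθone, hrone]
    rw [mul_comm (τ₀ : ℂ)] at hden1 ⊢
    field_simp
  rw [hw, hH, neg_zero, mul_eq_zero] at hre
  refine ⟨p, s, hpC, hp0.trans hm.symm, hp1, hpne, ?_, hsc.continuousOn, ?_,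
    hre.resolve_left T.c₃_pos.ne'⟩
  · rwa [hp, hm]
  · rwa [hp, hm]

/-- A constant path is not admitted, because interior times must avoid the branch points. A vertical
excursion below ζ' and back along the same segment is admissible, and its integral is 0. -/
lemma ζ'_mem_Gam : T.ζ' ∈ Gam A B := by
  have hy := T.ζ_im_pos
  set p : ℝ → ℂ := fun t => T.ζ' - (t * (1 - t) : ℝ) * Complex.I with hpdef
  set s : ℝ → ℂ := fun t => Complex.I * Real.sqrt ((2 * T.ζ.im + t * (1 - t)) * (t * (1 - t))) with hs
  have him : ∀ t, (p t).im = - T.ζ.im - t * (1 - t) := fun t => by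
    simp only [hpdef, Complex.sub_im, ζ'_im, Complex.im_ofReal_mul,
      Complex.I_im, mul_one]
  have hd : ∀ t, deriv p t = - (1 - 2 * t : ℝ) * Complex.I := fun t => by
    have h1 : HasDerivAt (fun t : ℝ => t * (1 - t)) (1 * (1 - t) + t * (-1)) t :=
      (hasDerivAt_id t).mul ((hasDerivAt_id t).const_sub 1)
    have := ((h1.ofReal_comp.mul_const Complex.I).const_sub T.ζ').deriv
    simp only [hpdef]
    rw [this]
    push_cast; ring
  refine ⟨p, s, ?_, by simp [hpdef, hm], by simp [hpdef], fun t ht => ?_, fun t ht => ?_, ?_,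
    fun t ht => ?_, ?_⟩
  · have : ContDiff ℝ 1 (fun t : ℝ => ((t * (1 - t) : ℝ) : ℂ)) :=
      Complex.ofRealCLM.contDiff.comp
        (contDiff_id.mul (contDiff_const.sub contDiff_id))
    fun_prop
  · have h := him t
    have : 0 ≤ t * (1 - t) := mul_nonneg ht.1 (sub_nonneg.mpr ht.2)
    constructor <;> intro e <;> rw [e] at h <;> simp at h <;> linarith
  · have h := him t
    have : 0 < t * (1 - t) := mul_pos ht.1 (sub_pos.mpr ht.2)
    rw [hp, hm]
    constructor <;> intro e <;> rw [e] at h <;> try rw [ζ'_im] at h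
    all_goals linarith
  · simp only [hs]; fun_prop
  · have h0 : 0 ≤ t * (1 - t) := mul_nonneg ht.1 (sub_nonneg.mpr ht.2)
    rw [hp, hm]
    have h1 : ((Real.sqrt ((2 * T.ζ.im + t * (1 - t)) * (t * (1 - t))) : ℝ) : ℂ) ^ 2
        = (2 * T.ζ.im + t * (1 - t)) * (t * (1 - t)) := by
      rw [← Complex.ofReal_pow, Real.sq_sqrt (by positivity)]
      push_cast; ring
    simp only [hs, hpdef]
    rw [mul_pow, h1]
    have h2 := T.ζ_sub_ζ'
    push_cast
    linear_combination (-(Complex.I * (t * (1 - t)))) * h2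
  -- With the same root on the way out and on the way back, reversing time changes only the sign of
  -- the velocity, so the integral equals its own negative.
  · have hodd : ∀ t, s (1 - t) / (p (1 - t) ^ 2 - 1) * deriv p (1 - t)
        = - (s t / (p t ^ 2 - 1) * deriv p t) := fun t => by
      rw [hd, hd]
      simp only [hs, hpdef]
      rw [show (1 - t) * (1 - (1 - t)) = t * (1 - t) by ring]
      push_cast
      ring
    have h1 := intervalIntegral.integral_comp_sub_left (a := 0) (b := 1)
      (fun t => s t / (p t ^ 2 - 1) * deriv p t) 1
    simp only [hodd, intervalIntegral.integral_neg, sub_self, sub_zero] at h1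
    have h2 : (∫ t in (0 : ℝ)..1, s t / (p t ^ 2 - 1) * deriv p t) = 0 := by
      linear_combination (-1 / 2 : ℂ) * h1
    rw [h2, Complex.zero_re]

lemma Gam_eq : Gam A B = {T.ζ, T.ζ'} ∪ ⋃ k, Set.range (T.pt k) := by
  apply Set.Subset.antisymm
  · rintro z ⟨p, s, h1, h2, h3, h4, h5, h6, h7, h8⟩
    by_cases hz : z = T.ζ
    · exact Or.inl (Or.inl hz)
    by_cases hz' : z = T.ζ'
    · exact Or.inl (Or.inr hz')
    right
    rw [hp, hm] at h7 
    rw [hm] at h2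
    simp only [hp, hm] at h5
    have hone := Set.right_mem_Icc.mpr (zero_le_one (α := ℝ))
    have := re_integral_eq h1 h2 (h3 ▸ hz') h4 h5 h6 h7
    rw [h8, mul_zero, h3] at this
    have h4' := h4 1 hone
    rw [h3] at h4'
    obtain ⟨k, x, hk⟩ := exists_eq_pt (w := s 1 / (z - T.ζ')) hz hz' h4'.1 h4'.2 (by
      have := sub_ne_zero.mpr hz'
      rw [div_pow, h7 1 hone, h3, mob]
      field_simp) (by linarith)
    exact Set.mem_iUnion.mpr ⟨k, x, hk.symm⟩
  · rintro z ((rfl | rfl) | hz)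
    -- The point ζ is reached along constant angle `ang 0 0`; there w = 0, where the potential
    -- vanishes.
    · rw [← polar_zero (T := T) (T.ang 0 0)]
      refine polar_mem_Gam hp hm ⟨le_rfl, zero_lt_one⟩ _ 0 ?_ ?_
      · simpa using reg_ang (T := T) 0 0
      · simpa using H_zero
    · exact ζ'_mem_Gam hp hm
    · obtain ⟨k, x, rfl⟩ := Set.mem_iUnion.mp hz
      obtain ⟨t, ht, rfl⟩ := exists_logit_eq x
      rw [← polar_eq_pt ht]
      -- The slope makes the spiral cross the real line where the k-th curve does. For t = 1/2 the
      -- division by zero gives slope 0, which is right because the end point itself has the angle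
      -- `ang k 0`.
      refine polar_mem_Gam hp hm ⟨ht.1.le, ht.2⟩ _
        ((T.ang k 0 - T.ang k (logit t)) / (1 / 2 - t)) ?_ ?_
      · by_cases h : t = 1 / 2
        · have : logit t = 0 := by rw [logit, h]; norm_num
          simpa [this] using reg_ang (T := T) k 0
        · rw [div_mul_cancel₀ _ (sub_ne_zero.mpr (Ne.symm h))]
          simpa using reg_ang (T := T) k 0
      · rw [← H_lift (T := T) k (logit t), lift, exp_polar]
        congr 1
        have h1 : 0 < 1 - t := sub_pos.mpr ht.2
        have h2 : Real.exp (logit t) = Real.sqrt (t * (1 - t)) / (1 - t) := by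
          rw [logit, ← Real.log_sqrt (div_pos ht.1 h1).le,
            Real.exp_log (Real.sqrt_pos.mpr (div_pos ht.1 h1)), Real.sqrt_eq_iff_mul_self_eq
            (div_pos ht.1 h1).le (by positivity), div_mul_div_comm,
            Real.mul_self_sqrt (mul_pos ht.1 h1).le]
          field_simp
        rw [← Complex.ofReal_exp, h2]
        push_cast
        ring

end Gam

end Triangle

end JacobiZeros

end

/-! ### The three curves as analytic arcs parametrized by [0, 1] -/

noncomputable section

namespace JacobiZeros

namespace Triangle

variable {T : Triangle}

lemma analyticAt_logit {t : ℝ} (ht : t ∈ Set.Ioo (0 : ℝ) 1) : AnalyticAt ℝ logit t := by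
  have h1 : 0 < 1 - t := sub_pos.mpr ht.2
  have : AnalyticAt ℝ (fun t : ℝ => t / (1 - t)) t :=
    analyticAt_id.div (analyticAt_const.sub analyticAt_id) h1.ne'
  exact (this.log (div_pos ht.1 h1)).div_const

lemma analyticAt_lift (k : Fin 3) (x : ℝ) : AnalyticAt ℝ (T.lift k) x := by
  have h1 : AnalyticAt ℝ (fun x : ℝ => (x : ℂ) + T.ang k x * Complex.I) x :=
    (Complex.ofRealCLM.analyticAt x).add
      (((Complex.ofRealCLM.analyticAt _).comp (analyticAt_ang k x)).mul analyticAt_const)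
  exact (analyticAt_cexp.restrictScalars (𝕜 := ℝ)).comp h1

lemma analyticAt_mobInv {v : ℂ} (hv : v ≠ 1) : AnalyticAt ℂ T.mobInv v :=
  (analyticAt_const.sub (analyticAt_id.mul analyticAt_const)).div
    (analyticAt_const.sub analyticAt_id) (sub_ne_zero.mpr hv.symm)

lemma analyticAt_pt (k : Fin 3) (x : ℝ) : AnalyticAt ℝ (T.pt k) x :=
  AnalyticAt.comp (g := T.mobInv) (f := fun x => T.lift k x ^ 2)
    ((analyticAt_mobInv (lift_sq_ne_one k x)).restrictScalars (𝕜 := ℝ))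
    ((analyticAt_lift k x).fun_pow 2)

variable (T) in
/-- The logarithm of the radial coordinate. -/
def rad (z : ℂ) : ℝ := Real.log ‖T.mob z‖ / 2

lemma rad_pt (k : Fin 3) (x : ℝ) : T.rad (T.pt k x) = x := by
  rw [rad, mob_pt, norm_pow, norm_lift, Real.log_pow, Real.log_exp]
  push_cast; ring

lemma continuousAt_mob {z : ℂ} (hz : z ≠ T.ζ') : ContinuousAt T.mob z :=
  (hasDerivAt_mob hz).continuousAt

lemma hasDerivAt_rad {γ : ℝ → ℂ} {γ' : ℂ} {t : ℝ} (h : HasDerivAt γ γ' t)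
    (hz : γ t ≠ T.ζ) (hz' : γ t ≠ T.ζ') : ∃ d, HasDerivAt (fun t => T.rad (γ t)) d t :=
  ⟨_, (hasDerivAt_log_norm ((hasDerivAt_mob hz').comp t h) (mob_ne_zero hz' hz)).div_const 2⟩

/-! ### The arcs -/

variable (T) in
/-- The parametrization of the `k`-th arc by `[0, 1]`. -/
def arcFun (k : Fin 3) (t : ℝ) : ℂ := T.polar t (T.ang k (logit t))

lemma arcFun_eq {k : Fin 3} {t : ℝ} (ht : t ∈ Set.Ioo (0 : ℝ) 1) :
    T.arcFun k t = T.pt k (logit t) := polar_eq_pt ht k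

lemma arcFun_zero (k : Fin 3) : T.arcFun k 0 = T.ζ := polar_zero _

lemma arcFun_one (k : Fin 3) : T.arcFun k 1 = T.ζ' := polar_one _

lemma eventually_arcFun_eq {k : Fin 3} {t : ℝ} (ht : t ∈ Set.Ioo (0 : ℝ) 1) :
    T.arcFun k =ᶠ[𝓝 t] fun t => T.pt k (logit t) := by
  filter_upwards [Ioo_mem_nhds ht.1 ht.2] with u hu using arcFun_eq hu

lemma analyticAt_arcFun {k : Fin 3} {t : ℝ} (ht : t ∈ Set.Ioo (0 : ℝ) 1) :
    AnalyticAt ℝ (T.arcFun k) t :=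
  ((analyticAt_pt k _).comp (analyticAt_logit ht)).congr (eventually_arcFun_eq ht).symm

lemma arcFun_den_ne (k : Fin 3) (t : ℝ) :
    t = 1 / 2 → Complex.exp (T.ang k (logit t) * Complex.I) ^ 2 ≠ 1 := by
  rintro rfl
  have := lift_sq_ne_one (T := T) k (logit (1 / 2))
  rw [lift, exp_logit ⟨by norm_num, by norm_num⟩] at this
  norm_num at this
  norm_num
  exact this

lemma norm_den_ge (t θ : ℝ) :
    |1 - t| - |t| ≤ ‖(1 - t : ℂ) - t * Complex.exp (θ * Complex.I) ^ 2‖ ∧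
    |t| - |1 - t| ≤ ‖(1 - t : ℂ) - t * Complex.exp (θ * Complex.I) ^ 2‖ := by
  have h1 : ‖(1 - t : ℂ)‖ = |1 - t| := by
    rw [show (1 - t : ℂ) = ((1 - t : ℝ) : ℂ) by push_cast; ring, Complex.norm_real,
      Real.norm_eq_abs]
  have h2 : ‖(t : ℂ) * Complex.exp (θ * Complex.I) ^ 2‖ = |t| := by
    rw [norm_mul, norm_pow, Complex.norm_exp_ofReal_mul_I, one_pow, mul_one, Complex.norm_real,
      Real.norm_eq_abs]
  rw [← h1, ← h2]
  exact ⟨norm_sub_norm_le _ _, by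
    rw [norm_sub_rev (1 - t : ℂ)]; exact norm_sub_norm_le _ _⟩

/-- The angle need not converge at the end point: the distance to ζ is bounded by an expression in t
alone that tends to 0. This also covers the parameters outside [0, 1]. -/
lemma continuousAt_arcFun_zero (k : Fin 3) : ContinuousAt (T.arcFun k) 0 := by
  rw [ContinuousAt, arcFun_zero, tendsto_iff_norm_sub_tendsto_zero]
  have hlim : Tendsto (fun t : ℝ => |t| * ‖T.ζ - T.ζ'‖ / (|1 - t| - |t|)) (𝓝 0) (𝓝 0) := by
    have : ContinuousAt (fun t : ℝ => |t| * ‖T.ζ - T.ζ'‖ / (|1 - t| - |t|)) 0 :=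
      ContinuousAt.div (by fun_prop) (by fun_prop) (by simp)
    simpa using this.tendsto
  have hpos : ∀ᶠ t : ℝ in 𝓝 0, 0 < |1 - t| - |t| := by
    have : ContinuousAt (fun t : ℝ => |1 - t| - |t|) 0 := by fun_prop
    exact this.tendsto.eventually_const_lt (by simp)
  refine squeeze_zero' (Eventually.of_forall fun _ => norm_nonneg _) ?_ hlim
  filter_upwards [hpos] with t ht
  rw [arcFun, polar_sub_ζ (arcFun_den_ne k t), norm_div, norm_mul, norm_mul, norm_pow,
    Complex.norm_exp_ofReal_mul_I, one_pow, mul_one, Complex.norm_real, Real.norm_eq_abs]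
  exact div_le_div_of_nonneg_left (by positivity) ht (norm_den_ge _ _).1

lemma continuousAt_arcFun_one (k : Fin 3) : ContinuousAt (T.arcFun k) 1 := by
  rw [ContinuousAt, arcFun_one, tendsto_iff_norm_sub_tendsto_zero]
  have hlim : Tendsto (fun t : ℝ => |1 - t| * ‖T.ζ - T.ζ'‖ / (|t| - |1 - t|)) (𝓝 1) (𝓝 0) := by
    have : ContinuousAt (fun t : ℝ => |1 - t| * ‖T.ζ - T.ζ'‖ / (|t| - |1 - t|)) 1 :=
      ContinuousAt.div (by fun_prop) (by fun_prop) (by simp)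
    simpa using this.tendsto
  have hpos : ∀ᶠ t : ℝ in 𝓝 1, 0 < |t| - |1 - t| := by
    have : ContinuousAt (fun t : ℝ => |t| - |1 - t|) 1 := by fun_prop
    exact this.tendsto.eventually_const_lt (by simp)
  refine squeeze_zero' (Eventually.of_forall fun _ => norm_nonneg _) ?_ hlim
  filter_upwards [hpos] with t ht
  rw [arcFun, polar_sub_ζ' (arcFun_den_ne k t), norm_div, norm_mul,
    show (1 - t : ℂ) = ((1 - t : ℝ) : ℂ) by push_cast; ring, Complex.norm_real, Real.norm_eq_abs]
  refine div_le_div_of_nonneg_left (by positivity) ht ?_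
  have := (norm_den_ge t (T.ang k (logit t))).2
  rwa [show (1 - t : ℂ) = ((1 - t : ℝ) : ℂ) by push_cast; ring] at this

lemma continuousOn_arcFun (k : Fin 3) : ContinuousOn (T.arcFun k) unitInterval := by
  intro t ht
  rcases ht.1.eq_or_lt with rfl | h0
  · exact (continuousAt_arcFun_zero k).continuousWithinAt
  rcases ht.2.eq_or_lt with rfl | h1
  · exact (continuousAt_arcFun_one k).continuousWithinAt
  exact (analyticAt_arcFun ⟨h0, h1⟩).continuousAt.continuousWithinAt

variable (T) in
/-- The `k`-th arc, oriented from `ζ` to `ζ'`. -/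
def arc (k : Fin 3) : Path T.ζ T.ζ' :=
  Path.ofLine (continuousOn_arcFun k) (arcFun_zero k) (arcFun_one k)

lemma arc_apply (k : Fin 3) (t : unitInterval) : T.arc k t = T.arcFun k t := rfl

lemma arc_extend (k : Fin 3) {t : ℝ} (ht : t ∈ Set.Icc (0 : ℝ) 1) :
    (T.arc k).extend t = T.arcFun k t := by
  rw [Path.extend_apply _ ht]; rfl

lemma logit_injOn : Set.InjOn logit (Set.Ioo 0 1) := by
  intro t ht u hu h
  have h1 : 0 < 1 - t := sub_pos.mpr ht.2
  have h2 : 0 < 1 - u := sub_pos.mpr hu.2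
  have h3 : t / (1 - t) = u / (1 - u) := by
    refine Real.log_injOn_pos (div_pos ht.1 h1) (div_pos hu.1 h2) ?_
    unfold logit at h
    linarith
  rw [div_eq_div_iff h1.ne' h2.ne'] at h3
  linarith

lemma arcFun_mem {k : Fin 3} {t : ℝ} (ht : t ∈ Set.Icc (0 : ℝ) 1) :
    (t = 0 ∧ T.arcFun k t = T.ζ) ∨ (t = 1 ∧ T.arcFun k t = T.ζ') ∨
      (t ∈ Set.Ioo (0 : ℝ) 1 ∧ T.arcFun k t = T.pt k (logit t)) := by
  rcases ht.1.eq_or_lt with rfl | h0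
  · exact Or.inl ⟨rfl, arcFun_zero k⟩
  rcases ht.2.eq_or_lt with rfl | h1
  · exact Or.inr (Or.inl ⟨rfl, arcFun_one k⟩)
  exact Or.inr (Or.inr ⟨⟨h0, h1⟩, arcFun_eq ⟨h0, h1⟩⟩)

lemma range_arc (k : Fin 3) : Set.range (T.arc k) = {T.ζ, T.ζ'} ∪ Set.range (T.pt k) := by
  ext z
  constructor
  · rintro ⟨t, rfl⟩
    rw [arc_apply]
    rcases arcFun_mem (T := T) (k := k) t.2 with ⟨-, h⟩ | ⟨-, h⟩ | ⟨-, h⟩ <;> rw [h] <;> simp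
  · rintro ((rfl | rfl) | ⟨x, rfl⟩)
    · exact (T.arc k).source_mem_range
    · exact (T.arc k).target_mem_range
    · obtain ⟨t, ht, rfl⟩ := exists_logit_eq x
      exact ⟨⟨t, ht.1.le, ht.2.le⟩, arcFun_eq ht⟩

lemma injective_arc (k : Fin 3) : Function.Injective (T.arc k) := by
  rintro ⟨t, ht⟩ ⟨u, hu⟩ h
  rw [arc_apply, arc_apply] at h
  simp only at h
  have hne := T.ζ_ne_ζ'
  rcases arcFun_mem (T := T) (k := k) ht with ⟨e1, h1⟩ | ⟨e1, h1⟩ | ⟨e1, h1⟩ <;>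
  rcases arcFun_mem (T := T) (k := k) hu with ⟨e2, h2⟩ | ⟨e2, h2⟩ | ⟨e2, h2⟩ <;>
  rw [h1, h2] at h
  · simp [e1, e2]
  · exact absurd h hne
  · exact absurd h.symm (pt_ne_ζ k _)
  · exact absurd h.symm hne
  · simp [e1, e2]
  · exact absurd h.symm (pt_ne_ζ' k _)
  · exact absurd h (pt_ne_ζ k _)
  · exact absurd h (pt_ne_ζ' k _)
  · exact Subtype.ext (logit_injOn e1 e2 (pt_inj h).2)

/-- The function `rad` composed with the arc is `logit`, whose derivative does not vanish on (0, 1).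
-/
lemma deriv_arcFun_ne_zero {k : Fin 3} {t : ℝ} (ht : t ∈ Set.Ioo (0 : ℝ) 1) :
    deriv (T.arcFun k) t ≠ 0 := by
  intro h0
  have hd := (analyticAt_arcFun (T := T) (k := k) ht).differentiableAt.hasDerivAt
  rw [h0] at hd
  have hz : T.arcFun k t ≠ T.ζ := by rw [arcFun_eq ht]; exact pt_ne_ζ k _
  have hz' : T.arcFun k t ≠ T.ζ' := by rw [arcFun_eq ht]; exact pt_ne_ζ' k _
  have h1 : HasDerivAt (fun t => T.rad (T.arcFun k t)) 0 t := by
    have := (hasDerivAt_log_norm ((hasDerivAt_mob hz').comp t hd) (mob_ne_zero hz' hz)).div_const 2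
    simpa [rad] using this
  have h2 : HasDerivAt logit 0 t := by
    refine h1.congr_of_eventuallyEq ?_
    filter_upwards [eventually_arcFun_eq ht] with u hu
    rw [hu, rad_pt]
  have h3 : 0 < 1 - t := sub_pos.mpr ht.2
  have h4 := ((((hasDerivAt_id t).div ((hasDerivAt_id t).const_sub 1) h3.ne').log
    (div_pos ht.1 h3).ne').div_const 2)
  have h5 := h2.unique h4
  have := ht.1
  simp only [id, Pi.div_apply] at h5
  field_simp at h5
  norm_num at h5

lemma isAnalyticArc_arc (k : Fin 3) : IsAnalyticArc (T.arc k) := by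
  have heq : ∀ t ∈ Set.Ioo (0 : ℝ) 1, (T.arc k).extend =ᶠ[𝓝 t] T.arcFun k := by
    intro t ht
    filter_upwards [Icc_mem_nhds ht.1 ht.2] with u hu using arc_extend k hu
  refine ⟨injective_arc k, fun t ht => ?_, fun t ht => ?_⟩
  · exact (analyticAt_arcFun ht).congr (heq t ht).symm
  · rw [(heq t ht).deriv_eq]
    exact deriv_arcFun_ne_zero ht

end Triangle

lemma IsAnalyticArc.symm {a b : ℂ} {γ : Path a b} (h : IsAnalyticArc γ) :
    IsAnalyticArc γ.symm := by
  have hmem : ∀ t ∈ Set.Ioo (0 : ℝ) 1, 1 - t ∈ Set.Ioo (0 : ℝ) 1 := fun t ht =>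
    ⟨sub_pos.mpr ht.2, by linarith [ht.1]⟩
  refine ⟨?_, fun t ht => ?_, fun t ht => ?_⟩
  · exact h.injective.comp unitInterval.symm_bijective.injective
  · rw [Path.extend_symm]
    exact (h.analytic _ (hmem t ht)).comp (analyticAt_const.sub analyticAt_id)
  · rw [Path.extend_symm, deriv_comp_const_sub]
    exact neg_ne_zero.mpr (h.regular _ (hmem t ht))

lemma IsAnalyticArc.cast {a b a' b' : ℂ} {γ : Path a b} (h : IsAnalyticArc γ) (ha : a' = a)
    (hb : b' = b) : IsAnalyticArc (γ.cast ha hb) := by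
  subst ha hb; exact h

namespace Triangle

variable {T : Triangle}

/-! ### The intersections with the real line -/

/-- The real line is the perpendicular bisector of the conjugate points ζ and ζ'. -/
lemma norm_mob_eq_one_iff {z : ℂ} (hz : z ≠ T.ζ') : ‖T.mob z‖ = 1 ↔ z.im = 0 := by
  have h0 : 0 < ‖z - T.ζ'‖ := norm_pos_iff.mpr (sub_ne_zero.mpr hz)
  have hy := T.ζ_im_pos
  rw [mob, norm_div, div_eq_one_iff_eq h0.ne', ← sq_eq_sq₀ (norm_nonneg _) (norm_nonneg _),
    ← Complex.normSq_eq_norm_sq, ← Complex.normSq_eq_norm_sq, Complex.normSq_apply,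
    Complex.normSq_apply]
  simp only [Complex.sub_re, Complex.sub_im, ζ'_im]
  have : T.ζ'.re = T.ζ.re := by simp [ζ']
  rw [this]
  constructor
  · intro h
    have : 4 * T.ζ.im * z.im = 0 := by linarith
    rcases mul_eq_zero.mp this with h | h
    · linarith
    · exact h
  · intro h; rw [h]; ring

lemma pt_im_eq_zero_iff (k : Fin 3) (x : ℝ) : (T.pt k x).im = 0 ↔ x = 0 := by
  rw [← norm_mob_eq_one_iff (pt_ne_ζ' k x), mob_pt, norm_pow, norm_lift, ← Real.exp_nat_mul,
    Real.exp_eq_one_iff]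
  simp

/-- The chord formula exp (2ia) - exp (2ib) = 2i exp (i (a + b)) sin (a - b). It turns the position
of the real crossing relative to ±1 into signs of sines, which `sg` records. -/
lemma lift_zero_sub (k j : Fin 3) : T.lift k 0 ^ 2 - T.n j ^ 2
    = 2 * Complex.I * T.lift k 0 * T.n j * Real.sin (T.ang k 0 - T.α j) := by
  rw [lift, n, Complex.ofReal_sin, Complex.sin]
  push_cast
  rw [show -(T.ang k 0 - T.α j : ℂ) * Complex.I = -((T.ang k 0 - T.α j) * Complex.I) by ring,
    Complex.exp_neg, sub_mul (T.ang k 0 : ℂ), Complex.exp_sub, zero_add]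
  have h1 := Complex.exp_ne_zero (T.ang k 0 * Complex.I)
  have h2 := Complex.exp_ne_zero (T.α j * Complex.I)
  field_simp
  rw [Complex.I_sq]
  ring

lemma pt_zero_sub_one (k : Fin 3) : T.pt k 0 - 1
    = (2 * T.c₁ / T.c₃ * Real.sin (T.ang k 0 - T.α 0) / Real.sin (T.ang k 0 - T.α 2) : ℝ) := by
  have h1 : 1 - T.lift k 0 ^ 2 ≠ 0 := sub_ne_zero.mpr (lift_sq_ne_one k 0).symm
  have h2 := lift_zero_sub (T := T) k 2
  rw [n_two] at h2
  have h3 := lift_zero_sub (T := T) k 0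
  have e1 := T.one_sub_ζ
  have e2 := T.one_sub_ζ'
  have hc := T.c₃_ne
  have hn := n_ne_zero (T := T) 0
  have hs : (Real.sin (T.ang k 0 - T.α 2) : ℂ) ≠ 0 := by
    intro h; rw [h] at h2; apply h1; linear_combination -h2
  have hl := lift_ne_zero (T := T) k 0
  have e3 : T.pt k 0 - 1 = (T.lift k 0 ^ 2 * (1 - T.ζ') - (1 - T.ζ)) / (1 - T.lift k 0 ^ 2) := by
    rw [pt, mobInv]; field_simp; ring
  have e4 : T.lift k 0 ^ 2 * (1 - T.ζ') - (1 - T.ζ)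
      = 2 * T.c₁ / T.c₃ * (T.n 0)⁻¹ * (T.lift k 0 ^ 2 - T.n 0 ^ 2) := by
    rw [e1, e2]; field_simp
  have e5 : 1 - T.lift k 0 ^ 2 = 2 * Complex.I * T.lift k 0 * Real.sin (T.ang k 0 - T.α 2) := by
    linear_combination -h2
  rw [e3, e4, e5, h3]
  push_cast at hs ⊢
  field_simp

lemma pt_zero_add_one (k : Fin 3) : T.pt k 0 + 1
    = (-(2 * T.c₂ / T.c₃ * Real.sin (T.ang k 0 - T.α 1) / Real.sin (T.ang k 0 - T.α 2)) : ℝ) := by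
  have h1 : 1 - T.lift k 0 ^ 2 ≠ 0 := sub_ne_zero.mpr (lift_sq_ne_one k 0).symm
  have h2 := lift_zero_sub (T := T) k 2
  rw [n_two] at h2
  have h3 := lift_zero_sub (T := T) k 1
  have e1 := T.one_add_ζ
  have e2 := T.one_add_ζ'
  have hc := T.c₃_ne
  have hn := n_ne_zero (T := T) 1
  have hs : (Real.sin (T.ang k 0 - T.α 2) : ℂ) ≠ 0 := by
    intro h; rw [h] at h2; apply h1; linear_combination -h2
  have hl := lift_ne_zero (T := T) k 0
  have e3 : T.pt k 0 + 1 = -(T.lift k 0 ^ 2 * (1 + T.ζ') - (1 + T.ζ)) / (1 - T.lift k 0 ^ 2) := by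
    rw [pt, mobInv]; field_simp; ring
  have e4 : T.lift k 0 ^ 2 * (1 + T.ζ') - (1 + T.ζ)
      = 2 * T.c₂ / T.c₃ * (T.n 1)⁻¹ * (T.lift k 0 ^ 2 - T.n 1 ^ 2) := by
    rw [e1, e2]; field_simp
  have e5 : 1 - T.lift k 0 ^ 2 = 2 * Complex.I * T.lift k 0 * Real.sin (T.ang k 0 - T.α 2) := by
    linear_combination -h2
  rw [e3, e4, e5, h3]
  push_cast at hs ⊢
  field_simp

/-- The position of the points of the curves on the real line. -/
lemma pt_zero_location (k : Fin 3) : ∃ r : ℝ, T.pt k 0 = r ∧ 0 < sg k 0 * (r - 1) ∧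
    sg k 1 * (r + 1) < 0 := by
  have h0 := sg_mul_sin_pos (ang_zero_mem (T := T) k) 0
  have h1 := sg_mul_sin_pos (ang_zero_mem (T := T) k) 1
  have h2 := sg_mul_sin_pos (ang_zero_mem (T := T) k) 2
  have e2 : sg k 2 = 1 := by fin_cases k <;> simp [sg]
  rw [e2, one_mul] at h2
  have a0 := pt_zero_sub_one (T := T) k
  have a1 := pt_zero_add_one (T := T) k
  have c1 := T.c₁_pos
  have c2 := T.c₂_pos
  have c3 := T.c₃_pos
  refine ⟨1 + 2 * T.c₁ / T.c₃ * Real.sin (T.ang k 0 - T.α 0) / Real.sin (T.ang k 0 - T.α 2), ?_,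
    ?_, ?_⟩
  · rw [Complex.ofReal_add, ← a0]; push_cast; ring
  · rw [add_sub_cancel_left]
    have : sg k 0 * (2 * T.c₁ / T.c₃ * Real.sin (T.ang k 0 - T.α 0) / Real.sin (T.ang k 0 - T.α 2))
      = 2 * T.c₁ / T.c₃ * (sg k 0 * Real.sin (T.ang k 0 - T.α 0)) / Real.sin (T.ang k 0 - T.α 2) := by
      ring
    rw [this]
    positivity
  · have e : 1 + 2 * T.c₁ / T.c₃ * Real.sin (T.ang k 0 - T.α 0) / Real.sin (T.ang k 0 - T.α 2) + 1
        = -(2 * T.c₂ / T.c₃ * Real.sin (T.ang k 0 - T.α 1) / Real.sin (T.ang k 0 - T.α 2)) := by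
      have h : ((1 + 2 * T.c₁ / T.c₃ * Real.sin (T.ang k 0 - T.α 0) / Real.sin (T.ang k 0 - T.α 2)
        + 1 : ℝ) : ℂ)
        = (-(2 * T.c₂ / T.c₃ * Real.sin (T.ang k 0 - T.α 1) / Real.sin (T.ang k 0 - T.α 2)) : ℝ) := by
        rw [← a1, Complex.ofReal_add, Complex.ofReal_add, ← a0]; push_cast; ring
      exact_mod_cast h
    rw [e]
    have : sg k 1 * -(2 * T.c₂ / T.c₃ * Real.sin (T.ang k 0 - T.α 1) / Real.sin (T.ang k 0 - T.α 2))
      = -(2 * T.c₂ / T.c₃ * (sg k 1 * Real.sin (T.ang k 0 - T.α 1)) / Real.sin (T.ang k 0 - T.α 2)) := by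
      ring
    rw [this, neg_lt_zero]
    positivity

lemma range_arc_inter_real (k : Fin 3) :
    Set.range (T.arc k) ∩ {z : ℂ | z.im = 0} = {T.pt k 0} := by
  have hy := T.ζ_im_pos
  rw [range_arc]
  ext z
  constructor
  · rintro ⟨(rfl | rfl) | ⟨x, rfl⟩, h⟩
    · exact absurd h hy.ne'
    · have h' : T.ζ'.im = 0 := h
      rw [ζ'_im] at h'; linarith
    · rw [(pt_im_eq_zero_iff k x).mp h]; rfl
  · rintro rfl
    exact ⟨Or.inr ⟨0, rfl⟩, (pt_im_eq_zero_iff k 0).mpr rfl⟩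

lemma range_arc_inter {k l : Fin 3} (h : k ≠ l) :
    Set.range (T.arc k) ∩ Set.range (T.arc l) = {T.ζ, T.ζ'} := by
  rw [range_arc, range_arc, ← Set.union_inter_distrib_left, Set.union_eq_left]
  rintro z ⟨⟨x, rfl⟩, ⟨y, hy⟩⟩
  exact absurd (pt_inj hy).1 h.symm

/-- The arcs make up `Γ`. -/
lemma isArcDecomposition {A B : ℝ} (hp : zetaPlus A B = T.ζ) (hm : zetaMinus A B = T.ζ') :
    IsArcDecomposition A B ((T.arc 0).cast hp hm) ((T.arc 1).cast hp hm)
      ((T.arc 2).symm.cast hm hp) := by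
  have r0 := pt_zero_location (T := T) 0
  have r1 := pt_zero_location (T := T) 1
  have r2 := pt_zero_location (T := T) 2
  simp [sg] at r0 r1 r2
  refine ⟨(isAnalyticArc_arc 0).cast _ _, (isAnalyticArc_arc 1).cast _ _,
    (isAnalyticArc_arc 2).symm.cast _ _, ?_, ?_, ?_, ?_, ?_, ?_, ?_⟩
  all_goals simp only [Path.cast_coe, Path.symm_range, hp, hm]
  · rw [Gam_eq hp hm, range_arc, range_arc, range_arc]
    ext z
    simp only [Set.mem_union, Set.mem_iUnion, Fin.exists_fin_succ, Fin.succ_zero_eq_one,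
      Fin.succ_one_eq_two, IsEmpty.exists_iff, or_false]
    tauto
  · exact range_arc_inter (by decide)
  · exact range_arc_inter (by decide)
  · exact range_arc_inter (by decide)
  · obtain ⟨r, hr, h1, h2⟩ := r0
    exact ⟨r, by linarith, by rw [range_arc_inter_real, hr]⟩
  · obtain ⟨r, hr, h1, h2⟩ := r1
    exact ⟨r, by linarith, by linarith, by rw [range_arc_inter_real, hr]⟩
  · obtain ⟨r, hr, h1, h2⟩ := r2
    exact ⟨r, by linarith, by rw [range_arc_inter_real, hr]⟩

end Triangle

end JacobiZeros

end

noncomputable section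

namespace JacobiZeros

namespace Triangle

variable {T : Triangle}

/-! ### The branch of the square root -/

variable (T) in
/-- The middle of the range of angles at radius `‖v‖` of the branch of `√v` that is cut along the
central curve. -/
def mid (v : ℂ) : ℝ := T.ang 1 (Real.log ‖v‖ / 2) + Real.pi / 2

variable (T) in
/-- The branch of `√v` that is cut along the central curve. -/
def sqrtBr (v : ℂ) : ℂ :=
  Complex.exp (T.mid v * Complex.I)
    * Complex.exp (Complex.log (Complex.exp (-(2 * T.mid v * Complex.I)) * v) / 2)

variable (T) in
/-- The branch of `((z - ζ) (z - ζ'))^{1/2}` that is cut along the central arc. -/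
def rootBr (z : ℂ) : ℂ := (z - T.ζ') * T.sqrtBr (T.mob z)

lemma sqrtBr_sq {v : ℂ} (hv : v ≠ 0) : T.sqrtBr v ^ 2 = v := by
  rw [sqrtBr, mul_pow, ← Complex.exp_nat_mul, ← Complex.exp_nat_mul]
  push_cast
  rw [mul_div_cancel₀ _ two_ne_zero, Complex.exp_log (mul_ne_zero (Complex.exp_ne_zero _) hv),
    ← mul_assoc, ← Complex.exp_add]
  ring_nf
  simp

lemma mid_exp (x θ : ℝ) : T.mid (Complex.exp (x + θ * Complex.I) ^ 2)
    = T.ang 1 x + Real.pi / 2 := by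
  rw [mid, norm_pow, norm_exp_polar, Real.log_pow, Real.log_exp]
  congr 2
  push_cast; ring

lemma exp_mid_mul {x θ : ℝ} : Complex.exp (-(2 * T.mid (Complex.exp (x + θ * Complex.I) ^ 2)
    * Complex.I)) * Complex.exp (x + θ * Complex.I) ^ 2
    = Complex.exp ((2 * x : ℝ) + (2 * (θ - (T.ang 1 x + Real.pi / 2)) : ℝ) * Complex.I) := by
  rw [mid_exp, ← Complex.exp_nat_mul, ← Complex.exp_add]
  push_cast
  ring_nf

lemma log_exp_mid_mul {x θ : ℝ} (h : θ ∈ Set.Ioo (T.ang 1 x) (T.ang 1 x + Real.pi)) :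
    Complex.log (Complex.exp (-(2 * T.mid (Complex.exp (x + θ * Complex.I) ^ 2)
    * Complex.I)) * Complex.exp (x + θ * Complex.I) ^ 2)
    = (2 * x : ℝ) + (2 * (θ - (T.ang 1 x + Real.pi / 2)) : ℝ) * Complex.I := by
  obtain ⟨h1, h2⟩ := h
  have him : ((2 * x : ℝ) + (2 * (θ - (T.ang 1 x + Real.pi / 2)) : ℝ) * Complex.I : ℂ).im
      = 2 * (θ - (T.ang 1 x + Real.pi / 2)) := by
    rw [Complex.add_im, Complex.ofReal_im, Complex.im_ofReal_mul]; simp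
  rw [exp_mid_mul, Complex.log_exp] <;> rw [him] <;> linarith

/-- Rotation by twice the middle angle brings the argument of v into (-π, π), where the principal
logarithm may be halved without ambiguity. -/
lemma sqrtBr_exp {x θ : ℝ} (h : θ ∈ Set.Ioo (T.ang 1 x) (T.ang 1 x + Real.pi)) :
    T.sqrtBr (Complex.exp (x + θ * Complex.I) ^ 2) = Complex.exp (x + θ * Complex.I) := by
  rw [sqrtBr, log_exp_mid_mul h, mid_exp, ← Complex.exp_add]
  congr 1
  push_cast
  ring

lemma continuousAt_sqrtBr {x θ : ℝ} (h : θ ∈ Set.Ioo (T.ang 1 x) (T.ang 1 x + Real.pi)) :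
    ContinuousAt T.sqrtBr (Complex.exp (x + θ * Complex.I) ^ 2) := by
  have hv : Complex.exp (x + θ * Complex.I) ^ 2 ≠ 0 := pow_ne_zero 2 (Complex.exp_ne_zero _)
  have hslit : Complex.exp (-(2 * T.mid (Complex.exp (x + θ * Complex.I) ^ 2)
      * Complex.I)) * Complex.exp (x + θ * Complex.I) ^ 2 ∈ Complex.slitPlane := by
    rw [Complex.mem_slitPlane_iff_arg]
    refine ⟨?_, mul_ne_zero (Complex.exp_ne_zero _) hv⟩
    rw [← Complex.log_im, log_exp_mid_mul h, Complex.add_im, Complex.ofReal_im,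
      Complex.im_ofReal_mul, Complex.I_im]
    have := h.2
    intro h'
    linarith
  set v := Complex.exp (x + θ * Complex.I) ^ 2
  have hm : ContinuousAt T.mid v := by
    have h1 : ContinuousAt (fun v : ℂ => Real.log ‖v‖ / 2) v :=
      (continuous_norm.continuousAt.log (norm_ne_zero_iff.mpr hv)).div_const 2
    exact ((continuous_ang 1).continuousAt.comp h1).add continuousAt_const
  have hm' : ContinuousAt (fun v => (T.mid v : ℂ)) v :=
    Complex.continuous_ofReal.continuousAt.comp hm
  have hlog : ContinuousAt (fun v => Complex.log (Complex.exp (-(2 * T.mid v * Complex.I)) * v)) v :=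
    ContinuousAt.clog (by fun_prop) hslit
  unfold sqrtBr
  fun_prop

/-- Polar coordinates on the complement of the central arc. -/
lemma exists_polar {z : ℂ} (hz : z ∉ Set.range (T.arc 1)) :
    z ≠ T.ζ ∧ z ≠ T.ζ' ∧ ∃ x θ : ℝ, θ ∈ Set.Ioo (T.ang 1 x) (T.ang 1 x + Real.pi) ∧
      T.mob z = Complex.exp (x + θ * Complex.I) ^ 2 := by
  rw [range_arc] at hz
  have h0 : z ≠ T.ζ := fun h => hz (Or.inl (Or.inl h))
  have h0' : z ≠ T.ζ' := fun h => hz (Or.inl (Or.inr h))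
  refine ⟨h0, h0', ?_⟩
  have hv := mob_ne_zero h0' h0
  set x := (Complex.log (T.mob z)).re / 2 with hx
  obtain ⟨m, hm, -⟩ := existsUnique_sub_zsmul_mem_Ico Real.pi_pos
    ((Complex.log (T.mob z)).im / 2) (T.ang 1 x)
  set θ := (Complex.log (T.mob z)).im / 2 - m • Real.pi with hθ
  have hmob : T.mob z = Complex.exp (x + θ * Complex.I) ^ 2 := by
    have h1 : T.mob z = Complex.exp (x + ((Complex.log (T.mob z)).im / 2 : ℝ) * Complex.I) ^ 2 := by
      rw [← Complex.exp_nat_mul]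
      nth_rewrite 1 [← Complex.exp_log hv]
      congr 1
      rw [hx]
      push_cast
      rw [mul_add, mul_div_cancel₀ _ two_ne_zero]
      nth_rewrite 1 [← Complex.re_add_im (Complex.log (T.mob z))]
      ring
    rw [h1, exp_polar_sq_eq_iff]
    exact ⟨rfl, m, by rw [hθ]; simp⟩
  refine ⟨x, θ, ⟨lt_of_le_of_ne hm.1 fun h => hz (Or.inr ⟨x, ?_⟩), hm.2⟩, hmob⟩
  refine mob_injOn (pt_ne_ζ' 1 x) h0' ?_
  rw [mob_pt, hmob, lift, h]

lemma notMem_arc_of_mob {z : ℂ} (hz' : z ≠ T.ζ') {x θ : ℝ}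
    (h : θ ∈ Set.Ioo (T.ang 1 x) (T.ang 1 x + Real.pi))
    (hz : T.mob z = Complex.exp (x + θ * Complex.I) ^ 2) : z ∉ Set.range (T.arc 1) := by
  rw [range_arc]
  rintro ((rfl | rfl) | ⟨y, rfl⟩)
  · have : T.mob T.ζ = 0 := by simp [mob]
    rw [this] at hz
    exact pow_ne_zero 2 (Complex.exp_ne_zero _) hz.symm
  · exact hz' rfl
  · rw [mob_pt, lift, exp_polar_sq_eq_iff] at hz
    obtain ⟨rfl, m, hm⟩ := hz
    obtain ⟨h1, h2⟩ := h
    have hpi := Real.pi_pos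
    have a1 : (m : ℝ) < 0 := by
      by_contra hc; push Not at hc
      nlinarith
    have a2 : (-1 : ℝ) < m := by
      by_contra hc; push Not at hc
      nlinarith
    have a1' : m < 0 := by exact_mod_cast a1
    have a2' : -1 < m := by exact_mod_cast a2
    omega

lemma rootBr_eq {z : ℂ} {x θ : ℝ} (h : θ ∈ Set.Ioo (T.ang 1 x) (T.ang 1 x + Real.pi))
    (hz : T.mob z = Complex.exp (x + θ * Complex.I) ^ 2) :
    T.rootBr z = (z - T.ζ') * Complex.exp (x + θ * Complex.I) := by
  rw [rootBr, hz, sqrtBr_exp h]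

lemma rootBr_sq {z : ℂ} (hz : z ≠ T.ζ) (hz' : z ≠ T.ζ') :
    T.rootBr z ^ 2 = (z - T.ζ) * (z - T.ζ') := by
  have := sub_ne_zero.mpr hz'
  rw [rootBr, mul_pow, sqrtBr_sq (mob_ne_zero hz' hz), mob]
  field_simp

lemma continuousAt_rootBr {z : ℂ} (hz : z ∉ Set.range (T.arc 1)) : ContinuousAt T.rootBr z := by
  obtain ⟨-, h0', x, θ, hθ, hmob⟩ := exists_polar hz
  have h1 : ContinuousAt (fun z => T.sqrtBr (T.mob z)) z :=
    ContinuousAt.comp (g := T.sqrtBr) (by rw [hmob]; exact continuousAt_sqrtBr hθ) (continuousAt_mob h0')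
  unfold rootBr
  fun_prop

lemma isClosed_range_arc (k : Fin 3) : IsClosed (Set.range (T.arc k)) :=
  (isCompact_range (T.arc k).continuous).isClosed

/-- A continuous square root of a holomorphic function is holomorphic wherever it does not vanish,
and the zeros ζ, ζ' lie on the cut. -/
lemma analyticOnNhd_rootBr : AnalyticOnNhd ℂ T.rootBr (Set.range (T.arc 1))ᶜ := by
  refine DifferentiableOn.analyticOnNhd (fun z hz => ?_) (isClosed_range_arc 1).isOpen_compl
  obtain ⟨h0, h0', -⟩ := exists_polar hz
  have hne : T.rootBr z ≠ 0 := fun h => by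
    have := rootBr_sq h0 h0'
    rw [h, zero_pow two_ne_zero] at this
    exact mul_ne_zero (sub_ne_zero.mpr h0) (sub_ne_zero.mpr h0') this.symm
  have hq := ((hasDerivAt_id z).sub_const T.ζ).mul ((hasDerivAt_id z).sub_const T.ζ')
  refine (hasDerivAt_of_sq_eq (continuousAt_rootBr hz) hq ?_
    hne).differentiableAt.differentiableWithinAt
  filter_upwards [(isClosed_range_arc 1).isOpen_compl.mem_nhds hz] with u hu
  obtain ⟨h1, h1', -⟩ := exists_polar hu
  exact rootBr_sq h1 h1'

/-- The point ∞ corresponds to w² = 1. That the angle 0 lies in the admissible window selects w = 1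
over w = -1, hence R(z) ~ z and not -z. -/
lemma zero_mem_range : (0 : ℝ) ∈ Set.Ioo (T.ang 1 0) (T.ang 1 0 + Real.pi) := by
  have h := ang_zero_mem (T := T) 1
  have h1 : T.Q - Real.pi < T.ang 1 0 := h.1
  have h2 : T.ang 1 0 < - T.P := h.2
  have hP := T.P_pos
  have hQ := T.Q_pos
  constructor <;> linarith

lemma tendsto_inv_cocompact : Tendsto (fun z : ℂ => z⁻¹) (cocompact ℂ) (𝓝 0) := by
  rw [← Metric.cobounded_eq_cocompact]
  exact tendsto_inv₀_cobounded

lemma tendsto_mob_cocompact : Tendsto T.mob (cocompact ℂ) (𝓝 1) := by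
  have h1 : Tendsto (fun z : ℂ => z - T.ζ') (cocompact ℂ) (cocompact ℂ) := by
    simpa [sub_eq_add_neg] using tendsto_id.comp ((Homeomorph.addRight (-T.ζ')).isClosedEmbedding.tendsto_cocompact)
  have h2 : Tendsto (fun z : ℂ => 1 - (T.ζ - T.ζ') * (z - T.ζ')⁻¹) (cocompact ℂ)
      (𝓝 (1 - (T.ζ - T.ζ') * 0)) :=
    ((tendsto_inv_cocompact.comp h1).const_mul _).const_sub _
  rw [mul_zero, sub_zero] at h2
  refine h2.congr' ?_
  filter_upwards [(Set.finite_singleton T.ζ').isCompact.compl_mem_cocompact] with z hz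
  have := one_sub_mob (T := T) (z := z) hz
  rw [div_eq_mul_inv] at this
  rw [← this]; ring

lemma rootBr_atInfinity : Tendsto (fun z => T.rootBr z / z) (cocompact ℂ) (𝓝 1) := by
  have h0 : Complex.exp ((0 : ℝ) + (0 : ℝ) * Complex.I) = 1 := by simp
  have h1 : Tendsto (fun z => T.sqrtBr (T.mob z)) (cocompact ℂ) (𝓝 1) := by
    have hc := continuousAt_sqrtBr (zero_mem_range (T := T))
    have hv := sqrtBr_exp (zero_mem_range (T := T))
    rw [ContinuousAt, hv] at hc
    rw [h0, one_pow] at hc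
    exact hc.comp tendsto_mob_cocompact
  have h2 : Tendsto (fun z : ℂ => 1 - T.ζ' * z⁻¹) (cocompact ℂ) (𝓝 (1 - T.ζ' * 0)) :=
    (tendsto_inv_cocompact.const_mul _).const_sub _
  have h3 := h2.mul h1
  rw [mul_zero, sub_zero, mul_one] at h3
  refine h3.congr' ?_
  filter_upwards [(Set.finite_singleton (0 : ℂ)).isCompact.compl_mem_cocompact] with z hz
  have : z ≠ 0 := hz
  rw [rootBr]
  field_simp

lemma isRootBranch {A B : ℝ} (hp : zetaPlus A B = T.ζ) (hm : zetaMinus A B = T.ζ') :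
    IsRootBranch A B (Set.range (T.arc 1)) T.rootBr where
  analytic := analyticOnNhd_rootBr
  sq z hz := by
    obtain ⟨h0, h0', -⟩ := exists_polar hz
    rw [hp, hm, rootBr_sq h0 h0']
  atInfinity := rootBr_atInfinity

lemma tendsto_mobInv {ι : Type*} {l : Filter ι} {v : ι → ℂ} (h : Tendsto v l (𝓝 1))
    (hne : ∀ᶠ i in l, v i ≠ 1) : Tendsto (fun i => T.mobInv (v i)) l (cocompact ℂ) := by
  rw [← Metric.cobounded_eq_cocompact, ← tendsto_norm_atTop_iff_cobounded]
  have h1 : Tendsto (fun i => ‖T.ζ - v i * T.ζ'‖) l (𝓝 ‖T.ζ - 1 * T.ζ'‖) :=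
    ((h.mul_const _).const_sub _).norm
  have h2 : Tendsto (fun i => ‖1 - v i‖) l (𝓝[>] 0) := by
    rw [tendsto_nhdsWithin_iff]
    constructor
    · simpa using (h.const_sub 1).norm
    · filter_upwards [hne] with i hi
      exact norm_pos_iff.mpr (sub_ne_zero.mpr hi.symm)
  have h3 := h1.pos_mul_atTop (by rw [one_mul]; exact norm_pos_iff.mpr T.ζ_sub_ζ'_ne)
    (tendsto_inv_nhdsGT_zero.comp h2)
  refine h3.congr fun i => ?_
  rw [mobInv, norm_div, div_eq_mul_inv]
  rfl

/-- The branch of the square root is unique. -/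
lemma isRootBranch_eq_rootBr {A B : ℝ} (hp : zetaPlus A B = T.ζ) (hm : zetaMinus A B = T.ζ')
    {R : ℂ → ℂ} (hR : IsRootBranch A B (Set.range (T.arc 1)) R) {z : ℂ}
    (hz : z ∉ Set.range (T.arc 1)) : R z = T.rootBr z := by
  obtain ⟨h0, h0', x, θ, hθ, hmob⟩ := exists_polar hz
  have hz0 := zero_mem_range (T := T)
  -- A path from z to ∞ off the cut: the logarithmic radius goes linearly to 0, and the angle
  -- measured from the central curve goes linearly to the one of w = 1. Both roots are continuous
  -- along it with equal squares, so they agree up to one constant sign, settled at infinity.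
  set y : ℝ → ℝ := fun τ => (1 - τ) * x with hy
  set ϑ : ℝ → ℝ := fun τ => (1 - τ) * (θ - T.ang 1 x) + τ * (0 - T.ang 1 0) with hϑ
  set v : ℝ → ℂ := fun τ =>
    Complex.exp (y τ + (T.ang 1 (y τ) + ϑ τ : ℝ) * Complex.I) ^ 2 with hv
  have hmem : ∀ τ ∈ Set.Icc (0 : ℝ) 1,
      T.ang 1 (y τ) + ϑ τ ∈ Set.Ioo (T.ang 1 (y τ)) (T.ang 1 (y τ) + Real.pi) := by
    intro τ hτ
    have h1 := (convex_Ioo (0 : ℝ) Real.pi) (x := θ - T.ang 1 x) (y := 0 - T.ang 1 0)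
      ⟨by linarith [hθ.1], by linarith [hθ.2]⟩ ⟨by linarith [hz0.1], by linarith [hz0.2]⟩
      (sub_nonneg.mpr hτ.2) hτ.1 (by ring)
    simp only [smul_eq_mul] at h1
    constructor <;> simp only [hϑ] <;> linarith [h1.1, h1.2]
  have hyc : Continuous y := by simp only [hy]; fun_prop
  have hvc : Continuous v := by
    have h1 : Continuous fun τ => T.ang 1 (y τ) := (continuous_ang 1).comp hyc
    have h2 : Continuous ϑ := by simp only [hϑ]; fun_prop
    simp only [hv]
    fun_prop
  have hv1 : v 1 = 1 := by
    simp [hv, hy, hϑ]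
  have hv0 : v 0 = T.mob z := by
    rw [hmob]
    simp [hv, hy, hϑ]
  have hne : ∀ τ ∈ Set.Ico (0 : ℝ) 1, v τ ≠ 1 := by
    intro τ hτ h
    have h1 : (1 : ℂ) = Complex.exp ((0 : ℝ) + (0 : ℝ) * Complex.I) ^ 2 := by simp
    rw [h1] at h
    simp only [hv] at h
    rw [exp_polar_sq_eq_iff] at h
    obtain ⟨hy0, m, hm⟩ := h
    have hpos : 0 < 1 - τ := sub_pos.mpr hτ.2
    have hx0 : x = 0 := (mul_eq_zero.mp hy0).resolve_left hpos.ne'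
    subst hx0
    have h2 := hmem τ ⟨hτ.1, hτ.2.le⟩
    rw [hm, hy0] at h2
    have hpi := Real.pi_pos
    have a1 : (m : ℝ) < 1 := by
      by_contra hc; push Not at hc
      nlinarith [h2.1, h2.2, hz0.1, hz0.2]
    have a2 : (-1 : ℝ) < m := by
      by_contra hc; push Not at hc
      nlinarith [h2.1, h2.2, hz0.1, hz0.2]
    have a1' : m < 1 := by exact_mod_cast a1
    have a2' : -1 < m := by exact_mod_cast a2
    have hm0 : m = 0 := by omega
    rw [hm0, hy0] at hm
    simp only [hϑ] at hm
    have h3 : (1 - τ) * θ = 0 := by push_cast at hm; linarith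
    have hθ0 : θ = 0 := (mul_eq_zero.mp h3).resolve_left hpos.ne'
    rw [hθ0, ← h1] at hmob
    exact mob_ne_one h0' hmob
  set p : ℝ → ℂ := fun τ => T.mobInv (v τ) with hpd
  have hpK : ∀ τ ∈ Set.Ico (0 : ℝ) 1, p τ ∉ Set.range (T.arc 1) := fun τ hτ =>
    notMem_arc_of_mob (mobInv_ne_ζ' (hne τ hτ)) (hmem τ ⟨hτ.1, hτ.2.le⟩) (mob_mobInv (hne τ hτ))
  have hpc : ∀ τ ∈ Set.Ico (0 : ℝ) 1, ContinuousAt p τ := fun τ hτ =>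
    ContinuousAt.comp (g := T.mobInv) (analyticAt_mobInv (hne τ hτ)).continuousAt hvc.continuousAt
  have hlim : Tendsto p (𝓝[<] 1) (cocompact ℂ) := by
    refine tendsto_mobInv ?_ ?_
    · rw [← hv1]; exact hvc.continuousAt.tendsto.mono_left nhdsWithin_le_nhds
    · filter_upwards [Ico_mem_nhdsLT zero_lt_one] with τ hτ using hne τ hτ
  have hc1 : ContinuousOn (fun τ => R (p τ)) (Set.Ico 0 1) := fun τ hτ =>
    (ContinuousAt.comp (g := R) (hR.analytic _ (hpK τ hτ)).continuousAt
      (hpc τ hτ)).continuousWithinAt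
  have hc2 : ContinuousOn (fun τ => T.rootBr (p τ)) (Set.Ico 0 1) := fun τ hτ =>
    (ContinuousAt.comp (g := T.rootBr) (continuousAt_rootBr (hpK τ hτ))
      (hpc τ hτ)).continuousWithinAt
  have hsq : ∀ τ ∈ Set.Ico (0 : ℝ) 1, R (p τ) ^ 2 = T.rootBr (p τ) ^ 2 := fun τ hτ => by
    obtain ⟨h1, h2, -⟩ := exists_polar (hpK τ hτ)
    rw [hR.sq _ (hpK τ hτ), rootBr_sq h1 h2, hp, hm]
  have hr0 : ∀ τ ∈ Set.Ico (0 : ℝ) 1, T.rootBr (p τ) ≠ 0 := fun τ hτ h => by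
    obtain ⟨h1, h2, -⟩ := exists_polar (hpK τ hτ)
    have h3 := rootBr_sq h1 h2
    rw [h, zero_pow two_ne_zero] at h3
    exact mul_ne_zero (sub_ne_zero.mpr h1) (sub_ne_zero.mpr h2) h3.symm
  have hp0 : p 0 = z := by simp only [hpd]; rw [hv0, mobInv_mob h0']
  have hzero : (0 : ℝ) ∈ Set.Ico (0 : ℝ) 1 := ⟨le_rfl, zero_lt_one⟩
  rcases isPreconnected_Ico.eq_or_eq_neg_of_sq_eq hc1 hc2 hsq (fun {τ} hτ => hr0 τ hτ) with h | h
  · have := h hzero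
    simpa [hp0] using this
  · exfalso
    have l1 := hR.atInfinity.comp hlim
    have l2 := ((rootBr_atInfinity (T := T)).comp hlim).neg
    have l3 : Tendsto ((fun z => R z / z) ∘ p) (𝓝[<] 1) (𝓝 (-1)) := by
      refine l2.congr' ?_
      filter_upwards [Ico_mem_nhdsLT (zero_lt_one (α := ℝ))] with τ hτ
      have := h hτ
      simp only [Function.comp, Pi.neg_apply] at this ⊢
      rw [this, neg_div]
    have := tendsto_nhds_unique l1 l3
    norm_num at this

/-- The left curve has a smaller angle than the central one, so the representative in the admissible
window is `ang 0 x + π`; the half turn produces the minus sign. -/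
lemma rootBr_pt_zero (x : ℝ) :
    T.rootBr (T.pt 0 x) = - ((T.pt 0 x - T.ζ') * T.lift 0 x) := by
  have h01 := ang_lt (T := T) (k := 0) (l := 1) (by decide) x
  have h12 := ang_lt (T := T) (k := 1) (l := 2) (by decide) x
  have h20 := ang_two_lt (T := T) x
  have hneg : Complex.exp (x + (T.ang 0 x + Real.pi : ℝ) * Complex.I) = - T.lift 0 x := by
    rw [lift, Complex.ofReal_add, add_mul, ← add_assoc, Complex.exp_add _ (Real.pi * Complex.I),
      Complex.exp_pi_mul_I]
    ring
  rw [rootBr_eq (x := x) (θ := T.ang 0 x + Real.pi) ⟨by linarith, by linarith⟩, hneg]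
  · ring
  · rw [hneg, mob_pt]; ring

lemma rootBr_pt_two (x : ℝ) : T.rootBr (T.pt 2 x) = (T.pt 2 x - T.ζ') * T.lift 2 x := by
  have h01 := ang_lt (T := T) (k := 0) (l := 1) (by decide) x
  have h12 := ang_lt (T := T) (k := 1) (l := 2) (by decide) x
  have h20 := ang_two_lt (T := T) x
  rw [rootBr_eq (x := x) (θ := T.ang 2 x) ⟨by linarith, by linarith⟩ (mob_pt 2 x), lift]

lemma pt_notMem {k : Fin 3} (hk : k ≠ 1) (x : ℝ) : T.pt k x ∉ Set.range (T.arc 1) := by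
  rw [range_arc]
  rintro ((h | h) | ⟨y, h⟩)
  · exact pt_ne_ζ k x h
  · exact pt_ne_ζ' k x h
  · exact hk (pt_inj h).1.symm

end Triangle

end JacobiZeros

end

/-! ### Non-tangential boundary values of the branch -/

noncomputable section

namespace JacobiZeros

/-- The sector of aperture `κ` to the left of a curve is not small. -/
lemma neBot_sector {z₀ d : ℂ} (hd : d ≠ 0) :
    (𝓝[{z : ℂ | (1 / 2 : ℝ) * ‖(z - z₀) / d‖ < ((z - z₀) / d).im}] z₀).NeBot := by
  rw [← mem_closure_iff_nhdsWithin_neBot, Metric.mem_closure_iff]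
  intro ε hε
  have hd' : 0 < ‖d‖ := norm_pos_iff.mpr hd
  have hδ : 0 < ε / (2 * ‖d‖) := by positivity
  refine ⟨z₀ + ((ε / (2 * ‖d‖) : ℝ) : ℂ) * Complex.I * d, ?_, ?_⟩
  · simp only [Set.mem_ofPred_eq, add_sub_cancel_left, mul_div_cancel_right₀ _ hd, norm_mul,
      Complex.norm_I, Complex.norm_real, Real.norm_eq_abs, abs_of_pos hδ, Complex.im_ofReal_mul,
      Complex.I_im]
    linarith
  · rw [dist_self_add_right, norm_mul, norm_mul, Complex.norm_I, Complex.norm_real,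
      Real.norm_eq_abs, abs_of_pos hδ]
    field_simp
    linarith

lemma HasLeftLimit.unique {γ : ℝ → ℂ} {f : ℂ → ℂ} {t : ℝ} {c c' : ℂ} (hγ : deriv γ t ≠ 0)
    (h : HasLeftLimit γ f t c) (h' : HasLeftLimit γ f t c') : c = c' := by
  have := neBot_sector (z₀ := γ t) hγ
  exact tendsto_nhds_unique (h (1 / 2) (by norm_num)) (h' (1 / 2) (by norm_num))

lemma ContinuousAt.hasLeftLimit {γ : ℝ → ℂ} {f : ℂ → ℂ} {t : ℝ} (h : ContinuousAt f (γ t)) :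
    HasLeftLimit γ f t (f (γ t)) := fun _ _ => h.tendsto.mono_left nhdsWithin_le_nhds

namespace Triangle

variable {T : Triangle}

variable (T) in
/-- The slope of the angle of the `k`-th curve. -/
def slope (k : Fin 3) (x : ℝ) : ℝ := deriv (T.ang k) x

lemma hasDerivAt_ang (k : Fin 3) (x : ℝ) : HasDerivAt (T.ang k) (T.slope k x) x :=
  (analyticAt_ang k x).differentiableAt.hasDerivAt

lemma hasDerivAt_lift (k : Fin 3) (x : ℝ) :
    HasDerivAt (T.lift k) ((1 + T.slope k x * Complex.I) * T.lift k x) x := by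
  have h1 : HasDerivAt (fun x : ℝ => (x : ℂ) + T.ang k x * Complex.I)
      (1 + T.slope k x * Complex.I) x :=
    (Complex.ofRealCLM.hasDerivAt (x := x)).add ((hasDerivAt_ang k x).ofReal_comp.mul_const _)
  have h2 := h1.cexp
  rw [mul_comm] at h2
  exact h2

lemma hasDerivAt_pt (k : Fin 3) (x : ℝ) : HasDerivAt (T.pt k) (deriv (T.pt k) x) x :=
  (analyticAt_pt k x).differentiableAt.hasDerivAt

variable (T) in
/-- Half the logarithm of `mob` relative to its value at the point `pt k x`. -/
def relLog (k : Fin 3) (x : ℝ) (z : ℂ) : ℂ := Complex.log (T.mob z / T.lift k x ^ 2) / 2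

lemma relLog_pt_self (k : Fin 3) (x : ℝ) : T.relLog k x (T.pt k x) = 0 := by
  rw [relLog, mob_pt, div_self (pow_ne_zero 2 (lift_ne_zero k x)), Complex.log_one, zero_div]

lemma exp_relLog {k : Fin 3} {x : ℝ} {z : ℂ} (h0 : z ≠ T.ζ) (h0' : z ≠ T.ζ') :
    T.mob z = (T.lift k x * Complex.exp (T.relLog k x z)) ^ 2 := by
  have hl := lift_ne_zero (T := T) k x
  rw [mul_pow, ← Complex.exp_nat_mul, relLog, Nat.cast_ofNat, mul_div_cancel₀ _ two_ne_zero,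
    Complex.exp_log (div_ne_zero (mob_ne_zero h0' h0) (pow_ne_zero 2 hl)),
    mul_div_cancel₀ _ (pow_ne_zero 2 hl)]

/-- Near the base point, moving along the curve changes `relLog` by the increment of y + i `ang k
y`. The chain rule gives its derivative without an explicit formula for that of `pt`. -/
lemma hasDerivAt_relLog (k : Fin 3) (x : ℝ) : ∃ d : ℂ,
    HasDerivAt (T.relLog k x) d (T.pt k x) ∧ d * deriv (T.pt k) x = 1 + T.slope k x * Complex.I := by
  have hl := lift_ne_zero (T := T) k x
  have hl2 := pow_ne_zero 2 hl
  have h1 := ((hasDerivAt_mob (pt_ne_ζ' (T := T) k x)).div_const (T.lift k x ^ 2)).clog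
    (by rw [mob_pt, div_self hl2]; exact Complex.one_mem_slitPlane)
  have h2 := h1.div_const 2
  refine ⟨_, h2, ?_⟩
  have h3 : HasDerivAt (fun y => T.relLog k x (T.pt k y)) _ x := h2.comp x (hasDerivAt_pt k x)
  have h4 : HasDerivAt (fun y => T.relLog k x (T.pt k y)) (1 + T.slope k x * Complex.I) x := by
    have h5 : HasDerivAt (fun y => Complex.log (T.lift k y ^ 2 / T.lift k x ^ 2) / 2) _ x :=
      ((((hasDerivAt_lift k x).fun_pow 2).div_const (T.lift k x ^ 2)).clog_real
        (by rw [div_self hl2]; exact Complex.one_mem_slitPlane)).div_const 2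
    convert h5 using 1
    · funext y; rw [relLog, mob_pt]
    · push_cast
      field_simp
  exact h3.unique h4

/-- The boundary values of the branch on the left side of the central arc. -/
lemma tendsto_rootBr_left {x : ℝ} {l : ℝ} (hl : 0 < l) {d : ℂ}
    (hd : d = l * deriv (T.pt 1) x) (hd0 : d ≠ 0) {κ : ℝ} (hκ : 0 < κ) :
    (∀ᶠ z in 𝓝[{z : ℂ | κ * ‖(z - T.pt 1 x) / d‖ < ((z - T.pt 1 x) / d).im}] (T.pt 1 x),
      z ∉ Set.range (T.arc 1)) ∧
    Tendsto T.rootBr (𝓝[{z : ℂ | κ * ‖(z - T.pt 1 x) / d‖ < ((z - T.pt 1 x) / d).im}] (T.pt 1 x))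
      (𝓝 ((T.pt 1 x - T.ζ') * T.lift 1 x)) := by
  obtain ⟨e, he, hed⟩ := hasDerivAt_relLog (T := T) 1 x
  set z₀ := T.pt 1 x with hz₀
  set s := T.slope 1 x with hs
  set r : ℂ → ℝ := fun z => x + (T.relLog 1 x z).re with hr
  set θ : ℂ → ℝ := fun z => T.ang 1 x + (T.relLog 1 x z).im with hθ
  have hr0 : r z₀ = x := by simp only [hr, hz₀, relLog_pt_self]; simp
  have hθ0 : θ z₀ = T.ang 1 x := by simp only [hθ, hz₀, relLog_pt_self]; simp
  have heR : HasFDerivAt (T.relLog 1 x) _ z₀ := he.hasFDerivAt.restrictScalars ℝ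
  have hrd : HasFDerivAt r _ z₀ := (Complex.reCLM.hasFDerivAt.comp z₀ heR).const_add x
  have hθd : HasFDerivAt θ _ z₀ := (Complex.imCLM.hasFDerivAt.comp z₀ heR).const_add (T.ang 1 x)
  have hang : HasDerivAt (T.ang 1) s (r z₀) := by rw [hr0]; exact hasDerivAt_ang 1 x
  -- θ - `ang 1` ∘ r is the angular distance from the central curve. Along z - z₀ = d u its
  -- derivative is l (1 + s²) Im u, so positive Im u means the side of larger angles.
  have hg := hθd.sub (hang.comp_hasFDerivAt z₀ hrd)
  have hcont := hg.continuousAt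
  have hd1 : 0 < ‖d‖ := norm_pos_iff.mpr hd0
  -- With this tolerance the linearization error is at most l κ ‖u‖, which the sector condition
  -- makes smaller than l Im u.
  have hε : 0 < l * κ / ‖d‖ := by positivity
  have hlt : ∀ᶠ z in 𝓝 z₀, (θ - T.ang 1 ∘ r) z < Real.pi := by
    refine hcont.tendsto.eventually_lt_const ?_
    simp only [Pi.sub_apply, Function.comp, hr0, hθ0, sub_self]
    exact Real.pi_pos
  have hgt := hg.isLittleO.def hε
  have hne : ∀ᶠ z in 𝓝 z₀, z ≠ T.ζ ∧ z ≠ T.ζ' :=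
    (isOpen_ne.eventually_mem (pt_ne_ζ 1 x)).and (isOpen_ne.eventually_mem (pt_ne_ζ' 1 x))
  have key : ∀ᶠ z in 𝓝[{z : ℂ | κ * ‖(z - z₀) / d‖ < ((z - z₀) / d).im}] z₀,
      z ∉ Set.range (T.arc 1) ∧
      T.rootBr z = (z - T.ζ') * (T.lift 1 x * Complex.exp (T.relLog 1 x z)) := by
    filter_upwards [nhdsWithin_le_nhds hlt, nhdsWithin_le_nhds hgt, nhdsWithin_le_nhds hne,
      self_mem_nhdsWithin] with z h1 h2 h3 h4
    have hpolar : T.lift 1 x * Complex.exp (T.relLog 1 x z)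
        = Complex.exp (r z + θ z * Complex.I) := by
      rw [lift, ← Complex.exp_add]
      congr 1
      simp only [hr, hθ]
      nth_rewrite 1 [← Complex.re_add_im (T.relLog 1 x z)]
      push_cast
      ring
    have hmob := exp_relLog (T := T) (k := 1) (x := x) h3.1 h3.2
    rw [hpolar] at hmob
    have hmem : θ z ∈ Set.Ioo (T.ang 1 (r z)) (T.ang 1 (r z) + Real.pi) := by
      refine ⟨?_, by simp only [Pi.sub_apply, Function.comp] at h1; linarith⟩
      set u := (z - z₀) / d with hu
      have hzu : z - z₀ = d * u := by rw [hu, mul_div_cancel₀ _ hd0]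
      have hez : (z - z₀) * e = l * ((1 + s * Complex.I) * u) := by
        rw [← hed, hzu, hd]; ring
      have hre : ((z - z₀) * e).re = l * (u.re - s * u.im) := by
        rw [hez, Complex.re_ofReal_mul]; simp
      have him : ((z - z₀) * e).im = l * (u.im + s * u.re) := by
        rw [hez, Complex.im_ofReal_mul]; simp
      simp only [Pi.sub_apply, Function.comp, hr0, hθ0, sub_self, sub_zero,
        sub_apply, smul_apply,
        ContinuousLinearMap.comp_apply, ContinuousLinearMap.coe_restrictScalars',
        ContinuousLinearMap.toSpanSingleton_apply, Complex.imCLM_apply, Complex.reCLM_apply,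
        smul_eq_mul, hre, him, Real.norm_eq_abs] at h2
      have h5 : ‖z - z₀‖ = ‖d‖ * ‖u‖ := by rw [hzu, norm_mul]
      rw [h5, show l * κ / ‖d‖ * (‖d‖ * ‖u‖) = l * (κ * ‖u‖) by field_simp] at h2
      have h6 := (abs_le.mp h2).1
      have h7 : κ * ‖u‖ < u.im := h4
      have h8 : l * (κ * ‖u‖) < l * u.im := mul_lt_mul_of_pos_left h7 hl
      have h9 : 0 < u.im := lt_of_le_of_lt (by positivity) h7
      nlinarith [mul_nonneg (mul_nonneg hl.le (sq_nonneg s)) h9.le]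
    exact ⟨notMem_arc_of_mob h3.2 hmem hmob, by rw [hpolar]; exact rootBr_eq hmem hmob⟩
  refine ⟨key.mono fun z h => h.1, ?_⟩
  have hc : ContinuousAt (fun z => (z - T.ζ') * (T.lift 1 x * Complex.exp (T.relLog 1 x z))) z₀ := by
    have := he.continuousAt
    fun_prop
  have hlim := hc.tendsto.mono_left (nhdsWithin_le_nhds
    (s := {z : ℂ | κ * ‖(z - z₀) / d‖ < ((z - z₀) / d).im}))
  rw [relLog_pt_self, Complex.exp_zero, mul_one] at hlim
  exact hlim.congr' (key.mono fun z h => h.2.symm)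

/-- The value on the left side of the curves, up to the factor `(z - ζ') * lift`. -/
def side : Fin 3 → ℝ := ![-1, 1, 1]

/-- The boundary values of the branch on the left side of the oriented arcs. -/
lemma hasLeftLimit_rootBr {k : Fin 3} {γ : ℝ → ℂ} {t x l : ℝ} (hγ : γ t = T.pt k x)
    (hd : deriv γ t = l * deriv (T.pt k) x) (hd0 : deriv γ t ≠ 0) (hl : k = 1 → 0 < l)
    {R : ℂ → ℂ} (hR : ∀ z, z ∉ Set.range (T.arc 1) → R z = T.rootBr z) :
    HasLeftLimit γ R t (side k * ((T.pt k x - T.ζ') * T.lift k x)) := by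
  have hoff : k ≠ 1 → HasLeftLimit γ R t (T.rootBr (T.pt k x)) := fun hk => by
    have hmem := pt_notMem (T := T) hk x
    have hc : ContinuousAt R (γ t) := by
      rw [hγ]
      refine (continuousAt_rootBr hmem).congr ?_
      filter_upwards [(isClosed_range_arc 1).isOpen_compl.mem_nhds hmem] with z hz
      exact (hR z hz).symm
    have := ContinuousAt.hasLeftLimit hc
    rwa [hγ, hR _ hmem] at this
  fin_cases k
  · have := hoff (by decide)
    simp only [Fin.zero_eta] at this ⊢
    rw [rootBr_pt_zero] at this
    simpa [side] using this
  · intro κ hκ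
    obtain ⟨h1, h2⟩ := tendsto_rootBr_left (hl rfl) hd hd0 hκ
    simp only [Fin.mk_one] at hγ ⊢
    rw [hγ]
    simp only [side, Matrix.cons_val_one, Matrix.cons_val_zero, Complex.ofReal_one, one_mul]
    exact h2.congr' (h1.mono fun z hz => (hR z hz).symm)
  · have := hoff (by decide)
    simp only [Fin.reduceFinMk] at this ⊢
    rw [rootBr_pt_two] at this
    simpa [side] using this

end Triangle

end JacobiZeros

end

/-! ### Arcs of an arbitrary decomposition -/

noncomputable section

namespace JacobiZeros

namespace Triangle

variable {T : Triangle}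

variable (T) in
/-- On `(0, 1)` the curve `γ` is the `k`-th curve with parameter `x`, traversed in the direction
given by the sign `s`. -/
structure Follows (k : Fin 3) (s : ℝ) (γ : ℝ → ℂ) (x x' : ℝ → ℝ) : Prop where
  eq : ∀ t ∈ Set.Ioo (0 : ℝ) 1, γ t = T.pt k (x t)
  hasDerivAt : ∀ t ∈ Set.Ioo (0 : ℝ) 1, HasDerivAt x (x' t) t
  sign : ∀ t ∈ Set.Ioo (0 : ℝ) 1, 0 < s * x' t
  tendsto_left : Tendsto (fun t => s * x t) (𝓝[>] 0) atBot
  tendsto_right : Tendsto (fun t => s * x t) (𝓝[<] 1) atTop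

lemma one_sub_mem_Ioo {t : ℝ} (ht : t ∈ Set.Ioo (0 : ℝ) 1) : 1 - t ∈ Set.Ioo (0 : ℝ) 1 :=
  ⟨sub_pos.mpr ht.2, by linarith [ht.1]⟩

lemma Follows.symm {k : Fin 3} {γ : ℝ → ℂ} {x x' : ℝ → ℝ} (h : T.Follows k 1 γ x x') :
    T.Follows k (-1) (fun t => γ (1 - t)) (fun t => x (1 - t)) (fun t => -x' (1 - t)) where
  eq t ht := h.eq _ (one_sub_mem_Ioo ht)
  hasDerivAt t ht := by
    have : HasDerivAt (fun t => x (1 - t)) _ t :=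
      (h.hasDerivAt _ (one_sub_mem_Ioo ht)).comp t ((hasDerivAt_id t).const_sub 1)
    simpa using this
  sign t ht := by simpa using h.sign _ (one_sub_mem_Ioo ht)
  tendsto_left := by
    have h1 : Tendsto (fun t : ℝ => 1 - t) (𝓝[>] 0) (𝓝[<] 1) := by
      refine tendsto_nhdsWithin_iff.mpr ⟨?_, ?_⟩
      · exact (Continuous.tendsto' (by fun_prop) _ _ (by simp)).mono_left nhdsWithin_le_nhds
      · filter_upwards [self_mem_nhdsWithin] with t ht
        simpa using ht
    have := tendsto_neg_atTop_atBot.comp (h.tendsto_right.comp h1)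
    simpa [Function.comp_def] using this
  tendsto_right := by
    have h1 : Tendsto (fun t : ℝ => 1 - t) (𝓝[<] 1) (𝓝[>] 0) := by
      refine tendsto_nhdsWithin_iff.mpr ⟨?_, ?_⟩
      · exact (Continuous.tendsto' (by fun_prop) _ _ (by simp)).mono_left nhdsWithin_le_nhds
      · filter_upwards [self_mem_nhdsWithin] with t ht
        simpa using ht
    have := tendsto_neg_atBot_atTop.comp (h.tendsto_left.comp h1)
    simpa [Function.comp_def] using this

lemma Follows.deriv_eq {k : Fin 3} {s : ℝ} {γ : ℝ → ℂ} {x x' : ℝ → ℝ}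
    (h : T.Follows k s γ x x') {t : ℝ} (ht : t ∈ Set.Ioo (0 : ℝ) 1) :
    deriv γ t = x' t * deriv (T.pt k) (x t) := by
  have h1 : HasDerivAt (fun t => T.pt k (x t)) _ t :=
    (hasDerivAt_pt k (x t)).scomp t (h.hasDerivAt t ht)
  rw [Complex.real_smul] at h1
  rw [← h1.deriv]
  refine EventuallyEq.deriv_eq ?_
  filter_upwards [Ioo_mem_nhds ht.1 ht.2] with u hu using h.eq u hu

lemma tendsto_rad_ζ : Tendsto T.rad (𝓝[{T.ζ}ᶜ] T.ζ) atBot := by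
  have h1 : Tendsto (fun z => ‖T.mob z‖) (𝓝[{T.ζ}ᶜ] T.ζ) (𝓝[>] 0) := by
    refine tendsto_nhdsWithin_iff.mpr ⟨?_, ?_⟩
    · have h2 := (continuousAt_mob T.ζ_ne_ζ').norm.tendsto
      have h3 : ‖T.mob T.ζ‖ = 0 := by simp [mob]
      rw [h3] at h2
      exact h2.mono_left nhdsWithin_le_nhds
    · filter_upwards [self_mem_nhdsWithin,
        nhdsWithin_le_nhds (isOpen_ne.eventually_mem T.ζ_ne_ζ')] with z hz hz'
      exact norm_pos_iff.mpr (mob_ne_zero hz' hz)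
  exact (Real.tendsto_log_nhdsGT_zero.comp h1).atBot_div_const two_pos

lemma tendsto_rad_ζ' : Tendsto T.rad (𝓝[{T.ζ'}ᶜ] T.ζ') atTop := by
  have h1 : Tendsto (fun z => ‖T.mob z‖⁻¹) (𝓝[{T.ζ'}ᶜ] T.ζ') (𝓝[>] 0) := by
    refine tendsto_nhdsWithin_iff.mpr ⟨?_, ?_⟩
    · have h2 : ContinuousAt (fun z => ‖(z - T.ζ') / (z - T.ζ)‖) T.ζ' := by
        refine (ContinuousAt.div (by fun_prop) (by fun_prop) ?_).norm
        exact sub_ne_zero.mpr T.ζ_ne_ζ'.symm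
      have h3 := h2.tendsto
      simp only [sub_self, zero_div, norm_zero] at h3
      refine (h3.mono_left nhdsWithin_le_nhds).congr fun z => ?_
      rw [mob, ← norm_inv, inv_div]
    · filter_upwards [self_mem_nhdsWithin,
        nhdsWithin_le_nhds (isOpen_ne.eventually_mem T.ζ_ne_ζ'.symm)] with z hz hz'
      exact inv_pos.mpr (norm_pos_iff.mpr (mob_ne_zero hz hz'))
  have h2 := tendsto_neg_atBot_atTop.comp
    ((Real.tendsto_log_nhdsGT_zero.comp h1).atBot_div_const two_pos)
  refine h2.congr fun z => ?_
  simp only [Function.comp, Real.log_inv, rad]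
  ring

/-- A regular curve from `ζ` to `ζ'` on the three curves stays on one of them. -/
lemma exists_follows {γ : ℝ → ℂ} (hc : ContinuousOn γ (Set.Icc 0 1))
    (hinj : Set.InjOn γ (Set.Icc 0 1)) (h0 : γ 0 = T.ζ) (h1 : γ 1 = T.ζ')
    (hd : ∀ t ∈ Set.Ioo (0 : ℝ) 1, DifferentiableAt ℝ γ t)
    (hreg : ∀ t ∈ Set.Ioo (0 : ℝ) 1, deriv γ t ≠ 0)
    (hmem : ∀ t ∈ Set.Icc (0 : ℝ) 1, γ t ∈ ({T.ζ, T.ζ'} ∪ ⋃ k, Set.range (T.pt k) : Set ℂ)) :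
    ∃ k x x', T.Follows k 1 γ x x' ∧ γ '' Set.Icc 0 1 = Set.range (T.arc k) := by
  have hsub := Set.Ioo_subset_Icc_self (a := (0 : ℝ)) (b := 1)
  have hne : ∀ t ∈ Set.Ioo (0 : ℝ) 1, γ t ≠ T.ζ := fun t ht h =>
    ht.1.ne' (hinj (hsub ht) ⟨le_rfl, zero_le_one⟩ (h.trans h0.symm))
  have hne' : ∀ t ∈ Set.Ioo (0 : ℝ) 1, γ t ≠ T.ζ' := fun t ht h =>
    ht.2.ne (hinj (hsub ht) ⟨zero_le_one, le_rfl⟩ (h.trans h1.symm))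
  have hpt : ∀ t ∈ Set.Ioo (0 : ℝ) 1, ∃ k y, T.pt k y = γ t := by
    intro t ht
    rcases hmem t (hsub ht) with (h | h) | h
    · exact absurd h (hne t ht)
    · exact absurd h (hne' t ht)
    · simpa using h
  have hhalf : (1 / 2 : ℝ) ∈ Set.Ioo (0 : ℝ) 1 := ⟨by norm_num, by norm_num⟩
  obtain ⟨k, y₀, hk⟩ := hpt _ hhalf
  have hcI : ContinuousOn γ (Set.Ioo 0 1) := hc.mono hsub
  have hconn : IsPreconnected (γ '' Set.Ioo 0 1) := isPreconnected_Ioo.image γ hcI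
  -- The three closed curves meet only in ζ and ζ', which the open arc avoids by injectivity; a
  -- connected set then lies on a single curve.
  have hk_all : γ '' Set.Ioo 0 1 ⊆ Set.range (T.arc k) := by
    rw [isPreconnected_iff_subset_of_disjoint_closed] at hconn
    have hcl : IsClosed (⋃ l ∈ ({k}ᶜ : Set (Fin 3)), Set.range (T.arc l)) :=
      (Set.toFinite _).isClosed_biUnion fun l _ => isClosed_range_arc l
    have hcover : γ '' Set.Ioo 0 1 ⊆ Set.range (T.arc k) ∪
        ⋃ l ∈ ({k}ᶜ : Set (Fin 3)), Set.range (T.arc l) := by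
      rintro _ ⟨t, ht, rfl⟩
      obtain ⟨l, y, hl⟩ := hpt t ht
      have hmem : γ t ∈ Set.range (T.arc l) := by rw [range_arc]; exact Or.inr ⟨y, hl⟩
      by_cases hkl : l = k
      · subst hkl; exact Or.inl hmem
      · exact Or.inr (Set.mem_iUnion₂.mpr ⟨l, hkl, hmem⟩)
    have hdisj : γ '' Set.Ioo 0 1 ∩ (Set.range (T.arc k) ∩
        ⋃ l ∈ ({k}ᶜ : Set (Fin 3)), Set.range (T.arc l)) = ∅ := by
      rw [Set.eq_empty_iff_forall_notMem]
      rintro _ ⟨⟨t, ht, rfl⟩, h2, h3⟩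
      obtain ⟨l, hl, hl'⟩ := Set.mem_iUnion₂.mp h3
      rw [range_arc] at hl' h2
      rcases hl' with (h | h) | ⟨y, h⟩
      · exact hne _ ht h
      · exact hne' _ ht h
      · rcases h2 with (h' | h') | ⟨y', h'⟩
        · exact hne _ ht h'
        · exact hne' _ ht h'
        · exact hl (pt_inj (h.trans h'.symm)).1
    rcases hconn _ _ (isClosed_range_arc (T := T) k) hcl hcover hdisj with h | h
    · exact h
    · exfalso
      obtain ⟨l, hl, hl'⟩ := Set.mem_iUnion₂.mp (h ⟨_, hhalf, rfl⟩)
      rw [range_arc] at hl'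
      rcases hl' with (h | h) | ⟨y, h⟩
      · exact hne _ hhalf h
      · exact hne' _ hhalf h
      · exact hl (pt_inj (h.trans hk.symm)).1
  set x : ℝ → ℝ := fun t => T.rad (γ t) with hx
  have heq : ∀ t ∈ Set.Ioo (0 : ℝ) 1, γ t = T.pt k (x t) := by
    intro t ht
    have := hk_all ⟨t, ht, rfl⟩
    rw [range_arc] at this
    rcases this with (h | h) | ⟨y, h⟩
    · exact absurd h (hne t ht)
    · exact absurd h (hne' t ht)
    · simp only [hx]; rw [← h, rad_pt]
  have hxd : ∀ t ∈ Set.Ioo (0 : ℝ) 1, HasDerivAt x (deriv x t) t := by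
    intro t ht
    obtain ⟨d, h⟩ := hasDerivAt_rad (hd t ht).hasDerivAt (hne t ht) (hne' t ht)
    exact h.differentiableAt.hasDerivAt
  have hxc : ContinuousOn x (Set.Ioo 0 1) := fun t ht => (hxd t ht).continuousAt.continuousWithinAt
  have hxinj : Set.InjOn x (Set.Ioo 0 1) := by
    intro t ht u hu h
    refine hinj (hsub ht) (hsub hu) ?_
    rw [heq t ht, heq u hu, h]
  have hleft : Tendsto x (𝓝[>] 0) atBot := by
    refine tendsto_rad_ζ.comp (tendsto_nhdsWithin_iff.mpr ⟨?_, ?_⟩)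
    · have := (hc 0 ⟨le_rfl, zero_le_one⟩).mono hsub
      rw [ContinuousWithinAt, nhdsWithin_Ioo_eq_nhdsGT zero_lt_one, h0] at this
      exact this
    · filter_upwards [Ioo_mem_nhdsGT (zero_lt_one (α := ℝ))] with t ht using hne t ht
  have hright : Tendsto x (𝓝[<] 1) atTop := by
    refine tendsto_rad_ζ'.comp (tendsto_nhdsWithin_iff.mpr ⟨?_, ?_⟩)
    · have := (hc 1 ⟨zero_le_one, le_rfl⟩).mono hsub
      rw [ContinuousWithinAt, nhdsWithin_Ioo_eq_nhdsLT zero_lt_one, h1] at this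
      exact this
    · filter_upwards [Ioo_mem_nhdsLT (zero_lt_one (α := ℝ))] with t ht using hne' t ht
  -- A continuous injective radial coordinate is strictly monotone on the interval; its limit +∞ at
  -- the right end excludes that it decreases.
  have hmono : StrictMonoOn x (Set.Ioo 0 1) := by
    rcases hxc.strictMonoOn_of_injOn_Ioo zero_lt_one hxinj with h | h
    · exact h
    · exfalso
      obtain ⟨t, ht1, ht2⟩ := ((hright.eventually_gt_atTop (x (1 / 2))).and
        (Ioo_mem_nhdsLT (show (1 / 2 : ℝ) < 1 by norm_num))).exists
      exact absurd (h hhalf ⟨by linarith [ht2.1], ht2.2⟩ ht2.1) ht1.not_gt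
  have hf : T.Follows k 1 γ x (deriv x) := by
    refine ⟨heq, hxd, fun t ht => ?_, by simpa using hleft, by simpa using hright⟩
    rw [one_mul]
    refine lt_of_le_of_ne ?_ fun h => ?_
    · have := hmono.monotoneOn.derivWithin_nonneg (x := t)
      rwa [derivWithin_of_isOpen isOpen_Ioo ht] at this
    · have h2 : HasDerivAt (fun t => T.pt k (x t)) _ t :=
        (hasDerivAt_pt k (x t)).scomp t (hxd t ht)
      rw [← h, zero_smul] at h2
      have h3 : HasDerivAt γ 0 t := h2.congr_of_eventuallyEq (by
        filter_upwards [Ioo_mem_nhds ht.1 ht.2] with u hu using heq u hu)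
      exact hreg t ht h3.deriv
  refine ⟨k, x, _, hf, ?_⟩
  ext z
  rw [range_arc]
  constructor
  · rintro ⟨t, ht, rfl⟩
    rcases ht.1.eq_or_lt with rfl | ht0
    · exact Or.inl (Or.inl h0)
    rcases ht.2.eq_or_lt with rfl | ht1
    · exact Or.inl (Or.inr h1)
    exact Or.inr ⟨x t, (heq t ⟨ht0, ht1⟩).symm⟩
  · rintro ((rfl | rfl) | ⟨y, rfl⟩)
    · exact ⟨0, ⟨le_rfl, zero_le_one⟩, h0⟩
    · exact ⟨1, ⟨zero_le_one, le_rfl⟩, h1⟩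
    · have hs : Set.SurjOn x (Set.Ioo 0 1) Set.univ := by
        refine hxc.surjOn_of_tendsto ⟨_, hhalf⟩ ?_ ?_
        · rwa [tendsto_comp_coe_Ioo_atBot zero_lt_one]
        · rwa [tendsto_comp_coe_Ioo_atTop zero_lt_one]
      obtain ⟨t, ht, rfl⟩ := hs (Set.mem_univ y)
      exact ⟨t, hsub ht, heq t ht⟩

lemma image_extend {a b : ℂ} (γ : Path a b) : γ.extend '' Set.Icc 0 1 = Set.range γ := by
  ext z
  constructor
  · rintro ⟨t, ht, rfl⟩
    rw [Path.extend_apply _ ht]; exact ⟨_, rfl⟩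
  · rintro ⟨t, rfl⟩
    exact ⟨t, t.2, Path.extend_apply _ t.2⟩

lemma injOn_extend {a b : ℂ} {γ : Path a b} (h : Function.Injective γ) :
    Set.InjOn γ.extend (Set.Icc 0 1) := by
  intro t ht u hu htu
  rw [Path.extend_apply _ ht, Path.extend_apply _ hu] at htu
  exact congrArg Subtype.val (h htu)

lemma exists_follows_path {γ : Path T.ζ T.ζ'} (h : IsAnalyticArc γ)
    (hmem : Set.range γ ⊆ ({T.ζ, T.ζ'} ∪ ⋃ k, Set.range (T.pt k) : Set ℂ)) :
    ∃ k x x', T.Follows k 1 γ.extend x x' ∧ Set.range γ = Set.range (T.arc k) := by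
  rw [← image_extend γ]
  refine exists_follows (by fun_prop) (injOn_extend h.injective) γ.extend_zero γ.extend_one
    (fun t ht => (h.analytic t ht).differentiableAt) h.regular fun t ht => hmem ?_
  rw [← image_extend]
  exact ⟨t, ht, rfl⟩

lemma pt_zero_eq_of_range {k : Fin 3} {x : ℝ}
    (h : Set.range (T.arc k) ∩ {z : ℂ | z.im = 0} = {(x : ℂ)}) :
    0 < sg k 0 * (x - 1) ∧ sg k 1 * (x + 1) < 0 := by
  obtain ⟨r, hr, h1, h2⟩ := pt_zero_location (T := T) k
  have : T.pt k 0 ∈ Set.range (T.arc k) ∩ {z : ℂ | z.im = 0} :=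
    ⟨by rw [range_arc]; exact Or.inr ⟨0, rfl⟩, (pt_im_eq_zero_iff k 0).mpr rfl⟩
  rw [h, Set.mem_singleton_iff, hr, Complex.ofReal_inj] at this
  rw [← this]
  exact ⟨h1, h2⟩

lemma eq_of_location {k : Fin 3} {x : ℝ} (h : 0 < sg k 0 * (x - 1) ∧ sg k 1 * (x + 1) < 0) :
    (x < -1 → k = 0) ∧ (-1 < x → x < 1 → k = 1) ∧ (1 < x → k = 2) := by
  obtain ⟨h1, h2⟩ := h
  fin_cases k <;> simp [sg] at h1 h2 ⊢ <;> grind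

/-- The arcs of any decomposition are the three curves. -/
lemma follows_of_isArcDecomposition {A B : ℝ} (hp : zetaPlus A B = T.ζ)
    (hm : zetaMinus A B = T.ζ') {γL γC : Path (zetaPlus A B) (zetaMinus A B)}
    {γR : Path (zetaMinus A B) (zetaPlus A B)} (h : IsArcDecomposition A B γL γC γR) :
    (∃ x x', T.Follows 0 1 γL.extend x x') ∧
    (∃ x x', T.Follows 1 1 γC.extend x x') ∧
    (∃ x x', T.Follows 2 (-1) γR.extend x x') ∧
    Set.range γC = Set.range (T.arc 1) := by
  have hΓ := h.union
  rw [Gam_eq hp hm] at hΓ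
  obtain ⟨kL, xL, xL', fL, rL⟩ := exists_follows_path (T := T) (h.arcL.cast hp.symm hm.symm)
    (by rw [← hΓ]; intro z hz; exact Or.inl (Or.inl hz))
  obtain ⟨kC, xC, xC', fC, rC⟩ := exists_follows_path (T := T) (h.arcC.cast hp.symm hm.symm)
    (by rw [← hΓ]; intro z hz; exact Or.inl (Or.inr hz))
  -- The right arc has the opposite orientation, so its reversal is analysed and the result is
  -- reversed back, with sign -1.
  obtain ⟨kR, xR, xR', fR, rR⟩ := exists_follows_path (T := T) (h.arcR.symm.cast hp.symm hm.symm)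
    (by
      rw [← hΓ]
      intro z hz
      rw [Path.cast_coe, Path.symm_range] at hz
      exact Or.inr hz)
  have rL : Set.range γL = _ := rL
  have rC : Set.range γC = _ := rC
  rw [Path.cast_coe, Path.symm_range] at rR
  have fL : T.Follows kL 1 γL.extend xL xL' := fL
  have fC : T.Follows kC 1 γC.extend xC xC' := fC
  have fR : T.Follows kR 1 γR.symm.extend xR xR' := fR
  obtain ⟨x, hx1, hx⟩ := h.realL
  rw [rL] at hx
  obtain rfl := (eq_of_location (pt_zero_eq_of_range hx)).1 hx1
  obtain ⟨x, hx1, hx2, hx⟩ := h.realC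
  rw [rC] at hx
  obtain rfl := (eq_of_location (pt_zero_eq_of_range hx)).2.1 hx1 hx2
  obtain ⟨x, hx1, hx⟩ := h.realR
  rw [rR] at hx
  obtain rfl := (eq_of_location (pt_zero_eq_of_range hx)).2.2 hx1
  have fR' := fR.symm
  rw [show (fun t => γR.symm.extend (1 - t)) = γR.extend by
    funext t; rw [Path.extend_symm]; simp] at fR'
  exact ⟨⟨_, _, fL⟩, ⟨_, _, fC⟩, ⟨_, _, fR'⟩, rC⟩

/-- The boundary values of the branch on the arcs. -/
lemma Follows.hasLeftLimit {k : Fin 3} {s : ℝ} {γ : ℝ → ℂ} {x x' : ℝ → ℝ}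
    (h : T.Follows k s γ x x') (hk : k = 1 → s = 1) {t : ℝ} (ht : t ∈ Set.Ioo (0 : ℝ) 1)
    (hreg : deriv γ t ≠ 0) {R : ℂ → ℂ} (hR : ∀ z, z ∉ Set.range (T.arc 1) → R z = T.rootBr z) :
    HasLeftLimit γ R t (side k * ((T.pt k (x t) - T.ζ') * T.lift k (x t))) :=
  hasLeftLimit_rootBr (h.eq t ht) (h.deriv_eq ht) hreg
    (fun hk1 => by simpa [hk hk1] using h.sign t ht) hR

variable (T) in
/-- The branch extended to the central arc by its boundary values from the left. -/
def rootPlus (z : ℂ) : ℂ :=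
  open Classical in
  if z ∈ Set.range (T.arc 1) then (z - T.ζ') * T.lift 1 (T.rad z) else T.rootBr z

lemma rootPlus_pt (k : Fin 3) (x : ℝ) :
    T.rootPlus (T.pt k x) = side k * ((T.pt k x - T.ζ') * T.lift k x) := by
  by_cases hk : k = 1
  · subst hk
    rw [rootPlus, if_pos (by rw [range_arc]; exact Or.inr ⟨x, rfl⟩), rad_pt]
    simp [side]
  · rw [rootPlus, if_neg (pt_notMem hk x)]
    fin_cases k
    · simpa [side] using rootBr_pt_zero x
    · simp at hk
    · simpa [side] using rootBr_pt_two x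

lemma Follows.isPlusBoundaryValue {a b : ℂ} {k : Fin 3} {s : ℝ} {γ : Path a b} {x x' : ℝ → ℝ}
    (h : T.Follows k s γ.extend x x') (hk : k = 1 → s = 1) (hγ : IsAnalyticArc γ) :
    IsPlusBoundaryValue γ T.rootBr T.rootPlus := by
  intro t ht
  rw [h.eq t ht, rootPlus_pt]
  exact h.hasLeftLimit hk ht (hγ.regular t ht) fun _ _ => rfl

/-- The arcs, the branch and its boundary values exist. -/
lemma exists_arcs {A B : ℝ} (hp : zetaPlus A B = T.ζ) (hm : zetaMinus A B = T.ζ') :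
    ∃ (γL γC : Path (zetaPlus A B) (zetaMinus A B)) (γR : Path (zetaMinus A B) (zetaPlus A B))
      (R Rp : ℂ → ℂ), IsArcDecomposition A B γL γC γR ∧ IsRootBranch A B (Set.range γC) R ∧
        IsPlusBoundaryValue γL R Rp ∧ IsPlusBoundaryValue γC R Rp ∧
        IsPlusBoundaryValue γR R Rp := by
  have h := isArcDecomposition (T := T) hp hm
  obtain ⟨⟨_, _, fL⟩, ⟨_, _, fC⟩, ⟨_, _, fR⟩, rC⟩ := follows_of_isArcDecomposition hp hm h
  refine ⟨_, _, _, T.rootBr, T.rootPlus, h, ?_, fL.isPlusBoundaryValue (by decide) h.arcL,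
    fC.isPlusBoundaryValue (fun _ => rfl) h.arcC, fR.isPlusBoundaryValue (by decide) h.arcR⟩
  exact isRootBranch hp hm

/-- The boundary values on the arcs are determined. -/
lemma Follows.eq_of_isPlusBoundaryValue {a b : ℂ} {k : Fin 3} {s : ℝ} {γ : Path a b}
    {x x' : ℝ → ℝ} (h : T.Follows k s γ.extend x x') (hk : k = 1 → s = 1) (hγ : IsAnalyticArc γ)
    {R Rp : ℂ → ℂ} (hR : ∀ z, z ∉ Set.range (T.arc 1) → R z = T.rootBr z)
    (hRp : IsPlusBoundaryValue γ R Rp) {t : ℝ} (ht : t ∈ Set.Ioo (0 : ℝ) 1) :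
    Rp (γ.extend t) = side k * ((T.pt k (x t) - T.ζ') * T.lift k (x t)) :=
  (hRp t ht).unique (hγ.regular t ht) (h.hasLeftLimit hk ht (hγ.regular t ht) hR)

end Triangle

end JacobiZeros

end

/-! ### The phase along a zero curve -/

noncomputable section

namespace JacobiZeros

namespace Triangle

variable {T : Triangle}

variable (T) in
/-- A rotated quotient whose argument measures the angle of the side `j` seen from `lift k x`. -/
def quot (k j : Fin 3) (x : ℝ) : ℂ :=
  sg k j * Complex.I * ((T.lift k x + T.n j) / (T.lift k x - T.n j))

variable (T) in
/-- The imaginary part of the complex potential along the `k`-th curve. -/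
def phase (k : Fin 3) (x : ℝ) : ℝ := ∑ j, T.c j * (Complex.log (T.quot k j x)).im

lemma sg_eq (k j : Fin 3) : sg k j = 1 ∨ sg k j = -1 := by
  fin_cases k <;> fin_cases j <;> simp [sg]

lemma sg_ne (k j : Fin 3) : sg k j ≠ 0 := by
  rcases sg_eq k j with h | h <;> rw [h] <;> norm_num

lemma lift_add_ne (k j : Fin 3) (x : ℝ) : T.lift k x + T.n j ≠ 0 ∧ T.lift k x - T.n j ≠ 0 := by
  have := sub_ne_zero.mpr (lift_sq_ne (T := T) k x j)
  rw [sq_sub_sq] at this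
  exact mul_ne_zero_iff.mp this

lemma normSq_lift (k : Fin 3) (x : ℝ) :
    (T.lift k x).re ^ 2 + (T.lift k x).im ^ 2 = Real.exp x ^ 2 := by
  rw [← norm_lift (T := T) k x, ← Complex.normSq_eq_norm_sq, Complex.normSq_apply]
  ring

lemma normSq_n (j : Fin 3) : (T.n j).re ^ 2 + (T.n j).im ^ 2 = 1 := by
  have := Complex.normSq_eq_norm_sq (T.n j)
  rw [norm_n, Complex.normSq_apply] at this
  linarith

lemma quot_im (k j : Fin 3) (x : ℝ) : (T.quot k j x).im
    = sg k j * ((Real.exp x ^ 2 - 1) / Complex.normSq (T.lift k x - T.n j)) := by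
  rw [quot, mul_assoc, Complex.im_ofReal_mul, Complex.I_mul_im, Complex.div_re, ← add_div,
    ← normSq_lift (T := T) k x, ← normSq_n (T := T) j]
  simp only [Complex.add_re, Complex.add_im, Complex.sub_re, Complex.sub_im]
  ring

lemma quot_zero_re (k j : Fin 3) : (T.quot k j 0).re
    = 2 * (sg k j * Real.sin (T.ang k 0 - T.α j)) / Complex.normSq (T.lift k 0 - T.n j) := by
  have h1 : T.lift k 0 = Complex.exp (T.ang k 0 * Complex.I) := by simp [lift]
  rw [quot, mul_assoc, Complex.re_ofReal_mul, Complex.I_mul_re, Complex.div_im, ← sub_div, h1,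
    Real.sin_sub]
  simp only [Complex.add_re, Complex.add_im, Complex.sub_re, Complex.sub_im, n,
    Complex.exp_ofReal_mul_I_re, Complex.exp_ofReal_mul_I_im]
  ring

/-- For x ≠ 0 the imaginary part is nonzero because |w| ≠ 1. At x = 0 the factor `sg k j` makes the
real part positive. So the principal logarithm is smooth along the entire curve. -/
lemma quot_mem_slitPlane (k j : Fin 3) (x : ℝ) : T.quot k j x ∈ Complex.slitPlane := by
  have hN : 0 < Complex.normSq (T.lift k x - T.n j) := Complex.normSq_pos.mpr (lift_add_ne k j x).2
  by_cases hx : x = 0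
  · subst hx
    refine Or.inl ?_
    rw [quot_zero_re]
    exact div_pos (mul_pos two_pos (sg_mul_sin_pos (ang_zero_mem k) j)) hN
  · refine Or.inr ?_
    rw [quot_im]
    refine mul_ne_zero (sg_ne k j) (div_ne_zero (fun h => hx ?_) hN.ne')
    have h1 : Real.exp x ^ 2 = 1 := by linarith
    rwa [← Real.exp_nat_mul, Real.exp_eq_one_iff, mul_eq_zero, or_iff_right (by norm_num)] at h1

lemma deriv_pt_ne_zero (k : Fin 3) (x : ℝ) : deriv (T.pt k) x ≠ 0 := by
  obtain ⟨d, -, h⟩ := hasDerivAt_relLog (T := T) k x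
  intro h0
  rw [h0, mul_zero] at h
  have := congrArg Complex.re h
  simp at this

/-- The real part is the derivative of the potential along the curve, where the potential is
constantly 0. -/
lemma im_G_lift (k : Fin 3) (x : ℝ) :
    T.G (T.lift k x) * ((1 + T.slope k x * Complex.I) * T.lift k x)
      = ((T.G (T.lift k x) * ((1 + T.slope k x * Complex.I) * T.lift k x)).im : ℂ) * Complex.I := by
  have h1 := hasDerivAt_H (hasDerivAt_lift (T := T) k x) (lift_sq_ne k x)
  have h2 : (fun t => T.H (T.lift k t)) = fun _ => 0 := funext (H_lift k)
  rw [h2] at h1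
  have h3 := h1.unique (hasDerivAt_const x (0 : ℝ))
  apply Complex.ext <;> simp [h3] at *

lemma hasDerivAt_log_quot (k j : Fin 3) (x : ℝ) : HasDerivAt (fun x => Complex.log (T.quot k j x))
    ((1 / (T.lift k x + T.n j) - 1 / (T.lift k x - T.n j))
      * ((1 + T.slope k x * Complex.I) * T.lift k x)) x := by
  obtain ⟨h1, h2⟩ := lift_add_ne (T := T) k j x
  have h3 := (hasDerivAt_lift (T := T) k x)
  have h4 : HasDerivAt (T.quot k j) _ x :=
    ((h3.add_const (T.n j)).div (h3.sub_const (T.n j)) h2).const_mul (sg k j * Complex.I)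
  convert h4.clog_real (quot_mem_slitPlane k j x) using 1
  have h5 : (sg k j : ℂ) ≠ 0 := by exact_mod_cast sg_ne k j
  have h6 := Complex.I_ne_zero
  rw [quot]
  field_simp

lemma hasDerivAt_phase (k : Fin 3) (x : ℝ) : HasDerivAt (T.phase k)
    (T.G (T.lift k x) * ((1 + T.slope k x * Complex.I) * T.lift k x)).im x := by
  have h1 : HasDerivAt (T.phase k) (∑ j, T.c j * ((1 / (T.lift k x + T.n j)
      - 1 / (T.lift k x - T.n j)) * ((1 + T.slope k x * Complex.I) * T.lift k x)).im) x := by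
    refine HasDerivAt.fun_sum fun j _ => ?_
    exact (Complex.imCLM.hasFDerivAt.comp_hasDerivAt x (hasDerivAt_log_quot k j x)).const_mul _
  convert h1 using 1
  rw [G, Finset.sum_mul, Complex.im_sum]
  refine Finset.sum_congr rfl fun j _ => ?_
  rw [mul_assoc, Complex.im_ofReal_mul]

/-- The differential of the measure in terms of the phase. -/
lemma pt_integrand_eq (k : Fin 3) (x : ℝ) :
    T.c₃ * (T.lift k x * (T.pt k x - T.ζ') / (T.pt k x ^ 2 - 1) * deriv (T.pt k) x)
      = -(deriv (T.phase k) x * Complex.I) := by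
  obtain ⟨w', h1, h2⟩ := integrand_eq (hasDerivAt_pt (T := T) k x)
    (hasDerivAt_lift (T := T) k x).continuousAt (Eventually.of_forall fun u => (mob_pt k u).symm)
    (pt_ne_ζ k x) (pt_ne_ζ' k x) (pt_ne k x).1 (pt_ne k x).2
  rw [h2, h1.unique (hasDerivAt_lift k x), (hasDerivAt_phase k x).deriv, ← im_G_lift]

/-- The differential R dz / (z² - 1) vanishes only at the branch points, and the curve is regular.
-/
lemma deriv_phase_ne_zero (k : Fin 3) (x : ℝ) : deriv (T.phase k) x ≠ 0 := by
  intro h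
  have h1 := pt_integrand_eq (T := T) k x
  rw [h] at h1
  obtain ⟨h2, h3⟩ := pt_ne (T := T) k x
  have h4 : T.pt k x ^ 2 - 1 ≠ 0 := by
    rw [show T.pt k x ^ 2 - 1 = (T.pt k x - 1) * (T.pt k x - -1) by ring]
    exact mul_ne_zero (sub_ne_zero.mpr h2) (sub_ne_zero.mpr h3)
  have h5 : (T.c₃ : ℂ) ≠ 0 := T.c₃_ne
  have h6 := mul_ne_zero h5 (mul_ne_zero (div_ne_zero (mul_ne_zero (lift_ne_zero (T := T) k x)
    (sub_ne_zero.mpr (pt_ne_ζ' (T := T) k x))) h4) (deriv_pt_ne_zero (T := T) k x))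
  rw [h1] at h6
  simp at h6

variable (T) in
/-- The total change of the phase along the `k`-th curve, in units of `π`. -/
def total (k : Fin 3) : ℝ := ∑ j, T.c j * sg k j

lemma arg_ofReal_mul_I {s : ℝ} (hs : s = 1 ∨ s = -1) :
    Complex.arg (s * Complex.I) = s * (Real.pi / 2) := by
  rcases hs with rfl | rfl <;> simp

lemma tendsto_im_log {ι : Type*} {l : Filter ι} {q : ι → ℂ} {s : ℝ} (hs : s = 1 ∨ s = -1)
    (h : Tendsto q l (𝓝 (s * Complex.I))) :
    Tendsto (fun i => (Complex.log (q i)).im) l (𝓝 (s * (Real.pi / 2))) := by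
  simp only [Complex.log_im]
  rw [← arg_ofReal_mul_I hs]
  refine (Complex.continuousAt_arg ?_).tendsto.comp h
  refine Or.inr ?_
  rcases hs with rfl | rfl <;> simp

/-- As w tends to ∞, (w + nⱼ) / (w - nⱼ) tends to 1 and only the rotation by i `sg k j` is left. At
the other end w tends to 0, the quotient tends to -1, and the sign is reversed. -/
lemma tendsto_phase_atTop (k : Fin 3) :
    Tendsto (T.phase k) atTop (𝓝 (Real.pi / 2 * T.total k)) := by
  have h1 : Tendsto (fun x => ‖T.lift k x‖) atTop atTop := by
    simp only [norm_lift]; exact Real.tendsto_exp_atTop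
  have h2 : Tendsto (fun x => (T.lift k x)⁻¹) atTop (𝓝 0) :=
    tendsto_inv₀_cobounded.comp (tendsto_norm_atTop_iff_cobounded.mp h1)
  rw [total, Finset.mul_sum]
  refine tendsto_finsetSum _ fun j _ => ?_
  rw [show Real.pi / 2 * (T.c j * sg k j) = T.c j * (sg k j * (Real.pi / 2)) by ring]
  refine (tendsto_im_log (sg_eq k j) ?_).const_mul _
  have h3 : Tendsto (fun x => sg k j * Complex.I * ((1 + T.n j * (T.lift k x)⁻¹)
      / (1 - T.n j * (T.lift k x)⁻¹))) atTop
      (𝓝 (sg k j * Complex.I * ((1 + T.n j * 0) / (1 - T.n j * 0)))) :=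
    (((h2.const_mul _).const_add _).div ((h2.const_mul _).const_sub _) (by simp)).const_mul _
  simp only [mul_zero, add_zero, sub_zero, div_one, mul_one] at h3
  refine h3.congr fun x => ?_
  have hl := lift_ne_zero (T := T) k x
  obtain ⟨-, h5⟩ := lift_add_ne (T := T) k j x
  rw [quot]
  field_simp

lemma tendsto_phase_atBot (k : Fin 3) :
    Tendsto (T.phase k) atBot (𝓝 (-(Real.pi / 2 * T.total k))) := by
  have h2 : Tendsto (T.lift k) atBot (𝓝 0) := by
    rw [tendsto_zero_iff_norm_tendsto_zero]
    simp only [norm_lift]; exact Real.tendsto_exp_atBot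
  rw [total, Finset.mul_sum, ← Finset.sum_neg_distrib]
  refine tendsto_finsetSum _ fun j _ => ?_
  rw [show -(Real.pi / 2 * (T.c j * sg k j)) = T.c j * (-sg k j * (Real.pi / 2)) by ring]
  refine (tendsto_im_log ?_ ?_).const_mul _
  · rcases sg_eq k j with h | h <;> simp [h]
  have h3 : Tendsto (T.quot k j) atBot
      (𝓝 (sg k j * Complex.I * ((0 + T.n j) / (0 - T.n j)))) :=
    ((h2.add_const _).div (h2.sub_const _) (by simpa using n_ne_zero j)).const_mul _
  convert h3 using 2
  have := n_ne_zero (T := T) j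
  push_cast
  field_simp
  simp

/-- The phase is monotone, in the direction of its total change. -/
lemma total_mul_deriv_phase_pos {k : Fin 3} (h : T.total k ≠ 0) (x : ℝ) :
    0 < T.total k * deriv (T.phase k) x := by
  have hpi := Real.pi_pos
  have hd : ∀ x ∈ (Set.univ : Set ℝ),
      HasDerivWithinAt (T.phase k) (deriv (T.phase k) x) Set.univ x := fun x _ =>
    (hasDerivAt_phase k x).differentiableAt.hasDerivAt.hasDerivWithinAt
  rcases hasDerivWithinAt_forall_lt_or_forall_gt_of_forall_ne convex_univ hd
    (fun x _ => deriv_phase_ne_zero k x) with hs | hs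
  · have hanti : StrictAnti (T.phase k) := strictAnti_of_deriv_neg fun x => hs x trivial
    have h1 : T.total k < 0 := by
      have a1 := hanti.antitone.le_of_tendsto (tendsto_phase_atTop k) 0
      have a2 := hanti.antitone.ge_of_tendsto (tendsto_phase_atBot k) 0
      refine lt_of_le_of_ne ?_ h
      nlinarith
    exact mul_pos_of_neg_of_neg h1 (hs x trivial)
  · have hmono : StrictMono (T.phase k) := strictMono_of_deriv_pos fun x => hs x trivial
    have h1 : 0 < T.total k := by
      have a1 := hmono.monotone.ge_of_tendsto (tendsto_phase_atTop k) 0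
      have a2 := hmono.monotone.le_of_tendsto (tendsto_phase_atBot k) 0
      refine lt_of_le_of_ne ?_ h.symm
      nlinarith
    exact mul_pos h1 (hs x trivial)

end Triangle

end JacobiZeros

end

/-! ### The positive measure on each arc -/

noncomputable section

namespace JacobiZeros

/-- After continuous extension to the closed interval, a function with nonnegative derivative has an
integrable derivative. The density may blow up at the end points, where an arbitrary parametrization
is not controlled. -/
lemma integrableOn_Ioo_of_hasDerivAt_of_nonneg {g g' : ℝ → ℝ} {a b l₀ l₁ : ℝ}
    (hg : ∀ t ∈ Set.Ioo a b, HasDerivAt g (g' t) t) (hpos : ∀ t ∈ Set.Ioo a b, 0 ≤ g' t)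
    (h0 : Tendsto g (𝓝[>] a) (𝓝 l₀)) (h1 : Tendsto g (𝓝[<] b) (𝓝 l₁)) :
    IntegrableOn g' (Set.Ioo a b) := by
  have hc : ContinuousOn g (Set.Ioo a b) := fun t ht =>
    (hg t ht).continuousAt.continuousWithinAt
  refine (intervalIntegral.integrableOn_deriv_of_nonneg (g := extendFrom (Set.Ioo a b) g)
    (continuousOn_Icc_extendFrom_Ioo hc h0 h1) (fun t ht => ?_) hpos).mono_set
    Set.Ioo_subset_Ioc_self
  refine (hg t ht).congr_of_eventuallyEq ?_
  filter_upwards [Ioo_mem_nhds ht.1 ht.2] with u hu using extendFrom_extends hc u hu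

/-- A complex line measure with the nonnegative density `g'` with respect to the parameter. -/
lemma exists_measure_lineMeasure {a b : ℂ} {γ : Path a b} (hγ : Function.Injective γ) {f : ℂ → ℂ}
    {g g' : ℝ → ℝ} {l₀ l₁ : ℝ} (hg : ∀ t ∈ Set.Ioo (0 : ℝ) 1, HasDerivAt g (g' t) t)
    (hpos : ∀ t ∈ Set.Ioo (0 : ℝ) 1, 0 ≤ g' t) (h0 : Tendsto g (𝓝[>] 0) (𝓝 l₀))
    (h1 : Tendsto g (𝓝[<] 1) (𝓝 l₁))
    (hf : ∀ t ∈ Set.Ioo (0 : ℝ) 1, f (γ.extend t) * deriv γ.extend t = g' t) :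
    ∃ ν : Measure ℂ, IsFiniteMeasure ν ∧ ν.real Set.univ = l₁ - l₀ ∧ ν (Set.range γ)ᶜ = 0 ∧
      ν {a} = 0 ∧ ν {b} = 0 ∧
      ∀ E, MeasurableSet E → lineMeasure γ f E = ((ν.real E : ℝ) : ℂ) := by
  set m : Measure ℝ := volume.restrict (Set.Ioo 0 1) with hm
  have hmeas : Measurable γ.extend := γ.extend.continuous.measurable
  have hint : Integrable g' m := integrableOn_Ioo_of_hasDerivAt_of_nonneg hg hpos h0 h1
  have hmem : ∀ᵐ t ∂m, t ∈ Set.Ioo (0 : ℝ) 1 := ae_restrict_mem measurableSet_Ioo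
  have hinj : ∀ t ∈ Set.Ioo (0 : ℝ) 1, γ.extend t ≠ a ∧ γ.extend t ≠ b := by
    intro t ht
    rw [Path.extend_apply γ ⟨ht.1.le, ht.2.le⟩]
    constructor
    · intro h
      have := hγ (h.trans γ.source.symm)
      exact ht.1.ne' (congrArg Subtype.val this)
    · intro h
      have := hγ (h.trans γ.target.symm)
      exact ht.2.ne (congrArg Subtype.val this)
  have hnull : ∀ E : Set ℂ, MeasurableSet E → (∀ t ∈ Set.Ioo (0 : ℝ) 1, γ.extend t ∉ E) →
      ((m.withDensity fun t => ENNReal.ofReal (g' t)).map γ.extend) E = 0 := by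
    intro E hE h
    rw [Measure.map_apply hmeas hE]
    refine withDensity_absolutelyContinuous _ _ ?_
    exact measure_mono_null (fun t ht ht' => h t ht' ht) (mem_ae_iff.mp hmem)
  have hreal : ∀ E : Set ℂ, MeasurableSet E →
      ((m.withDensity fun t => ENNReal.ofReal (g' t)).map γ.extend).real E
        = ∫ t in γ.extend ⁻¹' E, g' t ∂m := by
    intro E hE
    rw [measureReal_def, Measure.map_apply hmeas hE, withDensity_apply _ (hmeas hE),
      integral_eq_lintegral_of_nonneg_ae (ae_restrict_of_ae (hmem.mono hpos))
        hint.integrableOn.aestronglyMeasurable]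
  have hfin := isFiniteMeasure_withDensity_ofReal hint.2
  refine ⟨(m.withDensity fun t => ENNReal.ofReal (g' t)).map γ.extend, inferInstance, ?_, ?_, ?_, ?_, fun E hE => ?_⟩
  · rw [hreal _ MeasurableSet.univ, Set.preimage_univ, Measure.restrict_univ, hm,
      ← integral_Ioc_eq_integral_Ioo, ← intervalIntegral.integral_of_le zero_le_one]
    refine intervalIntegral.integral_eq_sub_of_hasDerivAt_of_tendsto zero_lt_one hg ?_ h0 h1
    rwa [intervalIntegrable_iff_integrableOn_Ioo_of_le zero_le_one]
  · refine hnull _ (isCompact_range γ.continuous).isClosed.isOpen_compl.measurableSet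
      fun t ht h => h ?_
    rw [← Path.extend_range]
    exact ⟨t, rfl⟩
  · exact hnull _ (measurableSet_singleton a) fun t ht => (hinj t ht).1
  · exact hnull _ (measurableSet_singleton b) fun t ht => (hinj t ht).2
  · have hae : (fun t => f (γ.extend t) * deriv γ.extend t) =ᵐ[m] fun t => (g' t : ℂ) :=
      hmem.mono hf
    -- The formula for the density is known only for interior parameters; the two end points have
    -- Lebesgue measure zero.
    rw [lineMeasure, ← Measure.restrict_congr_set Ioo_ae_eq_Icc, VectorMeasure.map_apply _ hmeas hE,
      WithDensityᵥEq.congr_ae hae, withDensityᵥ_apply hint.ofReal (hmeas hE), hreal E hE]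
    exact integral_complex_ofReal

namespace Triangle

variable {T : Triangle}

/-- The measure carried by one of the arcs. -/
lemma Follows.exists_measure {A B : ℝ} (hAB : A + B + 2 = T.c₃) {a b : ℂ} {k : Fin 3} {s : ℝ}
    {γ : Path a b} {x x' : ℝ → ℝ} (h : T.Follows k s γ.extend x x') (hk : k = 1 → s = 1)
    (hs : s = 1 ∨ s = -1) (hsign : 0 < -(side k * s * T.total k)) (hγ : IsAnalyticArc γ)
    {R Rp : ℂ → ℂ} (hR : ∀ z, z ∉ Set.range (T.arc 1) → R z = T.rootBr z)
    (hRp : IsPlusBoundaryValue γ R Rp) :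
    ∃ ν : Measure ℂ, IsFiniteMeasure ν ∧ ν.real Set.univ = -(side k * s * T.total k) / 2 ∧
      ν (Set.range γ)ᶜ = 0 ∧ ν {a} = 0 ∧ ν {b} = 0 ∧
      ∀ E, MeasurableSet E → lineMeasure γ (density A B Rp) E = ((ν.real E : ℝ) : ℂ) := by
  have hpi := Real.pi_pos
  have htot : T.total k ≠ 0 := by rintro h0; simp [h0] at hsign
  have hlim : (Tendsto (fun t => T.phase k (x t)) (𝓝[>] 0) (𝓝 (-(Real.pi / 2 * (s * T.total k))))) ∧
      Tendsto (fun t => T.phase k (x t)) (𝓝[<] 1) (𝓝 (Real.pi / 2 * (s * T.total k))) := by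
    rcases hs with rfl | rfl
    · have h1 := h.tendsto_left
      have h2 := h.tendsto_right
      simp only [one_mul] at h1 h2 ⊢
      exact ⟨(tendsto_phase_atBot k).comp h1, (tendsto_phase_atTop k).comp h2⟩
    · have h1 := tendsto_neg_atBot_atTop.comp h.tendsto_left
      have h2 := tendsto_neg_atTop_atBot.comp h.tendsto_right
      simp only [Function.comp_def, neg_mul, one_mul, neg_neg, mul_neg] at h1 h2 ⊢
      exact ⟨(tendsto_phase_atTop k).comp h1, (tendsto_phase_atBot k).comp h2⟩
  have hpos : ∀ t ∈ Set.Ioo (0 : ℝ) 1,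
      0 ≤ -(side k / (2 * Real.pi)) * (deriv (T.phase k) (x t) * x' t) := fun t ht => by
    have a1 := h.sign t ht
    have a2 := total_mul_deriv_phase_pos htot (x t)
    -- The product of three positive quantities equals the density times s² and `total k`², up to
    -- the positive factor 1 / (2π).
    have a3 : 0 < (-(side k * s * T.total k)) * (s * x' t) * (T.total k * deriv (T.phase k) (x t)) :=
      mul_pos (mul_pos hsign a1) a2
    have a4 : s ^ 2 = 1 := by rcases hs with h | h <;> rw [h] <;> norm_num
    have a5 : 0 < -(side k) * (deriv (T.phase k) (x t) * x' t) := by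
      have a6 : 0 < T.total k ^ 2 := by positivity
      refine (mul_pos_iff_of_pos_right a6).mp ?_
      calc _ < _ := a3
        _ = s ^ 2 * (-(side k) * (deriv (T.phase k) (x t) * x' t) * T.total k ^ 2) := by ring
        _ = _ := by rw [a4, one_mul]
    have a7 : -(side k / (2 * Real.pi)) * (deriv (T.phase k) (x t) * x' t)
        = -(side k) * (deriv (T.phase k) (x t) * x' t) / (2 * Real.pi) := by ring
    rw [a7]
    positivity
  have hdens : ∀ t ∈ Set.Ioo (0 : ℝ) 1, density A B Rp (γ.extend t) * deriv γ.extend t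
      = (-(side k / (2 * Real.pi)) * (deriv (T.phase k) (x t) * x' t) : ℝ) := fun t ht => by
    have a1 := pt_integrand_eq (T := T) k (x t)
    rw [density, h.eq_of_isPlusBoundaryValue hk hγ hR hRp ht, h.deriv_eq ht, h.eq t ht]
    have a2 : (A : ℂ) + B + 2 = T.c₃ := by exact_mod_cast congrArg Complex.ofReal hAB
    have a3 : (Real.pi : ℂ) ≠ 0 := by exact_mod_cast hpi.ne'
    rw [a2]
    -- The prefactor 1 / (2πi) cancels against the factor i of the purely imaginary differential.
    calc _ = (side k : ℂ) * x' t / (2 * Real.pi * Complex.I) * (T.c₃ * (T.lift k (x t)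
          * (T.pt k (x t) - T.ζ') / (T.pt k (x t) ^ 2 - 1) * deriv (T.pt k) (x t))) := by ring
      _ = _ := by
        rw [a1]
        push_cast
        field_simp [Complex.I_ne_zero]
  obtain ⟨ν, h1, h2, h3⟩ := exists_measure_lineMeasure hγ.injective (f := density A B Rp)
    (g := fun t => -(side k / (2 * Real.pi)) * T.phase k (x t))
    (g' := fun t => -(side k / (2 * Real.pi)) * (deriv (T.phase k) (x t) * x' t))
    (fun t ht => ((hasDerivAt_phase k (x t)).differentiableAt.hasDerivAt.comp t
      (h.hasDerivAt t ht)).const_mul _) hpos (hlim.1.const_mul _) (hlim.2.const_mul _)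
    hdens
  refine ⟨ν, h1, ?_, h3⟩
  -- The phase changes by π s `total k` along the arc; multiplication by -`side k` / (2π) gives the
  -- mass.
  rw [h2]
  field_simp
  ring

end Triangle

/-- Three finite measures on arcs that meet in null sets. -/
lemma measureReal_add_three {ν₁ ν₂ ν₃ : Measure ℂ} [IsFiniteMeasure ν₁] [IsFiniteMeasure ν₂]
    [IsFiniteMeasure ν₃] {K₁ K₂ K₃ : Set ℂ} {a b : ℂ} (h1 : ν₁ K₁ᶜ = 0)
    (h2 : ν₂ K₂ᶜ = 0) (h3 : ν₃ K₃ᶜ = 0) (h12 : K₁ ∩ K₂ = {a, b}) (h13 : K₁ ∩ K₃ = {a, b})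
    (h2a : ν₂ {a} = 0) (h2b : ν₂ {b} = 0) (h3a : ν₃ {a} = 0) (h3b : ν₃ {b} = 0) :
    ν₁.real K₁ + ν₂.real K₁ + ν₃.real K₁ = ν₁.real Set.univ := by
  have key : ∀ {ν : Measure ℂ} {K : Set ℂ}, ν Kᶜ = 0 → K₁ ∩ K = {a, b} → ν {a} = 0 → ν {b} = 0 →
      ν.real K₁ = 0 := by
    intro ν K hK hint ha hb
    have : ν K₁ = 0 := by
      refine measure_mono_null (t := ({a} ∪ {b}) ∪ Kᶜ) (fun z hz => ?_)
        (measure_union_null (measure_union_null ha hb) hK)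
      by_cases hzK : z ∈ K
      · have : z ∈ ({a, b} : Set ℂ) := hint ▸ ⟨hz, hzK⟩
        exact Or.inl this
      · exact Or.inr hzK
    rw [measureReal_def, this, ENNReal.toReal_zero]
  rw [key h2 h12 h2a h2b, key h3 h13 h3a h3b, add_zero, add_zero, measureReal_def, measureReal_def,
    measure_of_measure_compl_eq_zero h1]

end JacobiZeros

end

/-! ### The triangle that belongs to A and B -/

noncomputable section

namespace JacobiZeros

namespace Triangle

/-- The product in Heron's formula: sixteen times the squared area. -/
def heron (c₁ c₂ c₃ : ℝ) : ℝ := (c₁ + c₂ + c₃) * (-c₁ + c₂ + c₃) * (c₁ - c₂ + c₃) * (c₁ + c₂ - c₃)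

lemma one_sub_cos_law_sq {c₁ c₂ c₃ : ℝ} (h1 : 0 < c₁) (h3 : 0 < c₃) :
    1 - ((c₁ ^ 2 + c₃ ^ 2 - c₂ ^ 2) / (2 * c₁ * c₃)) ^ 2
      = heron c₁ c₂ c₃ / (2 * c₁ * c₃) ^ 2 := by
  rw [heron]
  field_simp
  ring

lemma sin_arccos_cos_law {c₁ c₂ c₃ : ℝ} (h1 : 0 < c₁) (h3 : 0 < c₃) :
    Real.sin (Real.arccos ((c₁ ^ 2 + c₃ ^ 2 - c₂ ^ 2) / (2 * c₁ * c₃)))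
      = √(heron c₁ c₂ c₃) / (2 * c₁ * c₃) := by
  rw [Real.sin_arccos, one_sub_cos_law_sq h1 h3, Real.sqrt_div' _ (sq_nonneg _),
    Real.sqrt_sq (by positivity)]

lemma cos_law_mem {c₁ c₂ c₃ : ℝ} (h1 : 0 < c₁) (h3 : 0 < c₃) (h : 0 < heron c₁ c₂ c₃) :
    -1 < (c₁ ^ 2 + c₃ ^ 2 - c₂ ^ 2) / (2 * c₁ * c₃) ∧
      (c₁ ^ 2 + c₃ ^ 2 - c₂ ^ 2) / (2 * c₁ * c₃) < 1 := by
  have h2 := one_sub_cos_law_sq (c₂ := c₂) h1 h3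
  have h4 : 0 < heron c₁ c₂ c₃ / (2 * c₁ * c₃) ^ 2 := by positivity
  refine abs_lt.mp ((sq_lt_one_iff_abs_lt_one _).mp ?_)
  linarith

lemma heron_swap (c₁ c₂ c₃ : ℝ) : heron c₂ c₁ c₃ = heron c₁ c₂ c₃ := by
  rw [heron, heron]; ring

lemma heron_pos {c₁ c₂ c₃ : ℝ} (h1 : 0 < c₁) (h2 : 0 < c₂) (h3 : 0 < c₃) (t1 : c₁ < c₂ + c₃)
    (t2 : c₂ < c₁ + c₃) (t3 : c₃ < c₁ + c₂) : 0 < heron c₁ c₂ c₃ := by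
  have a1 : 0 < -c₁ + c₂ + c₃ := by linarith
  have a2 : 0 < c₁ - c₂ + c₃ := by linarith
  have a3 : 0 < c₁ + c₂ - c₃ := by linarith
  rw [heron]
  positivity

/-- The triangle with given sides. -/
def ofSides (c₁ c₂ c₃ : ℝ) (h1 : 0 < c₁) (h2 : 0 < c₂) (h3 : 0 < c₃) (t1 : c₁ < c₂ + c₃)
    (t2 : c₂ < c₁ + c₃) (t3 : c₃ < c₁ + c₂) : Triangle where
  c₁ := c₁
  c₂ := c₂
  c₃ := c₃
  P := Real.arccos ((c₁ ^ 2 + c₃ ^ 2 - c₂ ^ 2) / (2 * c₁ * c₃))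
  Q := Real.arccos ((c₂ ^ 2 + c₃ ^ 2 - c₁ ^ 2) / (2 * c₂ * c₃))
  c₁_pos := h1
  c₂_pos := h2
  c₃_pos := h3
  P_pos := Real.arccos_pos.mpr (cos_law_mem h1 h3 (heron_pos h1 h2 h3 t1 t2 t3)).2
  Q_pos := Real.arccos_pos.mpr (cos_law_mem h2 h3 (heron_pos h2 h1 h3 t2 t1 (by linarith))).2
  add_lt_pi := by
    obtain ⟨-, a1⟩ := cos_law_mem h1 h3 (heron_pos h1 h2 h3 t1 t2 t3)
    obtain ⟨-, b1⟩ := cos_law_mem h2 h3 (heron_pos h2 h1 h3 t2 t1 (by linarith))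
    -- This is cos P + cos Q > 0, that is cos P > cos (π - Q), which is equivalent to P + Q < π.
    have key : 0 < (c₁ ^ 2 + c₃ ^ 2 - c₂ ^ 2) / (2 * c₁ * c₃)
        + (c₂ ^ 2 + c₃ ^ 2 - c₁ ^ 2) / (2 * c₂ * c₃) := by
      have e : (c₁ ^ 2 + c₃ ^ 2 - c₂ ^ 2) / (2 * c₁ * c₃)
          + (c₂ ^ 2 + c₃ ^ 2 - c₁ ^ 2) / (2 * c₂ * c₃)
          = (c₁ + c₂) * ((-c₁ + c₂ + c₃) * (c₁ - c₂ + c₃)) / (2 * c₁ * c₂ * c₃) := by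
        field_simp
        ring
      have d1 : 0 < -c₁ + c₂ + c₃ := by linarith
      have d2 : 0 < c₁ - c₂ + c₃ := by linarith
      rw [e]
      positivity
    have := Real.arccos_lt_arccos (x := -((c₂ ^ 2 + c₃ ^ 2 - c₁ ^ 2) / (2 * c₂ * c₃)))
      (y := (c₁ ^ 2 + c₃ ^ 2 - c₂ ^ 2) / (2 * c₁ * c₃)) (by linarith) (by linarith) a1.le
    rw [Real.arccos_neg] at this
    linarith
  close_re := by
    obtain ⟨a0, a1⟩ := cos_law_mem h1 h3 (heron_pos h1 h2 h3 t1 t2 t3)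
    obtain ⟨b0, b1⟩ := cos_law_mem h2 h3 (heron_pos h2 h1 h3 t2 t1 (by linarith))
    rw [Real.cos_arccos a0.le a1.le, Real.cos_arccos b0.le b1.le]
    field_simp
    ring
  close_im := by
    rw [sin_arccos_cos_law h1 h3, sin_arccos_cos_law h2 h3, heron_swap c₁ c₂]
    field_simp

variable {c₁ c₂ c₃ : ℝ} (h1 : 0 < c₁) (h2 : 0 < c₂) (h3 : 0 < c₃) (t1 : c₁ < c₂ + c₃)
  (t2 : c₂ < c₁ + c₃) (t3 : c₃ < c₁ + c₂)

lemma ofSides_ζ : (ofSides c₁ c₂ c₃ h1 h2 h3 t1 t2 t3).ζ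
    = ((c₂ : ℂ) ^ 2 - c₁ ^ 2 + Complex.I * (√(heron c₁ c₂ c₃) : ℝ)) / c₃ ^ 2 := by
  obtain ⟨a0, a1⟩ := cos_law_mem h1 h3 (heron_pos h1 h2 h3 t1 t2 t3)
  have e1 : (c₁ : ℂ) ≠ 0 := by exact_mod_cast h1.ne'
  have e3 : (c₃ : ℂ) ≠ 0 := by exact_mod_cast h3.ne'
  have hn : (ofSides c₁ c₂ c₃ h1 h2 h3 t1 t2 t3).n 0
      = (((c₁ ^ 2 + c₃ ^ 2 - c₂ ^ 2) / (2 * c₁ * c₃) : ℝ) : ℂ)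
        - ((√(heron c₁ c₂ c₃) / (2 * c₁ * c₃) : ℝ) : ℂ) * Complex.I := by
    rw [n, Complex.exp_mul_I, ← Complex.ofReal_cos, ← Complex.ofReal_sin]
    simp only [α, ofSides, Matrix.cons_val_zero, Real.cos_neg, Real.sin_neg,
      Real.cos_arccos a0.le a1.le, sin_arccos_cos_law h1 h3]
    push_cast
    ring
  rw [ζ, hn]
  simp only [ofSides]
  push_cast
  field_simp
  ring

lemma ofSides_ζ' : (ofSides c₁ c₂ c₃ h1 h2 h3 t1 t2 t3).ζ'
    = ((c₂ : ℂ) ^ 2 - c₁ ^ 2 - Complex.I * (√(heron c₁ c₂ c₃) : ℝ)) / c₃ ^ 2 := by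
  rw [ζ', ofSides_ζ]
  simp
  ring

end Triangle

/-- The triangle that belongs to the parameters `A`, `B`. -/
lemma exists_triangle {A B : ℝ} (hA : -1 < A ∧ A < 0) (hB : -1 < B ∧ B < 0)
    (hAB : -2 < A + B ∧ A + B < -1) : ∃ T : Triangle, T.c₁ = -A ∧ T.c₂ = -B ∧ T.c₃ = A + B + 2 ∧
      zetaPlus A B = T.ζ ∧ zetaMinus A B = T.ζ' := by
  obtain ⟨hA1, hA2⟩ := hA
  obtain ⟨hB1, hB2⟩ := hB
  obtain ⟨hAB1, hAB2⟩ := hAB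
  -- The perimeter is 2, and the other three factors in Heron's formula are 2 (A + 1), 2 (B + 1) and
  -- 2 (-A - B - 1).
  have hs : √(Triangle.heron (-A) (-B) (A + B + 2))
      = 4 * √((A + 1) * (B + 1) * (-A - B - 1)) := by
    rw [show Triangle.heron (-A) (-B) (A + B + 2)
      = 4 ^ 2 * ((A + 1) * (B + 1) * (-A - B - 1)) by rw [Triangle.heron]; ring,
      Real.sqrt_mul (by positivity), Real.sqrt_sq (by norm_num)]
  refine ⟨Triangle.ofSides (-A) (-B) (A + B + 2) (by linarith) (by linarith) (by linarith)
    (by linarith) (by linarith) (by linarith), rfl, rfl, rfl, ?_, ?_⟩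
  · rw [Triangle.ofSides_ζ, hs, zetaPlus]
    push_cast
    ring
  · rw [Triangle.ofSides_ζ', hs, zetaMinus]
    push_cast
    ring

end JacobiZeros

end

theorem lemma2p2 (A B : ℝ) (hA : -1 < A ∧ A < 0) (hB : -1 < B ∧ B < 0)
    (hAB : -2 < A + B ∧ A + B < -1) :
    (∃ (γL γC : Path (JacobiZeros.zetaPlus A B) (JacobiZeros.zetaMinus A B))
        (γR : Path (JacobiZeros.zetaMinus A B) (JacobiZeros.zetaPlus A B)) (R Rp : ℂ → ℂ),
        JacobiZeros.IsArcDecomposition A B γL γC γR ∧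
        JacobiZeros.IsRootBranch A B (Set.range γC) R ∧
        JacobiZeros.IsPlusBoundaryValue γL R Rp ∧
        JacobiZeros.IsPlusBoundaryValue γC R Rp ∧
        JacobiZeros.IsPlusBoundaryValue γR R Rp) ∧
    ∀ (γL γC : Path (JacobiZeros.zetaPlus A B) (JacobiZeros.zetaMinus A B))
      (γR : Path (JacobiZeros.zetaMinus A B) (JacobiZeros.zetaPlus A B)) (R Rp : ℂ → ℂ),
      JacobiZeros.IsArcDecomposition A B γL γC γR →
      JacobiZeros.IsRootBranch A B (Set.range γC) R →
      JacobiZeros.IsPlusBoundaryValue γL R Rp →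
      JacobiZeros.IsPlusBoundaryValue γC R Rp →
      JacobiZeros.IsPlusBoundaryValue γR R Rp →
      (∀ E : Set ℂ, MeasurableSet E →
        0 ≤ (JacobiZeros.mu A B γL γC γR Rp E).re ∧
        (JacobiZeros.mu A B γL γC γR Rp E).im = 0) ∧
      (JacobiZeros.mu A B γL γC γR Rp (Set.range γL) = ((1 + A : ℝ) : ℂ) ∧ 0 < 1 + A) ∧
      (JacobiZeros.mu A B γL γC γR Rp (Set.range γC) = ((-1 - A - B : ℝ) : ℂ) ∧
        0 < -1 - A - B) ∧
      (JacobiZeros.mu A B γL γC γR Rp (Set.range γR) = ((1 + B : ℝ) : ℂ) ∧ 0 < 1 + B) ∧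
      ∃ ν : MeasureTheory.Measure ℂ, MeasureTheory.IsProbabilityMeasure ν ∧
        ν (JacobiZeros.Gam A B)ᶜ = 0 ∧
        ∀ E : Set ℂ, MeasurableSet E →
          JacobiZeros.mu A B γL γC γR Rp E = ((ν.real E : ℝ) : ℂ) := by
  obtain ⟨T, e1, e2, e3, hp, hm⟩ := JacobiZeros.exists_triangle hA hB hAB
  refine ⟨JacobiZeros.Triangle.exists_arcs hp hm, fun γL γC γR R Rp hdec hR hL hC hRr => ?_⟩
  obtain ⟨⟨_, _, fL⟩, ⟨_, _, fC⟩, ⟨_, _, fR⟩, rC⟩ :=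
    JacobiZeros.Triangle.follows_of_isArcDecomposition hp hm hdec
  rw [rC] at hR
  have hbr : ∀ z, z ∉ Set.range (T.arc 1) → R z = T.rootBr z := fun z hz =>
    JacobiZeros.Triangle.isRootBranch_eq_rootBr hp hm hR hz
  have tot : ∀ k, T.total k
      = -A * JacobiZeros.Triangle.sg k 0 + -B * JacobiZeros.Triangle.sg k 1 + (A + B + 2) * JacobiZeros.Triangle.sg k 2 := by
    intro k
    simp [JacobiZeros.Triangle.total, Fin.sum_univ_three, JacobiZeros.Triangle.c, e1, e2, e3]
  -- The signed totals are -c₁ + c₂ + c₃, c₁ + c₂ - c₃ and c₁ - c₂ + c₃; each is twice the mass of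
  -- its arc.
  have sL : -(JacobiZeros.Triangle.side 0 * 1 * T.total 0) = 2 * (1 + A) := by
    rw [tot]; simp [JacobiZeros.Triangle.side, JacobiZeros.Triangle.sg]; ring
  have sC : -(JacobiZeros.Triangle.side 1 * 1 * T.total 1) = 2 * (-1 - A - B) := by
    rw [tot]; simp [JacobiZeros.Triangle.side, JacobiZeros.Triangle.sg]; ring
  have sR : -(JacobiZeros.Triangle.side 2 * -1 * T.total 2) = 2 * (1 + B) := by
    rw [tot]; simp [JacobiZeros.Triangle.side, JacobiZeros.Triangle.sg]; ring
  have pA : 0 < 1 + A := by linarith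
  have pB : 0 < 1 + B := by linarith
  have pC : 0 < -1 - A - B := by linarith
  obtain ⟨νL, _, mL, kL, aL, bL, eL⟩ := fL.exists_measure e3.symm (by decide) (Or.inl rfl)
    (by rw [sL]; positivity) hdec.arcL hbr hL
  obtain ⟨νC, _, mC, kC, aC, bC, eC⟩ := fC.exists_measure e3.symm (fun _ => rfl) (Or.inl rfl)
    (by rw [sC]; positivity) hdec.arcC hbr hC
  obtain ⟨νR, _, mR, kR, bR, aR, eR⟩ := fR.exists_measure e3.symm (by decide) (Or.inr rfl)
    (by rw [sR]; positivity) hdec.arcR hbr hRr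
  rw [sL, mul_div_cancel_left₀ _ two_ne_zero] at mL
  rw [sC, mul_div_cancel_left₀ _ two_ne_zero] at mC
  rw [sR, mul_div_cancel_left₀ _ two_ne_zero] at mR
  have hmu : ∀ E, MeasurableSet E → JacobiZeros.mu A B γL γC γR Rp E
      = ((νL.real E + νC.real E + νR.real E : ℝ) : ℂ) := by
    intro E hE
    rw [JacobiZeros.mu, add_apply, add_apply, eL E hE, eC E hE, eR E hE]
    push_cast
    rfl
  have hmeas : ∀ {a b : ℂ} (γ : Path a b), MeasurableSet (Set.range γ) := fun γ =>
    (isCompact_range γ.continuous).isClosed.measurableSet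
  have iLC := hdec.interLC
  have iLR := hdec.interLR
  have iCR := hdec.interCR
  refine ⟨fun E hE => ?_, ⟨?_, pA⟩, ⟨?_, pC⟩, ⟨?_, pB⟩, νL + νC + νR, ⟨?_⟩, ?_, fun E hE => ?_⟩
  · rw [hmu E hE, Complex.ofReal_re, Complex.ofReal_im]
    exact ⟨by positivity, rfl⟩
  · rw [hmu _ (hmeas γL), JacobiZeros.measureReal_add_three kL kC kR iLC iLR aC bC aR bR, mL]
  · rw [hmu _ (hmeas γC), add_comm (νL.real _), JacobiZeros.measureReal_add_three kC kL kR
      (by rw [Set.inter_comm]; exact iLC) iCR aL bL aR bR, mC]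
  · rw [hmu _ (hmeas γR), add_comm, ← add_assoc, JacobiZeros.measureReal_add_three kR kL kC
      (by rw [Set.inter_comm]; exact iLR) (by rw [Set.inter_comm]; exact iCR) aL bL aC bC, mR]
  · have h : (νL + νC + νR).real Set.univ = 1 := by
      rw [measureReal_add_apply, measureReal_add_apply, mL, mC, mR]
      ring
    rwa [measureReal_def, ENNReal.toReal_eq_one_iff] at h
  · have hsub : ∀ {ν : Measure ℂ} {K : Set ℂ}, ν Kᶜ = 0 → K ⊆ JacobiZeros.Gam A B →
        ν (JacobiZeros.Gam A B)ᶜ = 0 := fun h hK =>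
      measure_mono_null (Set.compl_subset_compl.mpr hK) h
    have hΓ := hdec.union
    rw [Measure.add_apply, Measure.add_apply, hsub kL, hsub kC, hsub kR, add_zero, add_zero] <;>
      rw [← hΓ] <;> intro z hz
    · exact Or.inr hz
    · exact Or.inl (Or.inr hz)
    · exact Or.inl (Or.inl hz)
  · rw [hmu E hE, measureReal_add_apply, measureReal_add_apply]
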